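/- For a real number $\mu>-1$ and $d\ge 1$ let $\mathbb{B}^d$ be the open Euclidean unit ball of $\mathbb{C}^d$, let $$dv_\mu(z)=\frac{\Gamma(d+\mu+1)}{\pi^d\,\Gamma(\mu+1)}(1-|z|^2)^\mu\,dv(z),$$ where $dv$ is Lebesgue measure, and let $\mathcal{A}^2_\mu(\mathbb{B}^d)\subset L^2(\mathbb{B}^d,dv_\mu)$ be the Hilbert space of square integrable holomorphic functions, with the standard orthonormal basis $$e^\mu_\alpha(z)=\sqrt{\tfrac{\Gamma(d+|\alpha|+\mu+1)}{\alpha!\,\Gamma(d+\mu+1)}}\;z^\alpha,\qquad \alpha\in\mathbb{Z}_+^d .$$ For $f\in L^\infty(\mathbb{B}^d)$ the Toeplitz operator $T^\mu_f$ on $\mathcal{A}^2_\mu(\mathbb{B}^d)$ is $T^\mu_f h=P_\mu(fh)$, with $P_\mu$ the orthogonal projection of $L^2(\mathbb{B}^d,dv_\mu)$ onto $\mathcal{A}^2_\mu(\mathbb{B}^d)$. Let $\mathrm{BUC}(\mathbb{B}^d)$ be the algebra of bounded complex functions on $\mathbb{B}^d$ that are uniformly continuous with respect to the Bergman metric, and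 let $\mathcal{T}_\mu(\mathrm{BUC}(\mathbb{B}^d))$ be the $C^*$-algebra generated by all $T^\mu_c$, $c\in\mathrm{BUC}(\mathbb{B}^d)$. Its semi-commutator ideal is its closed two-sided ideal generated by all $T^\mu_aT^\mu_b-T^\mu_{ab}$, $a,b\in\mathrm{BUC}(\mathbb{B}^d)$. Let $1\le\ell\le n-1$, $\lambda>-1$, and let $\ell=k_1+\cdots+k_m$ with integers $m\ge1$ and $k_j\ge 1$. Write $z=(z',z'')\in\mathbb{C}^\ell\times\mathbb{C}^{n-\ell}$ and $\alpha=(\alpha',\alpha'')$, and divide $\alpha'=(\alpha_{(1)},\dots,\alpha_{(m)})$ into consecutive groups of lengths $k_1,\dots,k_m$. For $\rho\in\mathbb{Z}_+^m$ let $\mathscr{H}_\rho\subset\mathcal{A}^2_\lambda(\mathbb{B}^\ell)$ be the finite-dimensional span of the $e^\lambda_{\alpha'}$ with $|\alpha_{(j)}|=\rho_j$ for $j=1,\dots,m$. Let $\boldsymbol{\mathcal{T}}_\lambda(1,\mathrm{BUC}(\mathbb{B}^{n-\ell}))$ be the $C^*$-algebra of operators on $\mathcal{A}^2_\lambda(\mathbb{B}^n)$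 generated by the Toeplitz operators with symbols $f_c(z',z'')=c(z'')$, $c\in\mathrm{BUC}(\mathbb{B}^{n-\ell})$. **Theorem.** There is exactly one unitary operator $$U:\mathcal{A}^2_\lambda(\mathbb{B}^n)\longrightarrow\bigoplus_{\rho\in\mathbb{Z}_+^m}\mathscr{H}_\rho\otimes\mathcal{A}^2_{\lambda+|\rho|+\ell}(\mathbb{B}^{n-\ell})$$ that maps every $e^\lambda_\alpha$ to $e^\lambda_{\alpha'}\otimes e^{\lambda+|\rho|+\ell}_{\alpha''}$ in the summand with $\rho=(|\alpha_{(1)}|,\dots,|\alpha_{(m)}|)$. For this $U$, each operator $\mathbf{T}\in\boldsymbol{\mathcal{T}}_\lambda(1,\mathrm{BUC}(\mathbb{B}^{n-\ell}))$ has a unique representation $$U\,\mathbf{T}\,U^{-1}=\bigoplus_{\rho\in\mathbb{Z}_+^m} I\otimes\bigl(T_c^{\lambda+|\rho|+\ell}+N^{\lambda+|\rho|+\ell}\bigr),$$ where $c\in\mathrm{BUC}(\mathbb{B}^{n-\ell})$, each $N^{\lambda+|\rho|+\ell}$ belongs to the semi-commutator ideal of $\mathcal{T}_{\lambda+|\rho|+\ell}(\mathrm{BUC}(\mathbb{B}^{n-\ell}))$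 and depends on $\rho$ only through $|\rho|$, and $\|N^{\lambda+|\rho|+\ell}\|\to0$ as $|\rho|\to\infty$. The function $c$ and the operators $N^{\lambda+|\rho|+\ell}$ are unique even among families $(N_\rho)_{\rho\in\mathbb{Z}_+^m}$ with these properties that may depend on all of $\rho$. -/

import Mathlib

open MeasureTheory Metric Set Filter Topology
open scoped ENNReal TensorProduct

namespace BergmanToeplitz

noncomputable section

/-- `ℂ^d` with its Euclidean norm. -/
abbrev Cn (d : ℕ) : Type := EuclideanSpace ℂ (Fin d)

/-- The open unit ball `𝔹^d` of `ℂ^d`, as a type. -/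
abbrev Ball (d : ℕ) : Type := ↥(ball (0 : Cn d) 1)

/-- Weight parameters: real numbers `> -1`. -/
abbrev Weight : Type := {μ : ℝ // -1 < μ}

/-- The weight `μ + p`. -/
def Weight.shift (μ : Weight) (p : ℕ) : Weight :=
  ⟨(μ : ℝ) + p, lt_of_lt_of_le μ.2 (le_add_of_nonneg_right p.cast_nonneg)⟩

/-- The density `c_μ (1 - |z|²)^μ`, with `c_μ = Γ(d + μ + 1) / (π^d Γ(μ + 1))`. -/
def weightFun (d : ℕ) (μ : Weight) (z : Cn d) : ℝ :=
  Real.Gamma (d + μ + 1) / (Real.pi ^ d * Real.Gamma (μ + 1)) * (1 - ‖z‖ ^ 2) ^ (μ : ℝ)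

/-- The weighted measure `dv_μ = c_μ (1 - |z|²)^μ dv` on the unit ball of `ℂ^d`. -/
def weightedMeasure (d : ℕ) (μ : Weight) : Measure (Cn d) :=
  ((volume : Measure (Cn d)).restrict (ball 0 1)).withDensity
    fun z => ENNReal.ofReal (weightFun d μ z)

lemma weightFun_const_pos (d : ℕ) (μ : Weight) :
    0 < Real.Gamma (d + μ + 1) / (Real.pi ^ d * Real.Gamma (μ + 1)) := by
  have h := μ.2
  have h1 : 0 < Real.Gamma (d + (μ : ℝ) + 1) :=
    Real.Gamma_pos_of_pos (by have : (0 : ℝ) ≤ d := d.cast_nonneg; linarith)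
  have h2 : 0 < Real.Gamma ((μ : ℝ) + 1) := Real.Gamma_pos_of_pos (by linarith)
  positivity

lemma one_sub_normSq_pos {d : ℕ} {z : Cn d} (hz : z ∈ ball (0 : Cn d) 1) : 0 < 1 - ‖z‖ ^ 2 := by
  have h : ‖z‖ < 1 := by simpa using hz
  nlinarith [norm_nonneg z]

lemma continuousOn_weightFun (d : ℕ) (μ : Weight) : ContinuousOn (weightFun d μ) (ball 0 1) := by
  refine continuousOn_const.mul (ContinuousOn.rpow_const (by fun_prop) fun z hz => Or.inl ?_)
  exact (one_sub_normSq_pos hz).ne'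

lemma weightFun_pos {d : ℕ} {μ : Weight} {z : Cn d} (hz : z ∈ ball (0 : Cn d) 1) :
    0 < weightFun d μ z :=
  mul_pos (weightFun_const_pos d μ) (Real.rpow_pos_of_pos (one_sub_normSq_pos hz) _)

lemma measurable_weightFun (d : ℕ) (μ : Weight) : Measurable (weightFun d μ) := by
  unfold weightFun; fun_prop

lemma weightedMeasure_ac (d : ℕ) (μ : Weight) :
    weightedMeasure d μ ≪ (volume : Measure (Cn d)).restrict (ball 0 1) :=
  withDensity_absolutelyContinuous _ _

lemma ae_mem_ball (d : ℕ) (μ : Weight) : ∀ᵐ z ∂(weightedMeasure d μ), z ∈ ball (0 : Cn d) 1 :=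
  (weightedMeasure_ac d μ).ae_le (ae_restrict_mem measurableSet_ball)

instance isFiniteMeasure_weightedMeasure (d : ℕ) (μ : Weight) :
    IsFiniteMeasure (weightedMeasure d μ) := by
  refine isFiniteMeasure_withDensity_ofReal ?_
  refine Integrable.hasFiniteIntegral ?_
  change IntegrableOn (weightFun d μ) (ball 0 1) volume
  rcases Nat.eq_zero_or_pos d with rfl | hd
  · have : Subsingleton (Cn 0) := inferInstance
    have : weightFun 0 μ = fun _ => weightFun 0 μ 0 := by
      ext z; rw [Subsingleton.elim z 0]
    rw [this]
    exact integrableOn_const measure_ball_lt_top.ne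
  · have : NeZero d := ⟨hd.ne'⟩
    have : Nontrivial (Cn d) := inferInstance
    refine Integrable.const_mul ?_ _
    change IntegrableOn (fun z : Cn d => (1 - ‖z‖ ^ 2) ^ (μ : ℝ)) (ball 0 1) volume
    rw [← integrable_indicator_iff measurableSet_ball]
    have e : (ball (0 : Cn d) 1).indicator (fun z : Cn d => (1 - ‖z‖ ^ 2) ^ (μ : ℝ)) =
        fun z => (Iio (1 : ℝ)).indicator (fun r : ℝ => (1 - r ^ 2) ^ (μ : ℝ)) ‖z‖ := by
      ext z
      simp [indicator]
    rw [e, integrable_fun_norm_addHaar]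
    set D := Module.finrank ℝ (Cn d) - 1
    have hμ := μ.2
    have base : IntegrableOn (fun r : ℝ => (1 - r) ^ (μ : ℝ)) (Ioo 0 1) volume := by
      have h1 : IntervalIntegrable (fun x : ℝ => x ^ (μ : ℝ)) volume 0 1 :=
        intervalIntegral.intervalIntegrable_rpow' hμ
      have h2 := (h1.comp_sub_left 1).symm
      simp only [sub_zero, sub_self] at h2
      rw [intervalIntegrable_iff_integrableOn_Ioo_of_le zero_le_one] at h2
      exact h2
    have key : IntegrableOn (fun r : ℝ => r ^ D • (1 - r ^ 2) ^ (μ : ℝ)) (Ioo 0 1) volume := by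
      have : IntegrableOn (fun r : ℝ => (r ^ D * (1 + r) ^ (μ : ℝ)) * (1 - r) ^ (μ : ℝ))
          (Ioo 0 1) volume := by
        refine Integrable.bdd_mul (c := max ((2:ℝ) ^ (μ : ℝ)) 1) base (by fun_prop) ?_
        filter_upwards [ae_restrict_mem measurableSet_Ioo] with r hr
        have hr0 : 0 ≤ r := hr.1.le
        have hb : (1 + r) ^ (μ : ℝ) ≤ max ((2:ℝ) ^ (μ : ℝ)) 1 := by
          rcases le_total 0 (μ : ℝ) with h | h
          · exact (Real.rpow_le_rpow (by linarith) (by linarith [hr.2]) h).trans (le_max_left _ _)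
          · exact (Real.rpow_le_one_of_one_le_of_nonpos (by linarith) h).trans (le_max_right _ _)
        have h0 : 0 ≤ (1 + r) ^ (μ : ℝ) := by positivity
        rw [Real.norm_of_nonneg (by positivity)]
        exact (mul_le_of_le_one_left h0 (pow_le_one₀ hr0 hr.2.le)).trans hb
      refine this.congr_fun (fun r hr => ?_) measurableSet_Ioo
      have : (1 - r ^ 2 : ℝ) = (1 + r) * (1 - r) := by ring
      simp only [smul_eq_mul]
      rw [this, Real.mul_rpow (by linarith [hr.1]) (by linarith [hr.2])]
      ring
    have e2 : (fun y : ℝ => y ^ D • (Iio (1 : ℝ)).indicator (fun r : ℝ => (1 - r ^ 2) ^ (μ : ℝ)) y)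
        = (Iio (1 : ℝ)).indicator fun r : ℝ => r ^ D • (1 - r ^ 2) ^ (μ : ℝ) := by
      ext y; simp only [indicator]; split_ifs <;> simp
    rw [e2, IntegrableOn, integrable_indicator_iff measurableSet_Iio, IntegrableOn,
      Measure.restrict_restrict measurableSet_Iio, inter_comm, Ioi_inter_Iio]
    exact key

/-- Rotations preserve the volume, hence integrals of functions of `w`. -/
lemma lintegral_rotation {d : ℕ} (u : Circle) (z : Cn d) {F : Cn d → ℝ≥0∞} (hF : Measurable F) :
    ∫⁻ w, F (z + (u : ℂ) • w) = ∫⁻ w, F w := by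
  let R : Cn d ≃ₗᵢ[ℝ] Cn d := LinearIsometryEquiv.piLpCongrRight 2 fun _ => rotation u
  have hR : ∀ w, R w = (u : ℂ) • w := by
    intro w; ext i; simp [R, rotation_apply]
  have h1 := (R.measurePreserving).lintegral_comp (f := fun w => F (z + w)) (by fun_prop)
  simp only [hR] at h1
  rw [h1, lintegral_add_left_eq_self]

/-- The mean value inequality over Euclidean balls of `ℂ^d`. -/
lemma mean_value_ineq {d : ℕ} {g : Cn d → ℂ} {z : Cn d} {r : ℝ}
    (hsub : ball z r ⊆ ball (0 : Cn d) 1) (hg : DifferentiableOn ℂ g (ball 0 1)) :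
    ‖g z‖ₑ * volume (ball (0 : Cn d) r) ≤ ∫⁻ w in ball z r, ‖g w‖ₑ := by
  classical
  set F : Cn d → ℝ≥0∞ := (ball z r).indicator (fun w => ‖g w‖ₑ) with hF
  have hFm : Measurable F := by
    have hc : ContinuousOn (fun w => ‖g w‖ₑ) (ball z r) :=
      continuous_enorm.comp_continuousOn (hg.continuousOn.mono hsub)
    have := ContinuousOn.measurable_piecewise hc
      (continuous_const (y := (0 : ℝ≥0∞))).continuousOn measurableSet_ball
    convert this using 1
    ext w; simp [F, indicator, piecewise]
  have hFi : ∫⁻ w in ball z r, ‖g w‖ₑ = ∫⁻ w, F w := by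
    rw [hF, lintegral_indicator measurableSet_ball]
  let H : Cn d → ℝ → ℝ≥0∞ := fun w θ => F (z + (Circle.exp θ : ℂ) • w)
  have hHm : Measurable (Function.uncurry H) := by
    refine hFm.comp (Continuous.measurable ?_)
    fun_prop
  have A : ∀ w ∈ ball (0 : Cn d) r,
      ‖g z‖ₑ * ENNReal.ofReal (2 * Real.pi) ≤ ∫⁻ θ in Ioc 0 (2 * Real.pi), H w θ := by
    intro w hw
    have hw' : ‖w‖ < r := by simpa using hw
    have hmem : ∀ ζ : ℂ, ‖ζ‖ ≤ 1 → z + ζ • w ∈ ball z r := by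
      intro ζ hζ
      simp only [mem_ball, dist_self_add_left, norm_smul]
      exact lt_of_le_of_lt (mul_le_of_le_one_left (norm_nonneg _) hζ) hw'
    let φ : ℂ → ℂ := fun ζ => g (z + ζ • w)
    have hφ : DifferentiableOn ℂ φ ((fun ζ : ℂ => z + ζ • w) ⁻¹' ball 0 1) :=
      hg.comp (by fun_prop) (fun ζ hζ => hζ)
    have hd : DiffContOnCl ℂ φ (ball 0 |1|) := by
      refine hφ.diffContOnCl_ball fun ζ hζ => hsub (hmem ζ ?_)
      simpa using hζ
    have h1 := hd.circleAverage
    rw [Real.circleAverage_def, intervalIntegral.integral_of_le Real.two_pi_pos.le] at h1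
    have h2 : φ 0 = g z := by simp [φ]
    have h3 : ∀ θ : ℝ, ‖φ (circleMap 0 1 θ)‖ₑ = H w θ := by
      intro θ
      have : circleMap 0 1 θ = (Circle.exp θ : ℂ) := by simp [circleMap]
      rw [this]
      simp only [φ, H, hF]
      rw [indicator_of_mem (hmem _ (by simp))]
    have h4 : ‖∫ θ in Ioc 0 (2 * Real.pi), φ (circleMap 0 1 θ)‖ₑ
        ≤ ∫⁻ θ in Ioc 0 (2 * Real.pi), H w θ := by
      refine (enorm_integral_le_lintegral_enorm _).trans_eq ?_
      simp only [h3]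
    have h5 : ∫ θ in Ioc 0 (2 * Real.pi), φ (circleMap 0 1 θ) = (2 * Real.pi) • g z := by
      rw [← h2, ← h1, smul_smul, mul_inv_cancel₀ Real.two_pi_pos.ne', one_smul]
    rw [h5, enorm_smul, mul_comm, Real.enorm_of_nonneg Real.two_pi_pos.le] at h4
    exact h4
  have B : ∫⁻ w in ball (0 : Cn d) r, ∫⁻ θ in Ioc 0 (2 * Real.pi), H w θ
      ≤ (∫⁻ w, F w) * ENNReal.ofReal (2 * Real.pi) := by
    rw [lintegral_lintegral_swap hHm.aemeasurable]
    calc ∫⁻ θ in Ioc 0 (2 * Real.pi), ∫⁻ w in ball (0 : Cn d) r, H w θ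
        ≤ ∫⁻ _θ in Ioc 0 (2 * Real.pi), ∫⁻ w, F w := by
          refine lintegral_mono fun θ => ?_
          exact (setLIntegral_le_lintegral _ _).trans_eq (lintegral_rotation _ z hFm)
      _ = _ := by simp
  have C : ‖g z‖ₑ * ENNReal.ofReal (2 * Real.pi) * volume (ball (0 : Cn d) r)
      ≤ ∫⁻ w in ball (0 : Cn d) r, ∫⁻ θ in Ioc 0 (2 * Real.pi), H w θ := by
    rw [← setLIntegral_const]
    exact setLIntegral_mono' measurableSet_ball A
  rw [hFi]
  have D := C.trans B
  have hp : ENNReal.ofReal (2 * Real.pi) ≠ 0 := by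
    simpa using Real.pi_pos
  rw [mul_right_comm] at D
  exact (ENNReal.mul_le_mul_iff_left hp ENNReal.ofReal_ne_top).1 D

/-- Point evaluations of holomorphic functions are locally uniformly bounded in `L²`. -/
lemma point_bound {d : ℕ} (μ : Weight) {z : Cn d} (hz : z ∈ ball (0 : Cn d) 1) :
    ∃ C : ℝ≥0∞, C ≠ ∞ ∧ ∃ s > 0, ball z s ⊆ ball (0 : Cn d) 1 ∧ ∀ w ∈ ball z s,
      ∀ g : Cn d → ℂ, DifferentiableOn ℂ g (ball 0 1) →
        ‖g w‖ₑ ≤ C * eLpNorm g 2 (weightedMeasure d μ) := by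
  obtain ⟨t, ht, hts⟩ : ∃ t > 0, closedBall z t ⊆ ball (0 : Cn d) 1 :=
    nhds_basis_closedBall.mem_iff.1 (isOpen_ball.mem_nhds hz)
  obtain ⟨m, hm, hmw⟩ : ∃ m : ℝ, 0 < m ∧ ∀ w ∈ closedBall z t, m ≤ weightFun d μ w := by
    obtain ⟨x, hx, hmin⟩ := (isCompact_closedBall z t).exists_isMinOn
      (nonempty_closedBall.2 ht.le) ((continuousOn_weightFun d μ).mono hts)
    exact ⟨_, weightFun_pos (hts hx), fun w hw => hmin hw⟩
  set V : Measure (Cn d) := volume.restrict (ball z t) with hV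
  have hVle : V ≤ (ENNReal.ofReal m)⁻¹ • weightedMeasure d μ := by
    have hm0 : ENNReal.ofReal m ≠ 0 := by simpa using hm
    have : ENNReal.ofReal m • V ≤ weightedMeasure d μ := by
      refine Measure.le_iff.2 fun s hs => ?_
      have hsub : ball z t ⊆ ball (0 : Cn d) 1 := ball_subset_closedBall.trans hts
      rw [weightedMeasure, withDensity_apply _ hs, Measure.restrict_restrict hs,
        Measure.smul_apply, hV, Measure.restrict_apply hs, smul_eq_mul, ← setLIntegral_const]
      refine (setLIntegral_mono' (hs.inter measurableSet_ball) fun w hw => ?_).trans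
        (lintegral_mono_set (inter_subset_inter_right _ hsub))
      exact ENNReal.ofReal_le_ofReal (hmw w (ball_subset_closedBall hw.2))
    calc V = (ENNReal.ofReal m)⁻¹ • (ENNReal.ofReal m • V) := by
          rw [smul_smul, ENNReal.inv_mul_cancel hm0 ENNReal.ofReal_ne_top, one_smul]
      _ ≤ _ := by gcongr
  have hvol : volume (ball (0 : Cn d) (t / 2)) ≠ 0 := (measure_ball_pos _ _ (by positivity)).ne'
  have hvolt : volume (ball (0 : Cn d) (t / 2)) ≠ ∞ := measure_ball_lt_top.ne
  have hVt : V univ ≠ ∞ := by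
    rw [hV, Measure.restrict_apply_univ]; exact measure_ball_lt_top.ne
  have hm0 : ENNReal.ofReal m ≠ 0 := by simpa using hm
  refine ⟨(volume (ball (0 : Cn d) (t / 2)))⁻¹ *
    (((ENNReal.ofReal m)⁻¹) ^ (1 / (2 : ℝ≥0∞)).toReal *
      V univ ^ (1 / (1 : ℝ≥0∞).toReal - 1 / (2 : ℝ≥0∞).toReal)), ?_, t / 2, by positivity,
    (ball_subset_ball (by linarith)).trans (ball_subset_closedBall.trans hts), ?_⟩
  · refine ENNReal.mul_ne_top (ENNReal.inv_ne_top.2 hvol) (ENNReal.mul_ne_top ?_ ?_)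
    · exact ENNReal.rpow_ne_top_of_nonneg (by positivity) (ENNReal.inv_ne_top.2 hm0)
    · exact ENNReal.rpow_ne_top_of_nonneg (by norm_num) hVt
  intro w hw g hg
  have hwt : ball w (t / 2) ⊆ ball z t := by
    refine ball_subset_ball' ?_
    have := (mem_ball.1 hw).le
    linarith
  have hzt : ball z t ⊆ ball (0 : Cn d) 1 := ball_subset_closedBall.trans hts
  have h1 := mean_value_ineq (hwt.trans hzt) hg
  have h2 : ∫⁻ x in ball w (t / 2), ‖g x‖ₑ ≤ eLpNorm g 1 V := by
    rw [eLpNorm_one_eq_lintegral_enorm, hV]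
    exact lintegral_mono_set hwt
  have hgV : AEStronglyMeasurable g V :=
    (hg.continuousOn.mono hzt).aestronglyMeasurable measurableSet_ball
  have h3 := eLpNorm_le_eLpNorm_mul_rpow_measure_univ (one_le_two : (1 : ℝ≥0∞) ≤ 2) hgV
  have h4 : eLpNorm g 2 V ≤ ((ENNReal.ofReal m)⁻¹) ^ (1 / (2 : ℝ≥0∞)).toReal *
      eLpNorm g 2 (weightedMeasure d μ) := by
    refine (eLpNorm_mono_measure g hVle).trans_eq ?_
    rw [eLpNorm_smul_measure_of_ne_top (by norm_num), smul_eq_mul]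
  have h5 : ‖g w‖ₑ ≤ (volume (ball (0 : Cn d) (t / 2)))⁻¹ *
      (‖g w‖ₑ * volume (ball (0 : Cn d) (t / 2))) := by
    rw [mul_left_comm, ENNReal.inv_mul_cancel hvol hvolt, mul_one]
  refine h5.trans ?_
  rw [mul_assoc]
  refine mul_le_mul_right ?_ _
  refine (h1.trans (h2.trans h3)).trans ?_
  calc _ ≤ (((ENNReal.ofReal m)⁻¹) ^ (1 / (2 : ℝ≥0∞)).toReal *
      eLpNorm g 2 (weightedMeasure d μ)) *
        V univ ^ (1 / (1 : ℝ≥0∞).toReal - 1 / (2 : ℝ≥0∞).toReal) := by gcongr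
    _ = _ := by ring

/-- The weighted Bergman space `𝒜²_μ(𝔹^d)` as a subspace of `L²(dv_μ)`: the classes in `L²(dv_μ)` of functions that are
holomorphic on the unit ball. -/
def bergmanSubmodule (d : ℕ) (μ : Weight) : Submodule ℂ (Lp ℂ 2 (weightedMeasure d μ)) where
  carrier := {f | ∃ g : Cn d → ℂ, DifferentiableOn ℂ g (ball 0 1) ∧ f =ᵐ[weightedMeasure d μ] g}
  add_mem' := by
    rintro f₁ f₂ ⟨g₁, h₁, e₁⟩ ⟨g₂, h₂, e₂⟩
    exact ⟨g₁ + g₂, h₁.add h₂, (Lp.coeFn_add f₁ f₂).trans (e₁.add e₂)⟩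
  zero_mem' := ⟨0, differentiableOn_const 0, Lp.coeFn_zero _ _ _⟩
  smul_mem' := by
    rintro a f ⟨g, h, e⟩
    exact ⟨a • g, h.const_smul a, (Lp.coeFn_smul a f).trans (e.const_smul a)⟩

lemma isClosed_bergmanSubmodule (d : ℕ) (μ : Weight) :
    IsClosed (bergmanSubmodule d μ : Set (Lp ℂ 2 (weightedMeasure d μ))) := by
  refine IsSeqClosed.isClosed fun f F hf hlim => ?_
  choose g hg hfg using hf
  have hdist : ∀ i j, eLpNorm (g i - g j) 2 (weightedMeasure d μ) = edist (f i) (f j) := by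
    intro i j
    rw [Lp.edist_def]
    exact (eLpNorm_congr_ae ((hfg i).sub (hfg j))).symm
  have hcau : CauchySeq f := hlim.cauchySeq
  -- locally uniform Cauchy estimates
  have hunif : ∀ z ∈ ball (0 : Cn d) 1, ∃ s > 0, ball z s ⊆ ball (0 : Cn d) 1 ∧
      ∀ ε > 0, ∃ K : ℕ, ∀ i ≥ K, ∀ j ≥ K, ∀ w ∈ ball z s, ‖g i w - g j w‖ ≤ ε := by
    intro z hz
    obtain ⟨C, hC, s, hs, hsub, hb⟩ := point_bound μ hz
    refine ⟨s, hs, hsub, fun ε hε => ?_⟩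
    have hpos : (0 : ℝ≥0∞) < ENNReal.ofReal ε / (C + 1) :=
      ENNReal.div_pos (by simpa using hε) (by simp [hC])
    obtain ⟨K, hK⟩ := EMetric.cauchySeq_iff.1 hcau _ hpos
    refine ⟨K, fun i hi j hj w hw => ?_⟩
    have h1 := hb w hw (g i - g j) ((hg i).sub (hg j))
    rw [hdist] at h1
    have h2 : ‖(g i - g j) w‖ₑ ≤ ENNReal.ofReal ε := by
      refine h1.trans ?_
      calc C * edist (f i) (f j) ≤ (C + 1) * (ENNReal.ofReal ε / (C + 1)) :=
            mul_le_mul' le_self_add (hK i hi j hj).le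
        _ = _ := ENNReal.mul_div_cancel (by simp) (by simp [hC])
    rw [← ofReal_norm] at h2
    exact (ENNReal.ofReal_le_ofReal_iff hε.le).1 h2
  have hptc : ∀ z ∈ ball (0 : Cn d) 1, ∃ y, Tendsto (fun i => g i z) atTop (𝓝 y) := by
    intro z hz
    obtain ⟨s, hs, -, h⟩ := hunif z hz
    refine cauchySeq_tendsto_of_complete (Metric.cauchySeq_iff.2 fun ε hε => ?_)
    obtain ⟨K, hK⟩ := h (ε / 2) (by positivity)
    refine ⟨K, fun i hi j hj => ?_⟩
    rw [dist_eq_norm]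
    exact (hK i hi j hj z (mem_ball_self hs)).trans_lt (by linarith)
  choose! G hG using hptc
  refine ⟨G, fun z hz => ?_, ?_⟩
  · -- the limit is holomorphic
    obtain ⟨s, hs, hsub, h⟩ := hunif z hz
    have hsub2 : ball z (s / 2) ⊆ ball (0 : Cn d) 1 := (ball_subset_ball (by linarith)).trans hsub
    have hder : ∀ ε > 0, ∃ K : ℕ, ∀ i ≥ K, ∀ j ≥ K, ∀ w ∈ ball z (s / 2),
        ‖fderiv ℂ (g i) w - fderiv ℂ (g j) w‖ ≤ ε := by
      intro ε hε
      obtain ⟨K, hK⟩ := h (ε * (s / 2) / 2) (by positivity)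
      refine ⟨K, fun i hi j hj w hw => ?_⟩
      have hws : ball w (s / 2) ⊆ ball z s := by
        refine ball_subset_ball' ?_
        have := (mem_ball.1 hw).le
        linarith
      have hwin : ball (0 : Cn d) 1 ∈ 𝓝 w := isOpen_ball.mem_nhds (hsub2 hw)
      have h1 : ‖fderiv ℂ (g i - g j) w‖ ≤ ε * (s / 2) / (s / 2) := by
        refine Complex.norm_fderiv_le_div_of_mapsTo_ball
          (((hg i).sub (hg j)).mono (hws.trans hsub)) (fun x hx => ?_) (by positivity)
        rw [mem_closedBall, dist_eq_norm]
        have a := hK i hi j hj x (hws hx)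
        have b := hK i hi j hj w (hws (mem_ball_self (by positivity)))
        calc ‖(g i - g j) x - (g i - g j) w‖ ≤ ‖(g i - g j) x‖ + ‖(g i - g j) w‖ := norm_sub_le _ _
          _ ≤ ε * (s / 2) / 2 + ε * (s / 2) / 2 := add_le_add a b
          _ = _ := by ring
      rw [mul_div_cancel_right₀ _ (by positivity)] at h1
      rwa [fderiv_sub ((hg i).differentiableAt hwin) ((hg j).differentiableAt hwin)] at h1
    have hder' : ∀ w ∈ ball z (s / 2), ∃ y, Tendsto (fun i => fderiv ℂ (g i) w) atTop (𝓝 y) := by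
      intro w hw
      refine cauchySeq_tendsto_of_complete (Metric.cauchySeq_iff.2 fun ε hε => ?_)
      obtain ⟨K, hK⟩ := hder (ε / 2) (by positivity)
      refine ⟨K, fun i hi j hj => ?_⟩
      rw [dist_eq_norm]
      exact (hK i hi j hj w hw).trans_lt (by linarith)
    choose! G' hG' using hder'
    have hU : UniformCauchySeqOn (fun i => fderiv ℂ (g i)) atTop (ball z (s / 2)) := by
      refine Metric.uniformCauchySeqOn_iff.2 fun ε hε => ?_
      obtain ⟨K, hK⟩ := hder (ε / 2) (by positivity)
      refine ⟨K, fun i hi j hj w hw => ?_⟩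
      rw [dist_eq_norm]
      exact (hK i hi j hj w hw).trans_lt (by linarith)
    have := hasFDerivAt_of_tendstoUniformlyOn isOpen_ball (hU.tendstoUniformlyOn_of_tendsto hG')
      (fun i w hw => ((hg i).differentiableAt
        (isOpen_ball.mem_nhds (hsub2 hw))).hasFDerivAt)
      (fun w hw => hG w (hsub2 hw)) (mem_ball_self (by positivity : 0 < s / 2))
    exact this.differentiableAt.differentiableWithinAt
  · obtain ⟨ns, hns, hae⟩ := (tendstoInMeasure_of_tendsto_Lp hlim).exists_seq_tendsto_ae
    have hall : ∀ᵐ z ∂(weightedMeasure d μ), ∀ i, f i z = g i z := ae_all_iff.2 hfg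
    filter_upwards [hae, hall, ae_mem_ball d μ] with z h1 h2 h3
    refine tendsto_nhds_unique h1 ?_
    simp only [h2]
    exact (hG z h3).comp hns.tendsto_atTop

instance completeSpace_bergmanSubmodule (d : ℕ) (μ : Weight) :
    CompleteSpace (bergmanSubmodule d μ) :=
  (isClosed_bergmanSubmodule d μ).completeSpace_coe

/-- The weighted Bergman space `𝒜²_μ(𝔹^d)`, a Hilbert space with the inner product of
`L²(dv_μ)`. -/
def BergmanSpace (d : ℕ) (μ : Weight) : Type := bergmanSubmodule d μ

instance (d : ℕ) (μ : Weight) : NormedAddCommGroup (BergmanSpace d μ) :=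
  inferInstanceAs (NormedAddCommGroup (bergmanSubmodule d μ))

instance (d : ℕ) (μ : Weight) : InnerProductSpace ℂ (BergmanSpace d μ) :=
  inferInstanceAs (InnerProductSpace ℂ (bergmanSubmodule d μ))

instance (d : ℕ) (μ : Weight) : CompleteSpace (BergmanSpace d μ) :=
  inferInstanceAs (CompleteSpace (bergmanSubmodule d μ))

/-- The bounded operators on `𝒜²_μ(𝔹^d)`. -/
abbrev BergmanOp (d : ℕ) (μ : Weight) : Type := BergmanSpace d μ →L[ℂ] BergmanSpace d μ

/-- The inclusion of `𝒜²_μ(𝔹^d)` into `L²(dv_μ)`. -/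
def bergmanIncl (d : ℕ) (μ : Weight) : BergmanSpace d μ →L[ℂ] Lp ℂ 2 (weightedMeasure d μ) :=
  (bergmanSubmodule d μ).subtypeL

/-- The Bergman projection: the orthogonal projection of `L²(dv_μ)` onto `𝒜²_μ(𝔹^d)`. -/
def bergmanProj (d : ℕ) (μ : Weight) : Lp ℂ 2 (weightedMeasure d μ) →L[ℂ] BergmanSpace d μ :=
  (bergmanSubmodule d μ).orthogonalProjectionOnto

/-- The Toeplitz operator `T_f h = P (f h)` on `𝒜²_μ(𝔹^d)` with symbol `f ∈ L^∞`, where `P` is the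
Bergman projection. -/
def toeplitz {d : ℕ} {μ : Weight} (f : Lp ℂ ∞ (weightedMeasure d μ)) : BergmanOp d μ :=
  bergmanProj d μ ∘L
    ((ContinuousLinearMap.mul ℂ ℂ).holderL (weightedMeasure d μ) ∞ 2 2 f) ∘L bergmanIncl d μ

/-- The pseudohyperbolic distance `|φ_z(w)|` on the unit ball, through the identity
`1 - |φ_z(w)|² = (1 - |z|²)(1 - |w|²) / |1 - ⟨z, w⟩|²`. -/
def pseudoDist {d : ℕ} (z w : Ball d) : ℝ :=
  √(1 - (1 - ‖(z : Cn d)‖ ^ 2) * (1 - ‖(w : Cn d)‖ ^ 2) / ‖1 - inner ℂ (z : Cn d) (w : Cn d)‖ ^ 2)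

/-- The Bergman metric `β(z, w) = (1/2) log ((1 + |φ_z(w)|) / (1 - |φ_z(w)|))` of the unit ball. -/
def bergmanDist {d : ℕ} (z w : Ball d) : ℝ :=
  1 / 2 * Real.log ((1 + pseudoDist z w) / (1 - pseudoDist z w))

/-- `BUC(𝔹^d)`: the bounded functions on the unit ball that are uniformly continuous with respect
to the Bergman metric. -/
def BUC (d : ℕ) : Subalgebra ℂ (Ball d → ℂ) where
  carrier := {c | (∃ C : ℝ, ∀ z, ‖c z‖ ≤ C) ∧
    ∀ ε > 0, ∃ δ > 0, ∀ z w, bergmanDist z w < δ → ‖c z - c w‖ < ε}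
  mul_mem' := by
    rintro a b ⟨⟨A, hA⟩, ha⟩ ⟨⟨B, hB⟩, hb⟩
    refine ⟨⟨A * B, fun z => ?_⟩, fun ε hε => ?_⟩
    · rw [Pi.mul_apply, norm_mul]
      exact mul_le_mul (hA z) (hB z) (norm_nonneg _) ((norm_nonneg _).trans (hA z))
    · have hA' : 0 < |A| + 1 := by positivity
      have hB' : 0 < |B| + 1 := by positivity
      obtain ⟨δ₁, h₁, k₁⟩ := ha (ε / 2 / (|B| + 1)) (by positivity)
      obtain ⟨δ₂, h₂, k₂⟩ := hb (ε / 2 / (|A| + 1)) (by positivity)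
      refine ⟨min δ₁ δ₂, lt_min h₁ h₂, fun z w hzw => ?_⟩
      have e : (a * b) z - (a * b) w = a z * (b z - b w) + (a z - a w) * b w := by
        simp only [Pi.mul_apply]; ring
      have l₁ := k₁ z w (hzw.trans_le (min_le_left _ _))
      have l₂ := k₂ z w (hzw.trans_le (min_le_right _ _))
      have m₁ : ‖a z‖ ≤ |A| + 1 := (hA z).trans ((le_abs_self A).trans (by linarith))
      have m₂ : ‖b w‖ ≤ |B| + 1 := (hB w).trans ((le_abs_self B).trans (by linarith))
      rw [lt_div_iff₀ hB'] at l₁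
      rw [lt_div_iff₀ hA'] at l₂
      rw [e]
      refine (norm_add_le _ _).trans_lt ?_
      rw [norm_mul, norm_mul]
      have n₁ : ‖a z‖ * ‖b z - b w‖ ≤ (|A| + 1) * ‖b z - b w‖ := by gcongr
      have n₂ : ‖a z - a w‖ * ‖b w‖ ≤ ‖a z - a w‖ * (|B| + 1) := by gcongr
      linarith
  add_mem' := by
    rintro a b ⟨⟨A, hA⟩, ha⟩ ⟨⟨B, hB⟩, hb⟩
    refine ⟨⟨A + B, fun z => (norm_add_le _ _).trans (add_le_add (hA z) (hB z))⟩, fun ε hε => ?_⟩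
    obtain ⟨δ₁, h₁, k₁⟩ := ha (ε / 2) (by positivity)
    obtain ⟨δ₂, h₂, k₂⟩ := hb (ε / 2) (by positivity)
    refine ⟨min δ₁ δ₂, lt_min h₁ h₂, fun z w hzw => ?_⟩
    have l₁ := k₁ z w (hzw.trans_le (min_le_left _ _))
    have l₂ := k₂ z w (hzw.trans_le (min_le_right _ _))
    have e : (a + b) z - (a + b) w = (a z - a w) + (b z - b w) := by
      simp only [Pi.add_apply]; ring
    rw [e]
    refine (norm_add_le _ _).trans_lt ?_
    linarith
  algebraMap_mem' r :=
    ⟨⟨‖r‖, fun z => by simp⟩, fun ε hε => ⟨1, one_pos, fun z w _ => by simpa using hε⟩⟩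

lemma continuous_BUC {d : ℕ} (c : BUC d) : Continuous (c : Ball d → ℂ) := by
  refine continuous_iff_continuousAt.2 fun z => ?_
  have hz : 0 < 1 - ‖(z : Cn d)‖ ^ 2 := one_sub_normSq_pos z.2
  have hzz : (1 : ℂ) - inner ℂ (z : Cn d) (z : Cn d) = ((1 - ‖(z : Cn d)‖ ^ 2 : ℝ) : ℂ) := by
    rw [inner_self_eq_norm_sq_to_K]; push_cast; rfl
  have hnzz : ‖(1 : ℂ) - inner ℂ (z : Cn d) (z : Cn d)‖ = 1 - ‖(z : Cn d)‖ ^ 2 := by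
    rw [hzz, Complex.norm_real, Real.norm_of_nonneg hz.le]
  have hp0 : pseudoDist z z = 0 := by
    rw [pseudoDist, hnzz, ← sq, div_self (by positivity)]; simp
  have hpc : ContinuousAt (fun w => pseudoDist z w) z := by
    unfold pseudoDist
    refine (continuousAt_const.sub (ContinuousAt.div (by fun_prop) (by fun_prop) ?_)).sqrt
    rw [hnzz]; positivity
  have hbc : ContinuousAt (fun w => bergmanDist z w) z := by
    unfold bergmanDist
    refine continuousAt_const.mul (ContinuousAt.log ((continuousAt_const.add hpc).div
      (continuousAt_const.sub hpc) ?_) ?_)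
    · simp [hp0]
    · simp [hp0]
  have hb0 : bergmanDist z z = 0 := by simp [bergmanDist, hp0]
  rw [Metric.continuousAt_iff']
  intro ε hε
  obtain ⟨δ, hδ, h⟩ := c.2.2 ε hε
  have := hbc.eventually_lt (continuousAt_const (y := δ)) (by simpa [hb0] using hδ)
  filter_upwards [this] with w hw
  rw [dist_comm, dist_eq_norm]
  exact h z w hw

/-- A function on the unit ball, extended by `0` to `ℂ^d`. -/
def extendBall {d : ℕ} (c : Ball d → ℂ) (z : Cn d) : ℂ :=
  open Classical in if h : z ∈ ball (0 : Cn d) 1 then c ⟨z, h⟩ else 0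

lemma measurable_extendBall {d : ℕ} (c : BUC d) : Measurable (extendBall (c : Ball d → ℂ)) := by
  classical
  refine measurable_of_restrict_of_restrict_compl (measurableSet_ball (x := (0 : Cn d)) (ε := 1))
    ?_ ?_
  · have : (ball (0 : Cn d) 1).domRestrict (extendBall (c : Ball d → ℂ)) = c := by
      ext z; simp [extendBall, domRestrict]
    rw [this]
    exact (continuous_BUC c).measurable
  · have : (ball (0 : Cn d) 1)ᶜ.domRestrict (extendBall (c : Ball d → ℂ)) = fun _ => 0 := by
      ext z
      have hz : (z : Cn d) ∉ ball (0 : Cn d) 1 := z.2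
      simp only [extendBall, domRestrict, hz, dif_neg, not_false_eq_true]
    rw [this]
    exact measurable_const

lemma exists_norm_extendBall_le {d : ℕ} (c : BUC d) :
    ∃ C : ℝ, ∀ z, ‖extendBall (c : Ball d → ℂ) z‖ ≤ C := by
  obtain ⟨C, hC⟩ := c.2.1
  refine ⟨max C 0, fun z => ?_⟩
  unfold extendBall
  split_ifs with h
  · exact (hC _).trans (le_max_left _ _)
  · simp

lemma memLp_symbol {d : ℕ} (μ : Weight) (c : BUC d) :
    MemLp (extendBall (c : Ball d → ℂ)) ∞ (weightedMeasure d μ) := by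
  obtain ⟨C, hC⟩ := exists_norm_extendBall_le c
  exact memLp_top_of_bound (measurable_extendBall c).aestronglyMeasurable C
    (Eventually.of_forall hC)

/-- The Toeplitz operator `T_c^μ` on `𝒜²_μ(𝔹^d)` with symbol `c ∈ BUC(𝔹^d)`. -/
def toeplitzBUC {d : ℕ} (μ : Weight) (c : BUC d) : BergmanOp d μ :=
  toeplitz (memLp_symbol μ c).toLp

/-- The last `d` coordinates `z''` of `z = (z', z'') ∈ ℂ^ℓ × ℂ^d`. -/
def lastCoords (ℓ d : ℕ) (z : Cn (ℓ + d)) : Cn d :=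
  WithLp.toLp 2 fun i => z (Fin.natAdd ℓ i)

lemma memLp_liftedSymbol {ℓ d : ℕ} (μ : Weight) (c : BUC d) :
    MemLp (fun z => extendBall (c : Ball d → ℂ) (lastCoords ℓ d z)) ∞
      (weightedMeasure (ℓ + d) μ) := by
  obtain ⟨C, hC⟩ := exists_norm_extendBall_le c
  refine memLp_top_of_bound ((measurable_extendBall c).comp ?_).aestronglyMeasurable C
    (Eventually.of_forall fun z => hC _)
  unfold lastCoords
  fun_prop

/-- The Toeplitz operator on `𝒜²_μ(𝔹^(ℓ+d))` with symbol `f_c(z', z'') = c(z'')`, where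
`c ∈ BUC(𝔹^d)`. -/
def toeplitzLifted (ℓ : ℕ) {d : ℕ} (μ : Weight) (c : BUC d) :
    BergmanOp (ℓ + d) μ :=
  toeplitz (memLp_liftedSymbol (ℓ := ℓ) μ c).toLp

/-- `𝒯_μ(BUC(𝔹^d))`: the C*-algebra generated by the Toeplitz operators with symbols in
`BUC(𝔹^d)`. -/
def toeplitzAlgebra (d : ℕ) (μ : Weight) :
    StarSubalgebra ℂ (BergmanOp d μ) :=
  (StarAlgebra.adjoin ℂ (range (toeplitzBUC (d := d) μ))).topologicalClosure

/-- `𝒯_μ(1, BUC(𝔹^d))`: the C*-algebra of operators on `𝒜²_μ(𝔹^(ℓ+d))` generated by the Toeplitz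
operators with symbols `f_c(z', z'') = c(z'')`, `c ∈ BUC(𝔹^d)`. -/
def liftedToeplitzAlgebra (ℓ d : ℕ) (μ : Weight) :
    StarSubalgebra ℂ (BergmanOp (ℓ + d) μ) :=
  (StarAlgebra.adjoin ℂ (range (toeplitzLifted ℓ (d := d) μ))).topologicalClosure

/-- The semi-commutator ideal of `𝒯_μ(BUC(𝔹^d))`: its closed two-sided ideal generated by the
semi-commutators `T_a T_b - T_(ab)`, `a, b ∈ BUC(𝔹^d)`, that is, the closed linear span of the
products `X (T_a T_b - T_(ab)) Y` with `X, Y` in the (unital) algebra. -/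
def semiCommutatorIdeal (d : ℕ) (μ : Weight) :
    Submodule ℂ (BergmanOp d μ) :=
  (Submodule.span ℂ {S | ∃ X ∈ toeplitzAlgebra d μ, ∃ Y ∈ toeplitzAlgebra d μ, ∃ a b : BUC d,
    S = X * (toeplitzBUC μ a * toeplitzBUC μ b - toeplitzBUC μ (a * b)) * Y}).topologicalClosure

/-- The function `√(Γ(d + |α| + μ + 1) / (α! Γ(d + μ + 1))) z^α`. -/
def monomialFun (d : ℕ) (μ : Weight) (α : Fin d → ℕ) (z : Cn d) : ℂ :=
  (√(Real.Gamma (d + (∑ i, α i : ℕ) + μ + 1) /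
    ((∏ i, (α i).factorial : ℕ) * Real.Gamma (d + μ + 1))) : ℝ) * ∏ i, z i ^ α i

lemma differentiable_monomialFun (d : ℕ) (μ : Weight) (α : Fin d → ℕ) :
    Differentiable ℂ (monomialFun d μ α) := by
  unfold monomialFun
  fun_prop

lemma memLp_monomialFun (d : ℕ) (μ : Weight) (α : Fin d → ℕ) :
    MemLp (monomialFun d μ α) 2 (weightedMeasure d μ) := by
  have hc := (differentiable_monomialFun d μ α).continuous
  obtain ⟨C, hC⟩ := (isCompact_closedBall (0 : Cn d) 1).exists_bound_of_continuousOn hc.continuousOn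
  refine MemLp.of_bound hc.aestronglyMeasurable C ?_
  filter_upwards [ae_mem_ball d μ] with z hz using hC z (ball_subset_closedBall hz)

/-- The standard orthonormal basis vectors `e_α^μ` of `𝒜²_μ(𝔹^d)`. -/
def basisVec (d : ℕ) (μ : Weight) (α : Fin d → ℕ) : BergmanSpace d μ :=
  ⟨(memLp_monomialFun d μ α).toLp, monomialFun d μ α,
    (differentiable_monomialFun d μ α).differentiableOn, MemLp.coeFn_toLp _⟩

/-- For a multi-index `α' = (α_(1), …, α_(m)) ∈ ℤ₊^ℓ`, grouped according to the composition
`ℓ = k₁ + ⋯ + k_m`, the tuple `(|α_(1)|, …, |α_(m)|)`. -/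
def blockDegree {ℓ : ℕ} (k : Composition ℓ) (α : Fin ℓ → ℕ) : Fin k.length → ℕ :=
  fun j => ∑ i with k.index i = j, α i

/-- The space `ℋ_ρ ⊆ 𝒜²_μ(𝔹^ℓ)` spanned by the `e_α'` with `|α_(j)| = ρ_j` for all `j`. -/
def levelSpace {ℓ : ℕ} (μ : Weight) (k : Composition ℓ) (ρ : Fin k.length → ℕ) :
    Submodule ℂ (BergmanSpace ℓ μ) :=
  Submodule.span ℂ (basisVec ℓ μ '' {α | blockDegree k α = ρ})

/-- `e_α'` as an element of the level space that it belongs to. -/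
def levelVec {ℓ : ℕ} (μ : Weight) (k : Composition ℓ) (α : Fin ℓ → ℕ) :
    levelSpace μ k (blockDegree k α) :=
  ⟨basisVec ℓ μ α, Submodule.subset_span ⟨α, rfl, rfl⟩⟩

/-- The weight `μ + |ρ| + ℓ`. -/
abbrev levelWeight {m : ℕ} (ℓ : ℕ) (μ : Weight) (ρ : Fin m → ℕ) : Weight :=
  μ.shift ((∑ j, ρ j) + ℓ)

/-- The summand `ℋ_ρ ⊗ 𝒜²_(μ+|ρ|+ℓ)(𝔹^d)`. As `ℋ_ρ` is finite-dimensional, the algebraic tensor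
product with its inner product is already the Hilbert space tensor product. -/
abbrev Summand {ℓ : ℕ} (d : ℕ) (μ : Weight) (k : Composition ℓ) (ρ : Fin k.length → ℕ) : Type :=
  levelSpace μ k ρ ⊗[ℂ] BergmanSpace d (levelWeight ℓ μ ρ)

/-- The Hilbert space direct sum `⨁_ρ ℋ_ρ ⊗ 𝒜²_(μ+|ρ|+ℓ)(𝔹^d)`. -/
abbrev DirectSumSpace {ℓ : ℕ} (d : ℕ) (μ : Weight) (k : Composition ℓ) : Type :=
  lp (fun ρ : Fin k.length → ℕ => Summand d μ k ρ) 2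

/-- `U` is the unitary operator from `𝒜²_μ(𝔹^(ℓ+d))` onto `⨁_ρ ℋ_ρ ⊗ 𝒜²_(μ+|ρ|+ℓ)(𝔹^d)` that sends
each basis vector `e_α`, `α = (α', α'')`, to the vector `e_α' ⊗ e_α''` of the summand with
`ρ = (|α_(1)|, …, |α_(m)|)`. -/
def IsDecomposition {ℓ d : ℕ} {μ : Weight} {k : Composition ℓ}
    (U : BergmanSpace (ℓ + d) μ ≃ₗᵢ[ℂ] DirectSumSpace d μ k) : Prop :=
  ∀ (α' : Fin ℓ → ℕ) (α'' : Fin d → ℕ),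
    U (basisVec (ℓ + d) μ (Fin.append α' α'')) =
      lp.single 2 (blockDegree k α')
        (levelVec μ k α' ⊗ₜ[ℂ] basisVec d (levelWeight ℓ μ (blockDegree k α')) α'')

/-- `U T U⁻¹ = ⨁_ρ I ⊗ A_ρ`. -/
def DecomposesAs {ℓ d : ℕ} {μ : Weight} {k : Composition ℓ}
    (U : BergmanSpace (ℓ + d) μ ≃ₗᵢ[ℂ] DirectSumSpace d μ k)
    (T : BergmanOp (ℓ + d) μ)
    (A : ∀ ρ : Fin k.length → ℕ,
      BergmanOp d (levelWeight ℓ μ ρ)) : Prop :=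
  ∀ (x : DirectSumSpace d μ k) (ρ : Fin k.length → ℕ),
    (U (T (U.symm x)) : ∀ ρ, Summand d μ k ρ) ρ = (A ρ).lTensor (levelSpace μ k ρ) (x ρ)

/-- `T` has the representation `U T U⁻¹ = ⨁_ρ I ⊗ (T_c^(μ+|ρ|+ℓ) + N_ρ)`, where each `N_ρ` belongs to
the semi-commutator ideal and `‖N_ρ‖ → 0` as `|ρ| → ∞`. -/
structure IsRepresentation {ℓ d : ℕ} {μ : Weight} {k : Composition ℓ}
    (U : BergmanSpace (ℓ + d) μ ≃ₗᵢ[ℂ] DirectSumSpace d μ k)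
    (T : BergmanOp (ℓ + d) μ) (c : BUC d)
    (N : ∀ ρ : Fin k.length → ℕ,
      BergmanOp d (levelWeight ℓ μ ρ)) : Prop where
  decomposes : DecomposesAs U T fun ρ => toeplitzBUC (levelWeight ℓ μ ρ) c + N ρ
  mem_ideal : ∀ ρ, N ρ ∈ semiCommutatorIdeal d (levelWeight ℓ μ ρ)
  tendsto_zero : Tendsto (fun ρ => ‖N ρ‖) (comap (fun ρ => ∑ j, ρ j) atTop) (𝓝 0)

end

end BergmanToeplitz

/-!
The argument has an algebraic half and an analytic half.

*Decomposition.* The map `(w, z) ↦ (√(1 - |z|²) w, z)` carries the product of `dv_μ` on `𝔹^ℓ` and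
`dv_(μ+ℓ)` on `𝔹^d` to `dv_μ` on `𝔹^(ℓ+d)` (`map_fiberMap`), and it turns the monomial `e_(α',α'')`
into a multiple of `(1 - |z|²)^(|α'|/2) e_α'(w) e_α''(z)`, where the power of `1 - |z|²` raises the
weight in `z` to `μ + |α'| + ℓ` (`monomialFun_fiberMap`). By induction on the dimension the
monomials form a Hilbert basis: orthonormality is `monomialsOrthonormal`, and in
`monomialsComplete` the Taylor coefficients in one variable of a function orthogonal to all
monomials are again holomorphic, square integrable and orthogonal to all monomials. So `U` exists
and is unique (`existsUnique_isDecomposition`), and comparison of matrix coefficients shows that a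
symbol depending on `z''` only becomes `⨁_ρ I ⊗ T_c` (`decomposesAs_toeplitzLifted`).

*Large weights.* Summing the monomial expansion gives the kernel `(1 - ⟨z, w⟩)^(-N)`,
`N = d + 1 + μ` (`fn_kernel`), and the norms of the kernels give the invariant integrals of powers
of `1 - |φ_z(w)|²` (`lintegral_sechSq_rpow`). As `N` grows these powers concentrate at the
diagonal, where a function in `BUC` oscillates little. This has two consequences. Schur's test with
the weight `(1 - |z|²)^(-N/2)` bounds `f ↦ b f - P (b f)`, so that semi-commutators tend to `0` as
the weight tends to infinity (`tendsto_norm_semiCommutator`); and Berezin transforms recover the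
symbol, so that `|c(z)| ≤ ‖T_c‖ + o(1)` (`eventually_norm_symbol_le`).

*Conclusion.* The operators of the form `⨁_ρ I ⊗ (T_c + N_|ρ|)` are closed under sums, adjoints and
products, since a product produces the new remainder `(T_c T_b - T_cb) + T_c M + N T_b + N M`. As
the remainders vanish in the limit, the norm of such an operator dominates the supremum of `|c|`
(`norm_symbol_le_of_decomposesAs`). Hence symbols and remainders converge along norm limits, the
set is a C*-algebra containing the generators, and the representation is unique.
-/

namespace BergmanToeplitz

noncomputable section

/-! ### Fibering the ball over a lower-dimensional ball -/

/-- The point `(w, z)` of `ℂ^ℓ × ℂ^d = ℂ^(ℓ+d)`. -/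
def joinCoords {ℓ d : ℕ} (w : Cn ℓ) (z : Cn d) : Cn (ℓ + d) :=
  WithLp.toLp 2 (Fin.append w z)

@[simp] lemma joinCoords_castAdd {ℓ d : ℕ} (w : Cn ℓ) (z : Cn d) (i : Fin ℓ) :
    joinCoords w z (Fin.castAdd d i) = w i := by simp [joinCoords]

@[simp] lemma joinCoords_natAdd {ℓ d : ℕ} (w : Cn ℓ) (z : Cn d) (i : Fin d) :
    joinCoords w z (Fin.natAdd ℓ i) = z i := by simp [joinCoords]

@[simp] lemma lastCoords_joinCoords {ℓ d : ℕ} (w : Cn ℓ) (z : Cn d) :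
    lastCoords ℓ d (joinCoords w z) = z := by
  ext i; simp [lastCoords]

lemma norm_sq_joinCoords {ℓ d : ℕ} (w : Cn ℓ) (z : Cn d) :
    ‖joinCoords w z‖ ^ 2 = ‖w‖ ^ 2 + ‖z‖ ^ 2 := by
  simp [EuclideanSpace.norm_sq_eq, Fin.sum_univ_add]

/-- The isometric isomorphism `ℂ^ℓ × ℂ^d ≃ ℂ^(ℓ+d)`. -/
def joinIsometry (ℓ d : ℕ) : WithLp 2 (Cn ℓ × Cn d) ≃ₗᵢ[ℂ] Cn (ℓ + d) where
  toFun x := joinCoords x.fst x.snd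
  invFun z := WithLp.toLp 2 (WithLp.toLp 2 fun i => z (Fin.castAdd d i), lastCoords ℓ d z)
  left_inv x := by
    obtain ⟨w, z⟩ := x
    simp [joinCoords, lastCoords]
  right_inv z := by
    ext i
    refine Fin.addCases (fun i => ?_) (fun i => ?_) i <;> simp [lastCoords]
  map_add' x y := by
    ext i
    refine Fin.addCases (fun i => ?_) (fun i => ?_) i <;> simp
  map_smul' a x := by
    ext i
    refine Fin.addCases (fun i => ?_) (fun i => ?_) i <;> simp
  norm_map' x := by
    refine (sq_eq_sq₀ (norm_nonneg _) (norm_nonneg _)).1 ?_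
    change ‖joinCoords x.fst x.snd‖ ^ 2 = _
    rw [norm_sq_joinCoords, WithLp.prod_norm_sq_eq_of_L2]

lemma continuous_joinCoords {ℓ d : ℕ} :
    Continuous fun p : Cn ℓ × Cn d => joinCoords p.1 p.2 :=
  (joinIsometry ℓ d).continuous.comp (WithLp.prod_continuous_toLp 2 (Cn ℓ) (Cn d))

lemma differentiable_joinCoords {ℓ d : ℕ} :
    Differentiable ℂ fun p : Cn ℓ × Cn d => joinCoords p.1 p.2 :=
  (joinIsometry ℓ d).differentiable.comp
    (WithLp.prodContinuousLinearEquiv 2 ℂ (Cn ℓ) (Cn d)).symm.differentiable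

@[fun_prop] lemma Measurable.joinCoords {X : Type*} [MeasurableSpace X] {ℓ d : ℕ} {f : X → Cn ℓ}
    {g : X → Cn d} (hf : Measurable f) (hg : Measurable g) :
    Measurable fun x => joinCoords (f x) (g x) :=
  continuous_joinCoords.measurable.comp (hf.prodMk hg)

@[fun_prop] lemma Continuous.joinCoords {X : Type*} [TopologicalSpace X] {ℓ d : ℕ} {f : X → Cn ℓ}
    {g : X → Cn d} (hf : Continuous f) (hg : Continuous g) :
    Continuous fun x => joinCoords (f x) (g x) :=
  continuous_joinCoords.comp (hf.prodMk hg)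

@[fun_prop] lemma Differentiable.joinCoords {X : Type*} [NormedAddCommGroup X] [NormedSpace ℂ X]
    {ℓ d : ℕ} {f : X → Cn ℓ} {g : X → Cn d} (hf : Differentiable ℂ f) (hg : Differentiable ℂ g) :
    Differentiable ℂ fun x => joinCoords (f x) (g x) :=
  differentiable_joinCoords.comp (hf.prodMk hg)

lemma measurable_lastCoords (ℓ d : ℕ) : Measurable (lastCoords ℓ d) := by
  unfold lastCoords; fun_prop

lemma lintegral_joinCoords {ℓ d : ℕ} {F : Cn (ℓ + d) → ℝ≥0∞} (hF : Measurable F) :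
    ∫⁻ x, F x = ∫⁻ z : Cn d, ∫⁻ w : Cn ℓ, F (joinCoords w z) := by
  have h1 : MeasurePreserving (joinIsometry ℓ d) := by
    let e : WithLp 2 (Cn ℓ × Cn d) ≃ₗᵢ[ℝ] Cn (ℓ + d) :=
      { (joinIsometry ℓ d).toLinearEquiv.restrictScalars ℝ with
        norm_map' := (joinIsometry ℓ d).norm_map }
    exact e.measurePreserving
  have h2 := h1.comp (WithLp.volume_preserving_toLp (Cn ℓ) (Cn d))
  have h3 := h2.lintegral_comp hF
  rw [← h3, Measure.volume_eq_prod, lintegral_prod_symm]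
  · rfl
  · exact (hF.comp h2.measurable).aemeasurable

lemma lintegral_weightedMeasure {d : ℕ} (μ : Weight) {F : Cn d → ℝ≥0∞} (hF : Measurable F) :
    ∫⁻ z, F z ∂(weightedMeasure d μ) =
      ∫⁻ z, (ball (0 : Cn d) 1).indicator (fun z => ENNReal.ofReal (weightFun d μ z) * F z) z := by
  rw [weightedMeasure, lintegral_withDensity_eq_lintegral_mul _
    (measurable_weightFun d μ).ennreal_ofReal hF, lintegral_indicator measurableSet_ball]
  rfl

lemma finrank_real_Cn (d : ℕ) : Module.finrank ℝ (Cn d) = 2 * d := by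
  have := finrank_real_of_complex (Cn d)
  simpa using this

lemma lintegral_comp_smul_Cn {d : ℕ} {s : ℝ} (hs : 0 < s) {F : Cn d → ℝ≥0∞} (hF : Measurable F) :
    ∫⁻ w, F w = ENNReal.ofReal (s ^ (2 * d)) * ∫⁻ w, F (s • w) := by
  have h1 := Measure.map_addHaar_smul (volume : Measure (Cn d)) hs.ne'
  have h2 : ∫⁻ w, F (s • w) = ∫⁻ w, F w ∂(Measure.map (s • ·) (volume : Measure (Cn d))) :=
    (lintegral_map hF (measurable_const_smul s)).symm
  rw [h2, h1, lintegral_smul_measure, finrank_real_Cn, smul_eq_mul, ← mul_assoc,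
    ← ENNReal.ofReal_mul (by positivity), abs_of_pos (by positivity),
    mul_inv_cancel₀ (by positivity), ENNReal.ofReal_one, one_mul]

/-- The map `(w, z) ↦ (√(1 - |z|²) w, z)`, which maps the product of balls onto the ball. -/
def fiberMap (ℓ d : ℕ) (p : Cn ℓ × Cn d) : Cn (ℓ + d) :=
  joinCoords (√(1 - ‖p.2‖ ^ 2) • p.1) p.2

lemma measurable_fiberMap (ℓ d : ℕ) : Measurable (fiberMap ℓ d) := by
  unfold fiberMap; fun_prop

lemma one_sub_norm_sq_fiberMap {ℓ d : ℕ} (w : Cn ℓ) {z : Cn d} (hz : z ∈ ball (0 : Cn d) 1) :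
    1 - ‖fiberMap ℓ d (w, z)‖ ^ 2 = (1 - ‖z‖ ^ 2) * (1 - ‖w‖ ^ 2) := by
  have h := one_sub_normSq_pos hz
  rw [fiberMap, norm_sq_joinCoords, norm_smul, mul_pow, Real.norm_of_nonneg (Real.sqrt_nonneg _),
    Real.sq_sqrt h.le]
  ring

lemma mem_ball_iff_one_sub {d : ℕ} {z : Cn d} : z ∈ ball (0 : Cn d) 1 ↔ 0 < 1 - ‖z‖ ^ 2 := by
  refine ⟨one_sub_normSq_pos, fun h => ?_⟩
  rw [mem_ball_zero_iff]
  nlinarith [norm_nonneg z]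

lemma fiberMap_mem_ball_iff {ℓ d : ℕ} {w : Cn ℓ} {z : Cn d} (hz : z ∈ ball (0 : Cn d) 1) :
    fiberMap ℓ d (w, z) ∈ ball (0 : Cn (ℓ + d)) 1 ↔ w ∈ ball (0 : Cn ℓ) 1 := by
  rw [mem_ball_iff_one_sub, mem_ball_iff_one_sub, one_sub_norm_sq_fiberMap w hz,
    mul_pos_iff_of_pos_left (one_sub_normSq_pos hz)]

/-- The normalizing constants of the weights are such that the densities multiply exactly. -/
lemma weightFun_fiberMap {ℓ d : ℕ} (μ : Weight) {w : Cn ℓ} {z : Cn d}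
    (hz : z ∈ ball (0 : Cn d) 1) (hw : w ∈ ball (0 : Cn ℓ) 1) :
    √(1 - ‖z‖ ^ 2) ^ (2 * ℓ) * weightFun (ℓ + d) μ (fiberMap ℓ d (w, z)) =
      weightFun d (μ.shift ℓ) z * weightFun ℓ μ w := by
  have h1 := one_sub_normSq_pos hz
  have h2 := one_sub_normSq_pos hw
  have hμ := μ.2
  have e1 : ((μ.shift ℓ : Weight) : ℝ) = μ + ℓ := rfl
  have h3 : Real.Gamma (μ + ℓ + 1) ≠ 0 := (Real.Gamma_pos_of_pos (by
    have : (0 : ℝ) ≤ ℓ := ℓ.cast_nonneg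
    linarith)).ne'
  rw [weightFun, weightFun, weightFun, one_sub_norm_sq_fiberMap w hz,
    Real.mul_rpow h1.le h2.le, pow_mul, Real.sq_sqrt h1.le, e1, Real.rpow_add h1,
    Real.rpow_natCast, pow_add]
  have e2 : ((ℓ + d : ℕ) : ℝ) + μ + 1 = d + (μ + ℓ) + 1 := by push_cast; ring
  have e3 : (ℓ : ℝ) + μ + 1 = μ + ℓ + 1 := by ring
  rw [e2, e3]
  field_simp

/-- The weighted measure of `𝔹^(ℓ+d)` is fibered over the one of `𝔹^d` with shifted weight. -/
lemma map_fiberMap (ℓ d : ℕ) (μ : Weight) :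
    Measure.map (fiberMap ℓ d) ((weightedMeasure ℓ μ).prod (weightedMeasure d (μ.shift ℓ))) =
      weightedMeasure (ℓ + d) μ := by
  refine Measure.ext_of_lintegral _ fun F hF => ?_
  have hm := measurable_fiberMap ℓ d
  have hFm : Measurable fun p => F (fiberMap ℓ d p) := hF.comp hm
  rw [lintegral_map hF hm, lintegral_prod_symm _ hFm.aemeasurable,
    lintegral_weightedMeasure _ hFm.lintegral_prod_left, lintegral_weightedMeasure _ hF]
  have hG : Measurable ((ball (0 : Cn (ℓ + d)) 1).indicator
      (fun z => ENNReal.ofReal (weightFun (ℓ + d) μ z) * F z)) :=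
    ((measurable_weightFun _ μ).ennreal_ofReal.mul hF).indicator measurableSet_ball
  rw [lintegral_joinCoords hG]
  congr 1
  ext z
  by_cases hz : z ∈ ball (0 : Cn d) 1
  · have hs : 0 < √(1 - ‖z‖ ^ 2) := Real.sqrt_pos.2 (one_sub_normSq_pos hz)
    have hGz : Measurable fun w : Cn ℓ => (ball (0 : Cn (ℓ + d)) 1).indicator
      (fun z => ENNReal.ofReal (weightFun (ℓ + d) μ z) * F z) (joinCoords w z) :=
      hG.comp (by fun_prop)
    have hFz : Measurable fun w : Cn ℓ => F (fiberMap ℓ d (w, z)) :=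
      hFm.comp measurable_prodMk_right
    rw [indicator_of_mem hz, lintegral_comp_smul_Cn hs hGz, lintegral_weightedMeasure _ hFz,
      ← lintegral_const_mul' _ _ ENNReal.ofReal_ne_top,
      ← lintegral_const_mul' _ _ ENNReal.ofReal_ne_top]
    congr 1
    ext w
    change _ = ENNReal.ofReal _ * (ball (0 : Cn (ℓ + d)) 1).indicator _ (fiberMap ℓ d (w, z))
    by_cases hw : w ∈ ball (0 : Cn ℓ) 1
    · rw [indicator_of_mem hw, indicator_of_mem ((fiberMap_mem_ball_iff hz).2 hw), ← mul_assoc,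
        ← mul_assoc, ← ENNReal.ofReal_mul (weightFun_pos hz).le,
        ← ENNReal.ofReal_mul (by positivity), weightFun_fiberMap μ hz hw]
    · rw [indicator_of_notMem hw, indicator_of_notMem (mt (fiberMap_mem_ball_iff hz).1 hw)]
      simp
  · rw [indicator_of_notMem hz]
    have : ∀ w : Cn ℓ, joinCoords w z ∉ ball (0 : Cn (ℓ + d)) 1 := by
      intro w hw
      rw [mem_ball_iff_one_sub, norm_sq_joinCoords] at hw
      refine hz (mem_ball_iff_one_sub.2 ?_)
      nlinarith [sq_nonneg ‖w‖]
    simp [this]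

lemma integrable_comp_fiberMap_iff {ℓ d : ℕ} (μ : Weight) {E : Type*} [NormedAddCommGroup E]
    {F : Cn (ℓ + d) → E} (hF : AEStronglyMeasurable F (weightedMeasure (ℓ + d) μ)) :
    Integrable (fun p => F (fiberMap ℓ d p))
      ((weightedMeasure ℓ μ).prod (weightedMeasure d (μ.shift ℓ))) ↔
      Integrable F (weightedMeasure (ℓ + d) μ) := by
  rw [← map_fiberMap] at hF ⊢
  exact (integrable_map_measure hF (measurable_fiberMap ℓ d).aemeasurable).symm

/-- Integration over `𝔹^(ℓ+d)` as iterated integration over `𝔹^d` and the fibers `𝔹^ℓ`. -/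
lemma integral_fiberMap {ℓ d : ℕ} (μ : Weight) {E : Type*} [NormedAddCommGroup E]
    [NormedSpace ℝ E] {F : Cn (ℓ + d) → E}
    (hF : Integrable F (weightedMeasure (ℓ + d) μ)) :
    ∫ x, F x ∂(weightedMeasure (ℓ + d) μ) =
      ∫ z, ∫ w, F (fiberMap ℓ d (w, z)) ∂(weightedMeasure ℓ μ)
        ∂(weightedMeasure d (μ.shift ℓ)) := by
  have h := (integrable_comp_fiberMap_iff μ hF.aestronglyMeasurable).2 hF
  rw [← integral_prod_symm _ h]
  have hF' := hF.aestronglyMeasurable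
  rw [← map_fiberMap] at hF' ⊢
  exact integral_map (measurable_fiberMap ℓ d).aemeasurable hF'

/-- Multiplication by `(1 - |z|²)^a` shifts the weight, up to the quotient of the constants. -/
lemma weightedMeasure_shift {d : ℕ} (μ : Weight) (a : ℕ) :
    weightedMeasure d (μ.shift a) = (weightedMeasure d μ).withDensity fun z =>
      ENNReal.ofReal (Real.Gamma (d + μ + a + 1) * Real.Gamma (μ + 1) /
        (Real.Gamma (d + μ + 1) * Real.Gamma (μ + a + 1)) * (1 - ‖z‖ ^ 2) ^ a) := by
  have hμ := μ.2
  have ha : (0 : ℝ) ≤ a := a.cast_nonneg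
  have hd : (0 : ℝ) ≤ d := d.cast_nonneg
  have h1 : Real.Gamma (d + μ + 1) ≠ 0 := (Real.Gamma_pos_of_pos (by linarith)).ne'
  have h2 : Real.Gamma ((μ : ℝ) + 1) ≠ 0 := (Real.Gamma_pos_of_pos (by linarith)).ne'
  rw [weightedMeasure, weightedMeasure, ← withDensity_mul _
    (measurable_weightFun d μ).ennreal_ofReal (by fun_prop)]
  refine withDensity_congr_ae ?_
  filter_upwards [ae_restrict_mem measurableSet_ball] with z hz
  have h := one_sub_normSq_pos hz
  rw [Pi.mul_apply, ← ENNReal.ofReal_mul (weightFun_pos hz).le]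
  congr 1
  have e1 : ((μ.shift a : Weight) : ℝ) = μ + a := rfl
  rw [weightFun, weightFun, e1, Real.rpow_add h, Real.rpow_natCast]
  have e2 : (d : ℝ) + (μ + a) + 1 = d + μ + a + 1 := by ring
  rw [e2]
  field_simp

lemma integral_weightedMeasure_shift {d : ℕ} (μ : Weight) (a : ℕ) {E : Type*}
    [NormedAddCommGroup E] [NormedSpace ℝ E] (F : Cn d → E) :
    ∫ z, F z ∂(weightedMeasure d (μ.shift a)) =
      ∫ z, (Real.Gamma (d + μ + a + 1) * Real.Gamma (μ + 1) /
        (Real.Gamma (d + μ + 1) * Real.Gamma (μ + a + 1)) * (1 - ‖z‖ ^ 2) ^ a) • F z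
        ∂(weightedMeasure d μ) := by
  rw [weightedMeasure_shift, integral_withDensity_eq_integral_toReal_smul (by fun_prop) (by simp)]
  refine integral_congr_ae ?_
  filter_upwards [ae_mem_ball d μ] with z hz
  have hμ := μ.2
  have ha : (0 : ℝ) ≤ a := a.cast_nonneg
  have hd : (0 : ℝ) ≤ d := d.cast_nonneg
  have h1 := (Real.Gamma_pos_of_pos (show (0 : ℝ) < d + μ + 1 by linarith))
  have h2 := (Real.Gamma_pos_of_pos (show (0 : ℝ) < μ + 1 by linarith))
  have h3 := (Real.Gamma_pos_of_pos (show (0 : ℝ) < d + μ + a + 1 by linarith))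
  have h4 := (Real.Gamma_pos_of_pos (show (0 : ℝ) < μ + a + 1 by linarith))
  have h := one_sub_normSq_pos hz
  rw [ENNReal.toReal_ofReal (by positivity)]

/-! ### Orthonormality of the monomials -/

lemma setIntegral_Ioo_rpow_mul_one_sub_rpow {α β : ℝ} (hα : 0 < α) (hβ : 0 < β) :
    ∫ x in Ioo (0 : ℝ) 1, x ^ (α - 1) * (1 - x) ^ (β - 1) =
      Real.Gamma α * Real.Gamma β / Real.Gamma (α + β) := by
  have h := ProbabilityTheory.beta_eq_betaIntegralReal α β hα hβ
  rw [ProbabilityTheory.beta] at h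
  rw [h, Complex.betaIntegral, intervalIntegral.integral_of_le (by norm_num),
    ← integral_Ioc_eq_integral_Ioo, ← RCLike.re_to_complex, ← integral_re]
  · refine setIntegral_congr_fun measurableSet_Ioc fun x ⟨hx1, hx₂⟩ ↦ ?_
    norm_cast
    rw [← Complex.ofReal_cpow hx1.le, ← Complex.ofReal_cpow (by linarith), RCLike.re_to_complex,
      Complex.re_mul_ofReal, Complex.ofReal_re]
  · convert! Complex.betaIntegral_convergent (u := α) (v := β) (by simpa) (by simpa)
    rw [intervalIntegrable_iff_integrableOn_Ioc_of_le (by simp), IntegrableOn]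

lemma integral_weightedMeasure {d : ℕ} (μ : Weight) {E : Type*} [NormedAddCommGroup E]
    [NormedSpace ℝ E] (F : Cn d → E) :
    ∫ z, F z ∂(weightedMeasure d μ) = ∫ z in ball (0 : Cn d) 1, weightFun d μ z • F z := by
  rw [weightedMeasure, integral_withDensity_eq_integral_toReal_smul
    (measurable_weightFun d μ).ennreal_ofReal (by simp)]
  refine setIntegral_congr_fun measurableSet_ball fun z hz => ?_
  rw [ENNReal.toReal_ofReal (weightFun_pos hz).le]

lemma volume_real_ball_Cn_one : (volume : Measure (Cn 1)).real (ball 0 1) = Real.pi := by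
  have : Nontrivial (Cn 1) := inferInstance
  rw [Measure.real, InnerProductSpace.volume_ball_of_dim_even (k := 1) (finrank_real_Cn 1)]
  simp [Real.pi_pos.le]

/-- The moments of the radial weights on the unit disc. -/
lemma integral_norm_pow_disc (μ : Weight) (a : ℕ) :
    ∫ z, ‖z‖ ^ (2 * a) ∂(weightedMeasure 1 μ) =
      Real.Gamma (a + 1) * Real.Gamma (μ + 2) / Real.Gamma (a + μ + 2) := by
  have hμ := μ.2
  have : Nontrivial (Cn 1) := inferInstance
  set C := Real.Gamma ((1 : ℕ) + μ + 1) / (Real.pi ^ 1 * Real.Gamma (μ + 1)) with hC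
  let g : ℝ → ℝ := (Ioo (0 : ℝ) 1).indicator fun t => t ^ ((a + 1 : ℝ) - 1) * (1 - t) ^ ((μ + 1 : ℝ) - 1)
  have h1 : ∫ z, ‖z‖ ^ (2 * a) ∂(weightedMeasure 1 μ) =
      ∫ z : Cn 1, (Iio (1 : ℝ)).indicator
        (fun r : ℝ => C * (1 - r ^ 2) ^ (μ : ℝ) * r ^ (2 * a)) ‖z‖ := by
    rw [integral_weightedMeasure, ← integral_indicator measurableSet_ball]
    congr 1
    ext z
    simp [indicator, weightFun, hC]
  have h2 : ∫ y in Ioi (0 : ℝ), y ^ (Module.finrank ℝ (Cn 1) - 1) • (Iio (1 : ℝ)).indicator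
        (fun r : ℝ => C * (1 - r ^ 2) ^ (μ : ℝ) * r ^ (2 * a)) y =
      ∫ y in Ioi (0 : ℝ), (C / 2) * ((2 * y ^ ((2 : ℝ) - 1)) • g (y ^ (2 : ℝ))) := by
    refine setIntegral_congr_fun measurableSet_Ioi fun y hy => ?_
    have hy : 0 < y := hy
    have e : y ^ ((2 : ℝ) - 1) = y := by norm_num
    simp only [finrank_real_Cn, g, e, Real.rpow_ofNat, smul_eq_mul]
    by_cases hy1 : y < 1
    · rw [indicator_of_mem (show y ∈ Iio 1 from hy1), indicator_of_mem
        (show y ^ 2 ∈ Ioo 0 1 from ⟨by positivity, by nlinarith⟩)]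
      simp only [add_sub_cancel_right, Real.rpow_natCast, ← pow_mul]
      ring
    · rw [indicator_of_notMem (show y ∉ Iio 1 from hy1), indicator_of_notMem]
      · simp
      · intro h; exact hy1 (by nlinarith [h.2])
  have h3 : ∫ y in Ioi (0 : ℝ), g y =
      Real.Gamma (a + 1) * Real.Gamma (μ + 1) / Real.Gamma (a + 1 + (μ + 1)) := by
    rw [← setIntegral_Ioo_rpow_mul_one_sub_rpow (by positivity) (by linarith),
      setIntegral_indicator measurableSet_Ioo, inter_eq_self_of_subset_right Ioo_subset_Ioi_self]
  rw [h1, integral_fun_norm_addHaar, h2, integral_const_mul,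
    integral_comp_rpow_Ioi_of_pos (by norm_num), h3, volume_real_ball_Cn_one, finrank_real_Cn, hC]
  have h4 : Real.Gamma ((μ : ℝ) + 1) ≠ 0 := (Real.Gamma_pos_of_pos (by linarith)).ne'
  have e1 : ((1 : ℕ) : ℝ) + μ + 1 = μ + 2 := by push_cast; ring
  have e2 : (a : ℝ) + 1 + (μ + 1) = a + μ + 2 := by ring
  rw [e1, e2]
  simp only [mul_one, nsmul_eq_mul, smul_eq_mul, Nat.cast_ofNat, pow_one]
  have := Real.pi_pos
  field_simp

/-- The weighted measures are invariant under rotations by a common angle. -/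
lemma measurePreserving_rotation {d : ℕ} (μ : Weight) (u : Circle) :
    MeasurePreserving (fun z : Cn d => (u : ℂ) • z) (weightedMeasure d μ)
      (weightedMeasure d μ) := by
  refine ⟨measurable_const_smul _, Measure.ext_of_lintegral _ fun F hF => ?_⟩
  have hm : Measurable fun z : Cn d => (u : ℂ) • z := measurable_const_smul _
  have h1 := lintegral_weightedMeasure μ (F := fun z => F ((u : ℂ) • z)) (hF.comp hm)
  have h2 := lintegral_rotation u 0 (F := (ball (0 : Cn d) 1).indicator
    fun z => ENNReal.ofReal (weightFun d μ z) * F z)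
    (((measurable_weightFun d μ).ennreal_ofReal.mul hF).indicator measurableSet_ball)
  rw [lintegral_map hF hm, h1, lintegral_weightedMeasure μ hF, ← h2]
  congr 1
  ext z
  have hn : ‖(u : ℂ) • z‖ = ‖z‖ := by rw [norm_smul, Circle.norm_coe, one_mul]
  simp only [indicator, weightFun, mem_ball_zero_iff, hn, zero_add]

lemma integral_rotation {d : ℕ} (μ : Weight) (u : Circle) {E : Type*} [NormedAddCommGroup E]
    [NormedSpace ℝ E] (F : Cn d → E) :
    ∫ z, F ((u : ℂ) • z) ∂(weightedMeasure d μ) = ∫ z, F z ∂(weightedMeasure d μ) :=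
  (measurePreserving_rotation μ u).integral_comp
    (measurableEmbedding_const_smul₀ (Circle.coe_ne_zero u)) F

lemma integrable_of_continuous {d : ℕ} (μ : Weight) {E : Type*} [NormedAddCommGroup E]
    [SecondCountableTopology E] {F : Cn d → E} (hF : Continuous F) :
    Integrable F (weightedMeasure d μ) := by
  obtain ⟨C, hC⟩ := (isCompact_closedBall (0 : Cn d) 1).exists_bound_of_continuousOn hF.continuousOn
  refine Integrable.of_bound hF.aestronglyMeasurable C ?_
  filter_upwards [ae_mem_ball d μ] with z hz using hC z (ball_subset_closedBall hz)

lemma continuous_monomialFun (d : ℕ) (μ : Weight) (α : Fin d → ℕ) :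
    Continuous (monomialFun d μ α) :=
  (differentiable_monomialFun d μ α).continuous

/-- The functions `e_α^μ` are orthonormal for `dv_μ`. -/
def MonomialsOrthonormal (d : ℕ) (μ : Weight) : Prop :=
  ∀ α β : Fin d → ℕ, ∫ z, starRingEnd ℂ (monomialFun d μ β z) * monomialFun d μ α z
    ∂(weightedMeasure d μ) = if α = β then 1 else 0

lemma monomialsOrthonormal_zero (μ : Weight) : MonomialsOrthonormal 0 μ := by
  intro α β
  have hμ := μ.2
  have h4 : Real.Gamma ((μ : ℝ) + 1) ≠ 0 := (Real.Gamma_pos_of_pos (by linarith)).ne'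
  have hv : (volume : Measure (Cn 0)).real univ = 1 := by
    let e : Cn 0 ≃ₗᵢ[ℝ] EuclideanSpace ℝ (Fin 0) :=
      { (0 : Cn 0 ≃ₗ[ℝ] EuclideanSpace ℝ (Fin 0)) with
        norm_map' := fun x => by rw [Subsingleton.elim x 0]; simp }
    have := e.measurePreserving.measure_preimage (s := univ) MeasurableSet.univ.nullMeasurableSet
    rw [Measure.real, ← preimage_univ, this, volume_euclideanSpace_eq_dirac]
    simp
  have hb : ball (0 : Cn 0) 1 = univ := by
    ext x; rw [Subsingleton.elim x 0]; simp
  have h0 : ∀ z : Cn 0, ‖z‖ = 0 := fun z => by rw [Subsingleton.elim z 0]; simp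
  rw [integral_weightedMeasure, hb, if_pos (Subsingleton.elim _ _)]
  simp [monomialFun, weightFun, h4, hv, h0]

lemma monomialsOrthonormal_one (μ : Weight) : MonomialsOrthonormal 1 μ := by
  intro α β
  have hμ := μ.2
  set a := α 0
  set b := β 0
  set A : ℂ := ((√(Real.Gamma ((1 : ℕ) + a + μ + 1) /
    (a.factorial * Real.Gamma ((1 : ℕ) + μ + 1))) : ℝ) : ℂ) with hA
  set B : ℂ := ((√(Real.Gamma ((1 : ℕ) + b + μ + 1) /
    (b.factorial * Real.Gamma ((1 : ℕ) + μ + 1))) : ℝ) : ℂ) with hB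
  have h1 : ∀ z : Cn 1, starRingEnd ℂ (monomialFun 1 μ β z) * monomialFun 1 μ α z =
      B * A * (starRingEnd ℂ (z 0) ^ b * z 0 ^ a) := by
    intro z
    simp only [monomialFun, Finset.univ_unique, Fin.default_eq_zero, Finset.sum_singleton,
      Finset.prod_singleton, map_mul, map_pow, Complex.conj_ofReal]
    ring
  simp only [h1, integral_const_mul]
  have hαβ : α = β ↔ a = b := by
    refine ⟨fun h => by simp [a, b, h], fun h => ?_⟩
    ext i; rw [Subsingleton.elim i 0]; exact h
  by_cases hab : a = b
  · rw [if_pos (hαβ.2 hab)]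
    have h2 : ∀ z : Cn 1, starRingEnd ℂ (z 0) ^ b * z 0 ^ a = ((‖z‖ ^ (2 * a) : ℝ) : ℂ) := by
      intro z
      have : ‖z‖ ^ 2 = ‖z 0‖ ^ 2 := by simp [EuclideanSpace.norm_sq_eq]
      rw [pow_mul, this, ← hab, ← mul_pow, mul_comm, Complex.mul_conj, Complex.normSq_eq_norm_sq]
      push_cast; ring
    have h3 : B * A = ((Real.Gamma ((1 : ℕ) + a + μ + 1) /
        (a.factorial * Real.Gamma ((1 : ℕ) + μ + 1)) : ℝ) : ℂ) := by
      have ha : (0 : ℝ) ≤ a := a.cast_nonneg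
      rw [hA, hB, ← hab, ← Complex.ofReal_mul, Real.mul_self_sqrt]
      have := Real.Gamma_pos_of_pos (show (0 : ℝ) < (1 : ℕ) + μ + 1 by push_cast; linarith)
      have := Real.Gamma_pos_of_pos (show (0 : ℝ) < (1 : ℕ) + a + μ + 1 by push_cast; linarith)
      positivity
    simp only [h2]
    rw [integral_complex_ofReal, integral_norm_pow_disc, h3, ← Complex.ofReal_mul,
      Complex.ofReal_eq_one, Real.Gamma_nat_eq_factorial]
    have ha : (0 : ℝ) ≤ a := a.cast_nonneg
    have e1 : ((1 : ℕ) : ℝ) + a + μ + 1 = a + μ + 2 := by push_cast; ring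
    have e2 : ((1 : ℕ) : ℝ) + μ + 1 = μ + 2 := by push_cast; ring
    have h5 := (Real.Gamma_pos_of_pos (show (0 : ℝ) < a + μ + 2 by linarith)).ne'
    have h6 := (Real.Gamma_pos_of_pos (show (0 : ℝ) < μ + 2 by linarith)).ne'
    have h7 : (a.factorial : ℝ) ≠ 0 := by positivity
    rw [e1, e2]
    field_simp
  · rw [if_neg (mt hαβ.1 hab)]
    set F : Cn 1 → ℂ := fun z => starRingEnd ℂ (z 0) ^ b * z 0 ^ a with hF
    -- the rotation by the angle `π / (a - b)` changes the sign of the integrand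
    have hab' : ((a : ℝ) - b) ≠ 0 := sub_ne_zero.2 (by exact_mod_cast hab)
    have h2 := integral_rotation μ (Circle.exp (Real.pi / (a - b))) F
    have h3 : ∀ z, F (((Circle.exp (Real.pi / (a - b)) : Circle) : ℂ) • z) = - F z := by
      intro z
      have e : starRingEnd ℂ ((Circle.exp (Real.pi / (a - b)) : Circle) : ℂ) ^ b *
          ((Circle.exp (Real.pi / (a - b)) : Circle) : ℂ) ^ a = -1 := by
        rw [← Circle.coe_inv_eq_conj, ← Circle.coe_pow, ← Circle.coe_pow, ← Circle.coe_mul,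
          ← Circle.exp_neg, ← Circle.exp_nsmul, ← Circle.exp_nsmul, ← Circle.exp_add]
        have : b • (-(Real.pi / ((a : ℝ) - b))) + a • (Real.pi / ((a : ℝ) - b)) = Real.pi := by
          simp only [nsmul_eq_mul]; field_simp; ring
        rw [this]; simp
      simp only [hF, PiLp.smul_apply, smul_eq_mul, map_mul, mul_pow]
      calc _ = (starRingEnd ℂ ((Circle.exp (Real.pi / (a - b)) : Circle) : ℂ) ^ b *
          ((Circle.exp (Real.pi / (a - b)) : Circle) : ℂ) ^ a) *
            (starRingEnd ℂ (z 0) ^ b * z 0 ^ a) := by ring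
        _ = _ := by rw [e]; ring
    simp only [h3, integral_neg] at h2
    have h4 : ∫ z, F z ∂(weightedMeasure 1 μ) = 0 := by
      have : (2 : ℂ) * ∫ z, F z ∂(weightedMeasure 1 μ) = 0 := by linear_combination -h2
      simpa using this
    rw [h4, mul_zero]

lemma shift_shift (μ : Weight) (p q : ℕ) : (μ.shift p).shift q = μ.shift (q + p) := by
  apply Subtype.ext
  simp only [Weight.shift]
  push_cast; ring

/-- The constant that relates the norms of monomials on the ball and on the base of its
fibration. -/
def fiberConst (ℓ d : ℕ) (μ : Weight) (a : ℕ) : ℝ :=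
  Real.Gamma (d + (μ + ℓ) + a + 1) * Real.Gamma (μ + ℓ + 1) /
    (Real.Gamma (d + (μ + ℓ) + 1) * Real.Gamma (μ + ℓ + a + 1))

lemma fiberConst_pos (ℓ d : ℕ) (μ : Weight) (a : ℕ) : 0 < fiberConst ℓ d μ a := by
  have hμ := μ.2
  have ha : (0 : ℝ) ≤ a := a.cast_nonneg
  have hd : (0 : ℝ) ≤ d := d.cast_nonneg
  have hl : (0 : ℝ) ≤ ℓ := ℓ.cast_nonneg
  have h1 := (Real.Gamma_pos_of_pos (show (0 : ℝ) < d + (μ + ℓ) + 1 by linarith))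
  have h2 := (Real.Gamma_pos_of_pos (show (0 : ℝ) < μ + ℓ + 1 by linarith))
  have h3 := (Real.Gamma_pos_of_pos (show (0 : ℝ) < d + (μ + ℓ) + a + 1 by linarith))
  have h4 := (Real.Gamma_pos_of_pos (show (0 : ℝ) < μ + ℓ + a + 1 by linarith))
  unfold fiberConst
  positivity

/-- The monomials factor along the fibration; the power of `√(1 - |z|²)` is the one that shifts the
weight on the base by `|α'|`. -/
lemma monomialFun_fiberMap {ℓ d : ℕ} (μ : Weight) (α' : Fin ℓ → ℕ) (α'' : Fin d → ℕ)
    (w : Cn ℓ) (z : Cn d) :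
    monomialFun (ℓ + d) μ (Fin.append α' α'') (fiberMap ℓ d (w, z)) =
      ((√(fiberConst ℓ d μ (∑ i, α' i)) * √(1 - ‖z‖ ^ 2) ^ (∑ i, α' i) : ℝ) : ℂ) *
        monomialFun ℓ μ α' w * monomialFun d (μ.shift ((∑ i, α' i) + ℓ)) α'' z := by
  set a := ∑ i, α' i with ha
  set b := ∑ i, α'' i with hb
  have hμ := μ.2
  have ha0 : (0 : ℝ) ≤ a := a.cast_nonneg
  have hb0 : (0 : ℝ) ≤ b := b.cast_nonneg
  have hd : (0 : ℝ) ≤ d := d.cast_nonneg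
  have hl : (0 : ℝ) ≤ ℓ := ℓ.cast_nonneg
  have h1 := (Real.Gamma_pos_of_pos (show (0 : ℝ) < ℓ + d + μ + 1 by linarith))
  have h2 := (Real.Gamma_pos_of_pos (show (0 : ℝ) < ℓ + μ + 1 by linarith))
  have h3 := (Real.Gamma_pos_of_pos (show (0 : ℝ) < ℓ + d + a + μ + 1 by linarith))
  have h4 := (Real.Gamma_pos_of_pos (show (0 : ℝ) < ℓ + a + μ + 1 by linarith))
  have h5 := (Real.Gamma_pos_of_pos (show (0 : ℝ) < ℓ + d + a + b + μ + 1 by linarith))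
  have hsum : ∑ i, Fin.append α' α'' i = a + b := by simp [Fin.sum_univ_add, ha, hb]
  have hfac : ∏ i, (Fin.append α' α'' i).factorial =
      (∏ i, (α' i).factorial) * ∏ i, (α'' i).factorial := by simp [Fin.prod_univ_add]
  have hprod : ∏ i, fiberMap ℓ d (w, z) i ^ Fin.append α' α'' i =
      ((√(1 - ‖z‖ ^ 2) ^ a : ℝ) : ℂ) * (∏ i, w i ^ α' i) * ∏ i, z i ^ α'' i := by
    simp only [fiberMap, Fin.prod_univ_add, joinCoords_castAdd, Fin.append_left,
      joinCoords_natAdd, Fin.append_right, PiLp.smul_apply, Complex.real_smul, mul_pow,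
      Finset.prod_mul_distrib]
    rw [Finset.prod_pow_eq_pow_sum]
    push_cast; rfl
  have hf1 : (0 : ℝ) < (∏ i, (α' i).factorial : ℕ) := by
    exact_mod_cast Finset.prod_pos fun i _ => Nat.factorial_pos _
  have hf2 : (0 : ℝ) < (∏ i, (α'' i).factorial : ℕ) := by
    exact_mod_cast Finset.prod_pos fun i _ => Nat.factorial_pos _
  have hcoef : √(Real.Gamma ((ℓ + d : ℕ) + (a + b : ℕ) + μ + 1) /
        ((∏ i, (α' i).factorial) * (∏ i, (α'' i).factorial) : ℕ) /
          Real.Gamma ((ℓ + d : ℕ) + μ + 1)) =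
      √(fiberConst ℓ d μ a) * √(Real.Gamma (ℓ + a + μ + 1) /
        ((∏ i, (α' i).factorial : ℕ) * Real.Gamma (ℓ + μ + 1))) *
      √(Real.Gamma (d + b + (μ.shift (a + ℓ) : Weight) + 1) /
        ((∏ i, (α'' i).factorial : ℕ) * Real.Gamma (d + (μ.shift (a + ℓ) : Weight) + 1))) := by
    rw [← Real.sqrt_mul (fiberConst_pos _ _ _ _).le, ← Real.sqrt_mul]
    · congr 1
      have e0 : ((μ.shift (a + ℓ) : Weight) : ℝ) = μ + (a + ℓ : ℕ) := rfl
      have e1 : (((ℓ + d : ℕ) : ℝ) + (a + b : ℕ) + μ + 1) = ℓ + d + a + b + μ + 1 := by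
        push_cast; ring
      have e2 : (((ℓ + d : ℕ) : ℝ) + μ + 1) = ℓ + d + μ + 1 := by push_cast; ring
      have e3 : (d : ℝ) + b + (μ + (a + ℓ : ℕ)) + 1 = ℓ + d + a + b + μ + 1 := by push_cast; ring
      have e4 : (d : ℝ) + (μ + (a + ℓ : ℕ)) + 1 = ℓ + d + a + μ + 1 := by push_cast; ring
      have e5 : (d : ℝ) + (μ + ℓ) + a + 1 = ℓ + d + a + μ + 1 := by ring
      have e6 : (μ : ℝ) + ℓ + 1 = ℓ + μ + 1 := by ring
      have e7 : (d : ℝ) + (μ + ℓ) + 1 = ℓ + d + μ + 1 := by ring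
      have e8 : (μ : ℝ) + ℓ + a + 1 = ℓ + a + μ + 1 := by ring
      rw [fiberConst, e0, e1, e2, e3, e4, e5, e6, e7, e8, Nat.cast_mul]
      field_simp
    · have := fiberConst_pos ℓ d μ a
      positivity
  rw [monomialFun, monomialFun, monomialFun, hsum, hfac, hprod, ← div_div, hcoef]
  simp only [← ha, ← hb, Complex.ofReal_mul]
  ring

/-- Matrix coefficients of a function of the last coordinates reduce to matrix coefficients over
the lower-dimensional ball, with respect to a shifted weight. -/
lemma integral_monomials_lastCoords {ℓ d : ℕ} {μ : Weight} (h : MonomialsOrthonormal ℓ μ)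
    (α' β' : Fin ℓ → ℕ) (α'' β'' : Fin d → ℕ) {c : Cn d → ℂ} (hc : Measurable c) {C : ℝ}
    (hC : ∀ z, ‖c z‖ ≤ C) :
    ∫ x, starRingEnd ℂ (monomialFun (ℓ + d) μ (Fin.append β' β'') x) *
        (c (lastCoords ℓ d x) * monomialFun (ℓ + d) μ (Fin.append α' α'') x)
        ∂(weightedMeasure (ℓ + d) μ) =
      if α' = β' then ∫ z, starRingEnd ℂ (monomialFun d (μ.shift ((∑ i, α' i) + ℓ)) β'' z) *
        (c z * monomialFun d (μ.shift ((∑ i, α' i) + ℓ)) α'' z)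
        ∂(weightedMeasure d (μ.shift ((∑ i, α' i) + ℓ)))
      else 0 := by
  set a := ∑ i, α' i with ha
  set b := ∑ i, β' i with hb
  have hint : Integrable (fun x => starRingEnd ℂ (monomialFun (ℓ + d) μ (Fin.append β' β'') x) *
        (c (lastCoords ℓ d x) * monomialFun (ℓ + d) μ (Fin.append α' α'') x))
        (weightedMeasure (ℓ + d) μ) := by
    have h1 : Integrable (fun x => starRingEnd ℂ (monomialFun (ℓ + d) μ (Fin.append β' β'') x) *
        monomialFun (ℓ + d) μ (Fin.append α' α'') x) (weightedMeasure (ℓ + d) μ) :=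
      integrable_of_continuous μ ((Complex.continuous_conj.comp (continuous_monomialFun _ _ _)).mul
        (continuous_monomialFun _ _ _))
    have h2 := h1.bdd_mul (f := fun x => c (lastCoords ℓ d x)) (c := C)
      (hc.comp (measurable_lastCoords ℓ d)).aestronglyMeasurable
      (Eventually.of_forall fun x => hC _)
    refine h2.congr (Eventually.of_forall fun x => ?_)
    simp only; ring
  rw [integral_fiberMap μ hint]
  have hin : ∀ z, ∫ w, starRingEnd ℂ (monomialFun (ℓ + d) μ (Fin.append β' β'')
        (fiberMap ℓ d (w, z))) * (c (lastCoords ℓ d (fiberMap ℓ d (w, z))) *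
          monomialFun (ℓ + d) μ (Fin.append α' α'') (fiberMap ℓ d (w, z))) ∂(weightedMeasure ℓ μ) =
      (((√(fiberConst ℓ d μ a) * √(1 - ‖z‖ ^ 2) ^ a : ℝ) : ℂ) *
      ((√(fiberConst ℓ d μ b) * √(1 - ‖z‖ ^ 2) ^ b : ℝ) : ℂ) *
      (starRingEnd ℂ (monomialFun d (μ.shift (b + ℓ)) β'' z) *
        (c z * monomialFun d (μ.shift (a + ℓ)) α'' z))) * if α' = β' then 1 else 0 := by
    intro z
    rw [← h α' β', ← integral_const_mul]
    congr 1
    ext w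
    rw [monomialFun_fiberMap, monomialFun_fiberMap, fiberMap, lastCoords_joinCoords,
      map_mul, map_mul, Complex.conj_ofReal]
    ring
  simp only [hin]
  by_cases hαβ : α' = β'
  · have hab : b = a := by rw [ha, hb, hαβ]
    simp only [if_pos hαβ, mul_one]
    rw [hab, ← shift_shift, integral_weightedMeasure_shift (μ.shift ℓ) a]
    refine integral_congr_ae ?_
    filter_upwards [ae_mem_ball d _] with z hz
    have h1 := one_sub_normSq_pos hz
    have e : (√(fiberConst ℓ d μ a) * √(1 - ‖z‖ ^ 2) ^ a) *
        (√(fiberConst ℓ d μ a) * √(1 - ‖z‖ ^ 2) ^ a) =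
        fiberConst ℓ d μ a * (1 - ‖z‖ ^ 2) ^ a := by
      calc _ = (√(fiberConst ℓ d μ a) * √(fiberConst ℓ d μ a)) *
            (√(1 - ‖z‖ ^ 2) * √(1 - ‖z‖ ^ 2)) ^ a := by ring
        _ = _ := by rw [Real.mul_self_sqrt (fiberConst_pos _ _ _ _).le, Real.mul_self_sqrt h1.le]
    rw [← Complex.ofReal_mul, e, Complex.real_smul]
    rfl
  · simp [if_neg hαβ]

/-- Integration over the fibers reduces orthonormality in `ℓ + d` variables to fewer variables. -/
lemma MonomialsOrthonormal.add {ℓ d : ℕ} {μ : Weight} (h : MonomialsOrthonormal ℓ μ)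
    (h' : ∀ ν, MonomialsOrthonormal d ν) : MonomialsOrthonormal (ℓ + d) μ := by
  intro α β
  obtain ⟨⟨α', α''⟩, rfl⟩ := (Fin.appendEquiv ℓ d).surjective α
  obtain ⟨⟨β', β''⟩, rfl⟩ := (Fin.appendEquiv ℓ d).surjective β
  have h1 := integral_monomials_lastCoords h α' β' α'' β'' (c := fun _ => 1) measurable_const
    (C := 1) (by simp)
  have h2 := h' (μ.shift ((∑ i, α' i) + ℓ)) α'' β''
  simp only [one_mul] at h1
  simp only [Fin.appendEquiv, Equiv.coe_fn_mk]
  rw [h1, h2]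
  have : Fin.append α' α'' = Fin.append β' β'' ↔ α' = β' ∧ α'' = β'' := by
    have := (Fin.appendEquiv ℓ d).injective.eq_iff (a := (α', α'')) (b := (β', β''))
    simpa [Fin.appendEquiv] using this
  simp only [this]
  split_ifs <;> simp_all

/-- The functions `e_α^μ` are orthonormal. -/
lemma monomialsOrthonormal (d : ℕ) (μ : Weight) : MonomialsOrthonormal d μ := by
  induction d generalizing μ with
  | zero => exact monomialsOrthonormal_zero μ
  | succ d ih =>
    rw [Nat.add_comm]
    exact (monomialsOrthonormal_one μ).add ih

/-! ### Taylor coefficients in one variable -/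

/-- The `a`-th Taylor coefficient at the origin of a function of one complex variable. -/
def taylorCoeff (a : ℕ) (G : ℂ → ℂ) : ℂ := (a.factorial : ℂ)⁻¹ * iteratedDeriv a G 0

lemma taylorCoeff_comp_mul (a : ℕ) {G : ℂ → ℂ} {ε : ℝ} (hε : 0 < ε)
    (hG : DifferentiableOn ℂ G (ball 0 ε)) {c : ℂ} (hc : ‖c‖ ≤ 1) :
    taylorCoeff a (fun ζ => G (c * ζ)) = c ^ a * taylorCoeff a G := by
  have h0 : (0 : ℂ) ∈ ball (0 : ℂ) ε := mem_ball_self hε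
  have hmap : MapsTo (fun ζ : ℂ => c * ζ) (ball 0 ε) (ball 0 ε) := by
    intro ζ hζ
    rw [mem_ball_zero_iff] at hζ ⊢
    rw [norm_mul]
    exact lt_of_le_of_lt (mul_le_of_le_one_left (norm_nonneg _) hc) hζ
  have h := iteratedDerivWithin_comp_const_smul (n := a) (x := 0) h0 isOpen_ball.uniqueDiffOn
    (hG.contDiffOn isOpen_ball) c hmap
  rw [mul_zero, iteratedDerivWithin_of_isOpen isOpen_ball h0,
    iteratedDerivWithin_of_isOpen isOpen_ball h0, smul_eq_mul] at h
  rw [taylorCoeff, taylorCoeff, h]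
  ring

/-- Cauchy's integral formula for Taylor coefficients. -/
lemma integral_circleMap_eq_taylorCoeff (a : ℕ) {G : ℂ → ℂ} {ρ : ℝ} (hρ : 0 < ρ)
    (hG : DifferentiableOn ℂ G (closedBall 0 ρ)) :
    ∫ θ in (0 : ℝ)..2 * Real.pi, ((circleMap 0 ρ θ) ^ a)⁻¹ * G (circleMap 0 ρ θ) =
      2 * Real.pi * taylorCoeff a G := by
  have h := hG.circleIntegral_one_div_sub_center_pow_smul hρ a
  have h1 : ∮ z in C(0, ρ), (1 / (z - 0) ^ (a + 1)) • G z =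
      Complex.I * ∫ θ in (0 : ℝ)..2 * Real.pi,
        ((circleMap 0 ρ θ) ^ a)⁻¹ * G (circleMap 0 ρ θ) := by
    rw [circleIntegral, ← intervalIntegral.integral_const_mul]
    congr 1
    ext θ
    have hne : circleMap 0 ρ θ ≠ 0 := circleMap_ne_center hρ.ne'
    simp only [deriv_circleMap, sub_zero, smul_eq_mul, pow_succ]
    field_simp
  rw [h1, smul_eq_mul] at h
  have hI : Complex.I ≠ 0 := Complex.I_ne_zero
  refine mul_left_cancel₀ hI ?_
  rw [h, taylorCoeff]
  field_simp

lemma exists_fderiv_bound {d : ℕ} {g : Cn d → ℂ} (hg : DifferentiableOn ℂ g (ball 0 1)) {R : ℝ}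
    (hR : R < 1) : ∃ M, ∀ x ∈ closedBall (0 : Cn d) R, ‖fderiv ℂ g x‖ ≤ M := by
  set t := (1 - R) / 2 with ht
  have ht0 : 0 < t := by rw [ht]; linarith
  have hsub : closedBall (0 : Cn d) (R + t) ⊆ ball 0 1 :=
    closedBall_subset_ball (by rw [ht]; linarith)
  obtain ⟨M, hM⟩ := (isCompact_closedBall (0 : Cn d) (R + t)).exists_bound_of_continuousOn
    (hg.continuousOn.mono hsub)
  refine ⟨(M + M) / t, fun x hx => ?_⟩
  have hxt : ball x t ⊆ closedBall (0 : Cn d) (R + t) := by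
    intro y hy
    rw [mem_closedBall_zero_iff] at hx ⊢
    have := norm_le_norm_add_norm_sub x y
    rw [mem_ball, dist_eq_norm, norm_sub_rev] at hy
    linarith
  refine Complex.norm_fderiv_le_div_of_mapsTo_ball (hg.mono (hxt.trans hsub)) (fun y hy => ?_) ht0
  rw [mem_closedBall, dist_eq_norm]
  exact (norm_sub_le _ _).trans (add_le_add (hM y (hxt hy)) (hM x (hxt (mem_ball_self ht0))))

/-- The number `ζ` as a point of `ℂ^1`. -/
def oneVec (ζ : ℂ) : Cn 1 := WithLp.toLp 2 fun _ => ζ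

@[simp] lemma norm_oneVec (ζ : ℂ) : ‖oneVec ζ‖ = ‖ζ‖ := by
  simp [oneVec, EuclideanSpace.norm_eq]

@[fun_prop] lemma differentiable_oneVec : Differentiable ℂ oneVec := by
  rw [differentiable_euclidean]
  exact fun _ => differentiable_id

/-- The `a`-th Taylor coefficient of a function in the first of `1 + d` variables. -/
def firstCoeff {d : ℕ} (a : ℕ) (g : Cn (1 + d) → ℂ) (z : Cn d) : ℂ :=
  taylorCoeff a fun ζ => g (joinCoords (oneVec ζ) z)

lemma differentiableOn_fiber {d : ℕ} {g : Cn (1 + d) → ℂ} (hg : DifferentiableOn ℂ g (ball 0 1))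
    (z : Cn d) :
    DifferentiableOn ℂ (fun ζ => g (joinCoords (oneVec ζ) z)) (ball 0 √(1 - ‖z‖ ^ 2)) := by
  have h : Differentiable ℂ fun ζ => joinCoords (oneVec ζ) z := by fun_prop
  refine hg.comp h.differentiableOn fun ζ hζ => ?_
  rw [mem_ball_zero_iff] at hζ
  rw [mem_ball_iff_one_sub, norm_sq_joinCoords, norm_oneVec]
  have h1 := Real.lt_sqrt (norm_nonneg _) |>.1 hζ
  linarith

lemma joinCoords_eq_add {ℓ d : ℕ} (w : Cn ℓ) (z : Cn d) :
    joinCoords w z = joinCoords w 0 + joinCoords 0 z := by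
  ext i
  refine Fin.addCases (fun i => ?_) (fun i => ?_) i <;> simp

/-- Taylor coefficients in one of the variables are holomorphic in the other ones: differentiation
under the integral sign in Cauchy's formula. -/
lemma differentiableOn_firstCoeff {d : ℕ} (a : ℕ) {g : Cn (1 + d) → ℂ}
    (hg : DifferentiableOn ℂ g (ball 0 1)) : DifferentiableOn ℂ (firstCoeff a g) (ball 0 1) := by
  intro z₀ hz₀
  rw [mem_ball_zero_iff] at hz₀
  set t := (1 + ‖z₀‖) / 2 with ht
  have ht0 : 0 < t := by positivity
  have ht1 : t < 1 := by rw [ht]; linarith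
  set ρ := 1 - t with hρ
  have hρ0 : 0 < ρ := by rw [hρ]; linarith
  set R := √(ρ ^ 2 + t ^ 2) with hR
  have hR1 : R < 1 := by
    rw [hR, Real.sqrt_lt' one_pos, hρ]
    nlinarith [mul_pos ht0 (show 0 < 1 - t by linarith)]
  have hs : ball (0 : Cn d) t ∈ 𝓝 z₀ :=
    isOpen_ball.mem_nhds (by rw [mem_ball_zero_iff, ht]; linarith)
  have hmem : ∀ z ∈ ball (0 : Cn d) t, ∀ ζ : ℂ, ‖ζ‖ ≤ ρ →
      joinCoords (oneVec ζ) z ∈ closedBall (0 : Cn (1 + d)) R := by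
    intro z hz ζ hζ
    rw [mem_ball_zero_iff] at hz
    rw [mem_closedBall_zero_iff]
    refine Real.le_sqrt_of_sq_le ?_
    rw [norm_sq_joinCoords, norm_oneVec]
    have := norm_nonneg z
    have := norm_nonneg ζ
    gcongr
  have hsub : closedBall (0 : Cn (1 + d)) R ⊆ ball 0 1 := closedBall_subset_ball hR1
  have hcirc : ∀ θ : ℝ, ‖circleMap 0 ρ θ‖ ≤ ρ := fun θ => by
    rw [norm_circleMap_zero, abs_of_pos hρ0]
  obtain ⟨M, hM⟩ := exists_fderiv_bound hg hR1
  let J : Cn d →L[ℂ] Cn (1 + d) := LinearMap.toContinuousLinearMap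
    { toFun := fun z => joinCoords (0 : Cn 1) z
      map_add' := fun x y => by
        ext i
        refine Fin.addCases (fun i => ?_) (fun i => ?_) i <;> simp
      map_smul' := fun a x => by
        ext i
        refine Fin.addCases (fun i => ?_) (fun i => ?_) i <;> simp }
  have hJ : ∀ z, J z = joinCoords (0 : Cn 1) z := fun _ => rfl
  let k : ℝ → ℂ := fun θ => ((circleMap 0 ρ θ) ^ a)⁻¹
  have hk : Continuous k :=
    ((continuous_circleMap 0 ρ).pow a).inv₀ fun θ => pow_ne_zero _ (circleMap_ne_center hρ0.ne')
  let F : Cn d → ℝ → ℂ := fun z θ => k θ * g (joinCoords (oneVec (circleMap 0 ρ θ)) z)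
  let F' : Cn d → ℝ → Cn d →L[ℂ] ℂ := fun z θ =>
    k θ • (fderiv ℂ g (joinCoords (oneVec (circleMap 0 ρ θ)) z)).comp J
  have hjc : ∀ z : Cn d, Continuous fun θ : ℝ => joinCoords (oneVec (circleMap 0 ρ θ)) z :=
    fun z => continuous_joinCoords.comp
      ((differentiable_oneVec.continuous.comp (continuous_circleMap 0 ρ)).prodMk continuous_const)
  have hFc : ∀ z ∈ ball (0 : Cn d) t, Continuous (F z) := by
    intro z hz
    refine hk.mul (ContinuousOn.comp_continuous (hg.continuousOn.mono hsub) (hjc z) fun θ => ?_)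
    exact hmem z hz _ (hcirc θ)
  have key := hasFDerivAt_integral_of_dominated_of_fderiv_le (𝕜 := ℂ)
    (μ := volume.restrict (Ioc 0 (2 * Real.pi))) (F := F) (F' := F') (x₀ := z₀)
    (bound := fun θ => ‖k θ‖ * (M * ‖J‖)) hs ?_ ?_ ?_ ?_ ?_ ?_
  · refine DifferentiableAt.differentiableWithinAt ?_
    refine (key.differentiableAt.const_mul ((2 * Real.pi : ℂ)⁻¹)).congr_of_eventuallyEq ?_
    filter_upwards [hs] with z hz
    have hd : DifferentiableOn ℂ (fun ζ => g (joinCoords (oneVec ζ) z)) (closedBall 0 ρ) := by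
      have h : Differentiable ℂ fun ζ => joinCoords (oneVec ζ) z := by fun_prop
      refine hg.comp h.differentiableOn fun ζ hζ => hsub (hmem z hz ζ ?_)
      simpa using hζ
    have := integral_circleMap_eq_taylorCoeff a hρ0 hd
    rw [intervalIntegral.integral_of_le Real.two_pi_pos.le] at this
    change _ = _ * ∫ θ in Ioc 0 (2 * Real.pi), ((circleMap 0 ρ θ) ^ a)⁻¹ *
      g (joinCoords (oneVec (circleMap 0 ρ θ)) z)
    rw [this, firstCoeff]
    have hpi : (2 * Real.pi : ℂ) ≠ 0 := by exact_mod_cast Real.two_pi_pos.ne'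
    field_simp
  · filter_upwards [hs] with z hz using (hFc z hz).aestronglyMeasurable
  · exact ((hFc z₀ (mem_of_mem_nhds hs)).continuousOn (s := Icc 0 (2 * Real.pi))).integrableOn_Icc.mono_set
      Ioc_subset_Icc_self
  · have h1 : Measurable fun θ : ℝ =>
        fderiv ℂ g (joinCoords (oneVec (circleMap 0 ρ θ)) z₀) :=
      (measurable_fderiv ℂ g).comp (hjc z₀).measurable
    have h2 : Continuous fun L : Cn (1 + d) →L[ℂ] ℂ => L.comp J := by fun_prop
    exact ((hk.measurable.aestronglyMeasurable).smul
      (h2.comp_aestronglyMeasurable h1.aestronglyMeasurable))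
  · refine Eventually.of_forall fun θ z hz => ?_
    simp only [F', norm_smul]
    refine mul_le_mul_of_nonneg_left ?_ (norm_nonneg _)
    refine (ContinuousLinearMap.opNorm_comp_le _ _).trans ?_
    exact mul_le_mul_of_nonneg_right (hM _ (hmem z hz _ (hcirc θ))) (norm_nonneg _)
  · exact ((hk.norm.mul continuous_const).continuousOn (s := Icc 0 (2 * Real.pi))).integrableOn_Icc.mono_set
      Ioc_subset_Icc_self
  · refine Eventually.of_forall fun θ z hz => ?_
    have h1 : HasFDerivAt (fun z => joinCoords (oneVec (circleMap 0 ρ θ)) z) J z := by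
      have : (fun z => joinCoords (oneVec (circleMap 0 ρ θ)) z) =
          fun z => joinCoords (oneVec (circleMap 0 ρ θ)) (0 : Cn d) + J z := by
        ext1 z; rw [joinCoords_eq_add, hJ]
      rw [this]
      exact J.hasFDerivAt.const_add _
    have h2 := (hg.differentiableAt (isOpen_ball.mem_nhds
      (hsub (hmem z hz _ (hcirc θ))))).hasFDerivAt.comp z h1
    exact h2.const_mul (k θ)

/-! ### Completeness of the monomials -/

/-- Rotation averages pick out the Taylor coefficients of a holomorphic function on the disc. -/
lemma integral_conj_pow_mul_disc (μ : Weight) (a : ℕ) {G : ℂ → ℂ}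
    (hG : DifferentiableOn ℂ G (ball 0 1))
    (hint : Integrable (fun w : Cn 1 => G (w 0)) (weightedMeasure 1 μ)) :
    ∫ w, starRingEnd ℂ (w 0) ^ a * G (w 0) ∂(weightedMeasure 1 μ) =
      taylorCoeff a G * ((∫ w, ‖w‖ ^ (2 * a) ∂(weightedMeasure 1 μ) : ℝ) : ℂ) := by
  classical
  have hnorm : ∀ w : Cn 1, ‖w‖ = ‖w 0‖ := fun w => by simp [EuclideanSpace.norm_eq]
  set G' : ℂ → ℂ := (ball (0 : ℂ) 1).indicator G with hG'
  have hGm : Measurable G' := by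
    have := ContinuousOn.measurable_piecewise hG.continuousOn
      (continuous_const (y := (0 : ℂ))).continuousOn measurableSet_ball
    convert this using 1
    ext w; simp [G', indicator, piecewise]
  have hae : (fun w : Cn 1 => G (w 0)) =ᵐ[weightedMeasure 1 μ] fun w => G' (w 0) := by
    filter_upwards [ae_mem_ball 1 μ] with w hw
    rw [hG', indicator_of_mem]
    rwa [mem_ball_zero_iff, ← hnorm, ← mem_ball_zero_iff]
  set φ : Cn 1 → ℂ := fun w => starRingEnd ℂ (w 0) ^ a * G' (w 0) with hφ
  have hφm : Measurable φ :=
    ((Complex.continuous_conj.measurable.comp (by fun_prop)).pow_const a).mul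
      (hGm.comp (by fun_prop))
  have hφi : Integrable φ (weightedMeasure 1 μ) := by
    refine (hint.congr hae).bdd_mul (c := 1) (Measurable.aestronglyMeasurable
      ((Complex.continuous_conj.measurable.comp (by fun_prop)).pow_const a)) ?_
    filter_upwards [ae_mem_ball 1 μ] with w hw
    rw [norm_pow, RCLike.norm_conj, ← hnorm]
    exact pow_le_one₀ (norm_nonneg _) (mem_ball_zero_iff.1 hw).le
  have hI : ∫ w, starRingEnd ℂ (w 0) ^ a * G (w 0) ∂(weightedMeasure 1 μ) =
      ∫ w, φ w ∂(weightedMeasure 1 μ) := by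
    refine integral_congr_ae ?_
    filter_upwards [hae] with w hw
    simp only [hφ]; rw [hw]
  have hprod : Integrable (Function.uncurry fun (θ : ℝ) (w : Cn 1) => φ ((Circle.exp θ : ℂ) • w))
      ((volume.restrict (Ioc 0 (2 * Real.pi))).prod (weightedMeasure 1 μ)) := by
    have hm : Measurable (Function.uncurry fun (θ : ℝ) (w : Cn 1) => φ ((Circle.exp θ : ℂ) • w)) :=
      hφm.comp (Continuous.measurable (by fun_prop))
    rw [integrable_prod_iff hm.aestronglyMeasurable]
    constructor
    · refine Eventually.of_forall fun θ => ?_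
      exact (measurePreserving_rotation μ (Circle.exp θ)).integrable_comp_of_integrable hφi
    · simp only [Function.uncurry]
      simp only [integral_rotation μ (Circle.exp _) fun w => ‖φ w‖]
      exact integrable_const _
  have hswap := integral_integral_swap hprod
  simp only [integral_rotation μ (Circle.exp _) φ] at hswap
  rw [integral_const] at hswap
  have hin : ∀ w ∈ ball (0 : Cn 1) 1,
      ∫ θ in Ioc 0 (2 * Real.pi), φ ((Circle.exp θ : ℂ) • w) =
        2 * Real.pi * taylorCoeff a G * ((‖w‖ ^ (2 * a) : ℝ) : ℂ) := by
    intro w hw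
    have hw1 : ‖w 0‖ < 1 := by rwa [← hnorm, ← mem_ball_zero_iff]
    have hmem : ∀ ζ : ℂ, ‖ζ‖ ≤ 1 → w 0 * ζ ∈ ball (0 : ℂ) 1 := by
      intro ζ hζ
      rw [mem_ball_zero_iff, norm_mul]
      exact lt_of_le_of_lt (mul_le_of_le_one_right (norm_nonneg _) hζ) hw1
    have hd : DifferentiableOn ℂ (fun ζ => G (w 0 * ζ)) (closedBall 0 1) :=
      hG.comp (by fun_prop) fun ζ hζ => hmem ζ (by simpa using hζ)
    have h1 := integral_circleMap_eq_taylorCoeff a one_pos hd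
    rw [taylorCoeff_comp_mul a one_pos hG hw1.le,
      intervalIntegral.integral_of_le Real.two_pi_pos.le] at h1
    have h2 : ∀ θ : ℝ, φ ((Circle.exp θ : ℂ) • w) = starRingEnd ℂ (w 0) ^ a *
        (((circleMap 0 1 θ) ^ a)⁻¹ * G (w 0 * circleMap 0 1 θ)) := by
      intro θ
      have e : circleMap 0 1 θ = (Circle.exp θ : ℂ) := by simp [circleMap]
      have hm := hmem (Circle.exp θ : ℂ) (Circle.norm_coe _).le
      simp only [hφ, PiLp.smul_apply, smul_eq_mul]
      rw [e, mul_comm (Circle.exp θ : ℂ) (w 0), hG', indicator_of_mem hm, map_mul, mul_pow,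
        ← Circle.coe_inv_eq_conj, Circle.coe_inv, inv_pow]
      ring
    simp only [h2]
    rw [integral_const_mul, h1, pow_mul, hnorm, ← Complex.normSq_eq_norm_sq, Complex.ofReal_pow,
      ← Complex.mul_conj, mul_pow]
    ring
  have hr : ∫ w, (∫ θ in Ioc 0 (2 * Real.pi), φ ((Circle.exp θ : ℂ) • w)) ∂(weightedMeasure 1 μ) =
      2 * Real.pi * taylorCoeff a G *
        ((∫ w, ‖w‖ ^ (2 * a) ∂(weightedMeasure 1 μ) : ℝ) : ℂ) := by
    rw [← integral_complex_ofReal, ← integral_const_mul]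
    refine integral_congr_ae ?_
    filter_upwards [ae_mem_ball 1 μ] with w hw using hin w hw
  rw [hr] at hswap
  rw [hI]
  have hpi : (2 * Real.pi : ℂ) ≠ 0 := by exact_mod_cast Real.two_pi_pos.ne'
  refine mul_left_cancel₀ hpi ?_
  rw [← mul_assoc, ← hswap]
  simp [Measure.real, Real.pi_pos.le]

lemma weightedMeasure_real_univ (d : ℕ) (μ : Weight) : (weightedMeasure d μ).real univ = 1 := by
  have hμ := μ.2
  have hd : (0 : ℝ) ≤ d := d.cast_nonneg
  have h := monomialsOrthonormal d μ 0 0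
  have h1 := (Real.Gamma_pos_of_pos (show (0 : ℝ) < d + μ + 1 by linarith)).ne'
  have h2 : ∀ z, monomialFun d μ 0 z = 1 := by
    intro z
    simp [monomialFun, h1]
  simp only [h2, map_one, mul_one, if_true, integral_const, Complex.real_smul] at h
  exact_mod_cast h

instance isProbabilityMeasure_weightedMeasure (d : ℕ) (μ : Weight) :
    IsProbabilityMeasure (weightedMeasure d μ) :=
  (isProbabilityMeasure_iff_real).2 (weightedMeasure_real_univ d μ)

lemma integral_norm_pow_disc_pos (μ : Weight) (a : ℕ) :
    0 < ∫ z, ‖z‖ ^ (2 * a) ∂(weightedMeasure 1 μ) := by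
  have hμ := μ.2
  have ha : (0 : ℝ) ≤ a := a.cast_nonneg
  rw [integral_norm_pow_disc]
  have h1 := (Real.Gamma_pos_of_pos (show (0 : ℝ) < a + 1 by linarith))
  have h2 := (Real.Gamma_pos_of_pos (show (0 : ℝ) < μ + 2 by linarith))
  have h3 := (Real.Gamma_pos_of_pos (show (0 : ℝ) < a + μ + 2 by linarith))
  positivity

/-- The integral over a fiber of `𝔹^(1+d) → 𝔹^d` against `conj w^a` is, up to a constant and a
power of `1 - |z|²`, the `a`-th Taylor coefficient in the fiber variable. -/
lemma integral_fiber_conj_pow {d : ℕ} (μ : Weight) (a : ℕ) {g : Cn (1 + d) → ℂ}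
    (hg : DifferentiableOn ℂ g (ball 0 1)) {z : Cn d} (hz : z ∈ ball (0 : Cn d) 1)
    (hint : Integrable (fun w => g (fiberMap 1 d (w, z))) (weightedMeasure 1 μ)) :
    ∫ w, starRingEnd ℂ (w 0) ^ a * g (fiberMap 1 d (w, z)) ∂(weightedMeasure 1 μ) =
      (√(1 - ‖z‖ ^ 2) : ℂ) ^ a * firstCoeff a g z *
        ((∫ w, ‖w‖ ^ (2 * a) ∂(weightedMeasure 1 μ) : ℝ) : ℂ) := by
  set s := √(1 - ‖z‖ ^ 2) with hs
  have h1 := one_sub_normSq_pos hz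
  have hs0 : 0 < s := Real.sqrt_pos.2 h1
  have hs1 : ‖(s : ℂ)‖ ≤ 1 := by
    rw [Complex.norm_real, Real.norm_of_nonneg hs0.le, hs]
    exact Real.sqrt_le_one.2 (by nlinarith [norm_nonneg z])
  have hfib := differentiableOn_fiber hg z
  have e : ∀ w : Cn 1, fiberMap 1 d (w, z) = joinCoords (oneVec ((s : ℂ) * w 0)) z := by
    intro w
    rw [fiberMap]
    congr 1
    ext i
    rw [Subsingleton.elim i 0]
    simp [oneVec, hs]
  have hG : DifferentiableOn ℂ (fun ζ : ℂ => g (joinCoords (oneVec ((s : ℂ) * ζ)) z))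
      (ball 0 1) := by
    refine hfib.comp (f := fun ζ : ℂ => (s : ℂ) * ζ) (by fun_prop) fun ζ hζ => ?_
    rw [mem_ball_zero_iff] at hζ ⊢
    rw [norm_mul, Complex.norm_real, Real.norm_of_nonneg hs0.le]
    exact mul_lt_of_lt_one_right hs0 hζ
  simp only [e] at hint ⊢
  rw [integral_conj_pow_mul_disc μ a hG hint, taylorCoeff_comp_mul a hs0 hfib hs1]
  rfl

lemma memLp_two_iff_integrable_sq {d : ℕ} {μ : Weight} {g : Cn d → ℂ}
    (hg : DifferentiableOn ℂ g (ball 0 1)) :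
    MemLp g 2 (weightedMeasure d μ) ↔
      Integrable (fun z => ‖g z‖ ^ 2) (weightedMeasure d μ) :=
  memLp_two_iff_integrable_sq_norm
    ((hg.continuousOn.aestronglyMeasurable measurableSet_ball).mono_ac (weightedMeasure_ac d μ))

/-- Taylor coefficients in the first variable are square integrable for a shifted weight. -/
lemma memLp_firstCoeff {d : ℕ} (μ : Weight) (a : ℕ) {g : Cn (1 + d) → ℂ}
    (hg : DifferentiableOn ℂ g (ball 0 1)) (hL : MemLp g 2 (weightedMeasure (1 + d) μ)) :
    MemLp (firstCoeff a g) 2 (weightedMeasure d (μ.shift (a + 1))) := by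
  have hh := differentiableOn_firstCoeff a hg
  rw [memLp_two_iff_integrable_sq hh]
  have hsq := (memLp_two_iff_integrable_sq hg).1 hL
  have hgi := hL.integrable one_le_two
  have h1 := (integrable_comp_fiberMap_iff μ hsq.aestronglyMeasurable).2 hsq
  have h2 := (integrable_comp_fiberMap_iff μ hgi.aestronglyMeasurable).2 hgi
  set m := ∫ w, ‖w‖ ^ (2 * a) ∂(weightedMeasure 1 μ) with hm
  have hm0 : 0 < m := integral_norm_pow_disc_pos μ a
  have key : Integrable (fun z => (1 - ‖z‖ ^ 2) ^ a * ‖firstCoeff a g z‖ ^ 2)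
      (weightedMeasure d (μ.shift 1)) := by
    have hmeas : AEStronglyMeasurable (fun z => (1 - ‖z‖ ^ 2) ^ a * ‖firstCoeff a g z‖ ^ 2)
        (weightedMeasure d (μ.shift 1)) := by
      refine AEStronglyMeasurable.mul (by fun_prop) (AEStronglyMeasurable.pow ?_ 2)
      exact ((hh.continuousOn.aestronglyMeasurable measurableSet_ball).mono_ac
        (weightedMeasure_ac d _)).norm
    refine (h1.integral_prod_right.const_mul (m ^ 2)⁻¹).mono' hmeas ?_
    filter_upwards [ae_mem_ball d _, h1.prod_left_ae, h2.prod_left_ae] with z hz hz1 hz2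
    have hz0 := one_sub_normSq_pos hz
    have e := integral_fiber_conj_pow μ a hg hz hz2
    have e1 : √(1 - ‖z‖ ^ 2) ^ a * ‖firstCoeff a g z‖ * m ≤
        ∫ w, ‖g (fiberMap 1 d (w, z))‖ ∂(weightedMeasure 1 μ) := by
      have : √(1 - ‖z‖ ^ 2) ^ a * ‖firstCoeff a g z‖ * m =
          ‖∫ w, starRingEnd ℂ (w 0) ^ a * g (fiberMap 1 d (w, z)) ∂(weightedMeasure 1 μ)‖ := by
        rw [e, norm_mul, norm_mul, norm_pow, Complex.norm_real, Complex.norm_real,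
          Real.norm_of_nonneg (Real.sqrt_nonneg _), Real.norm_of_nonneg hm0.le]
      rw [this]
      refine norm_integral_le_of_norm_le hz2.norm ?_
      filter_upwards [ae_mem_ball 1 μ] with w hw
      rw [norm_mul, norm_pow, RCLike.norm_conj]
      refine mul_le_of_le_one_left (norm_nonneg _) (pow_le_one₀ (norm_nonneg _) ?_)
      have : ‖w‖ = ‖w 0‖ := by simp [EuclideanSpace.norm_eq]
      rw [← this]
      exact (mem_ball_zero_iff.1 hw).le
    -- Cauchy-Schwarz on the fiber, a probability space
    have e2 : (∫ w, ‖g (fiberMap 1 d (w, z))‖ ∂(weightedMeasure 1 μ)) ^ 2 ≤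
        ∫ w, ‖g (fiberMap 1 d (w, z))‖ ^ 2 ∂(weightedMeasure 1 μ) := by
      have hconv : ConvexOn ℝ univ fun x : ℝ => x ^ 2 := even_two.convexOn_pow
      exact hconv.map_integral_le (by fun_prop) isClosed_univ (by simp) hz2.norm hz1
    have e3 := (pow_le_pow_left₀ (by positivity) e1 2).trans e2
    rw [Real.norm_of_nonneg (by positivity), inv_mul_eq_div, le_div_iff₀ (by positivity)]
    refine le_of_eq_of_le ?_ e3
    rw [mul_pow, mul_pow, ← pow_mul, mul_comm a 2, pow_mul, Real.sq_sqrt hz0.le]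
  rw [← shift_shift, weightedMeasure_shift,
    integrable_withDensity_iff (by fun_prop) (Eventually.of_forall fun _ => ENNReal.ofReal_lt_top)]
  refine (key.const_mul (fiberConst 1 d μ a)).congr ?_
  filter_upwards [ae_mem_ball d _] with z hz
  have hz0 := one_sub_normSq_pos hz
  have hc := fiberConst_pos 1 d μ a
  have e : Real.Gamma (d + (μ.shift 1 : Weight) + a + 1) * Real.Gamma ((μ.shift 1 : Weight) + 1) /
      (Real.Gamma (d + (μ.shift 1 : Weight) + 1) * Real.Gamma ((μ.shift 1 : Weight) + a + 1)) =
        fiberConst 1 d μ a := rfl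
  rw [e, ENNReal.toReal_ofReal (by positivity)]
  ring

/-- The moments of a function on `𝔹^(1+d)` against monomials are moments on `𝔹^d` of its Taylor
coefficients in the first variable. -/
lemma integral_conj_monomialFun_append {d : ℕ} (μ : Weight) (a : ℕ) (β : Fin d → ℕ)
    {g : Cn (1 + d) → ℂ} (hg : DifferentiableOn ℂ g (ball 0 1))
    (hL : MemLp g 2 (weightedMeasure (1 + d) μ)) :
    ∃ C : ℂ, C ≠ 0 ∧
      ∫ x, starRingEnd ℂ (monomialFun (1 + d) μ (Fin.append (fun _ => a) β) x) * g x
        ∂(weightedMeasure (1 + d) μ) =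
      C * ∫ z, starRingEnd ℂ (monomialFun d (μ.shift (a + 1)) β z) * firstCoeff a g z
        ∂(weightedMeasure d (μ.shift (a + 1))) := by
  have hμ := μ.2
  have ha : (0 : ℝ) ≤ a := a.cast_nonneg
  have hgi := hL.integrable one_le_two
  have h2 := (integrable_comp_fiberMap_iff μ hgi.aestronglyMeasurable).2 hgi
  set m := ∫ w, ‖w‖ ^ (2 * a) ∂(weightedMeasure 1 μ) with hm
  have hm0 : 0 < m := integral_norm_pow_disc_pos μ a
  set A : ℝ := √(Real.Gamma ((1 : ℕ) + a + μ + 1) /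
    (a.factorial * Real.Gamma ((1 : ℕ) + μ + 1))) with hA
  have hA0 : 0 < A := by
    have h1 := (Real.Gamma_pos_of_pos (show (0 : ℝ) < (1 : ℕ) + a + μ + 1 by
      push_cast; linarith))
    have h2 := (Real.Gamma_pos_of_pos (show (0 : ℝ) < (1 : ℕ) + μ + 1 by push_cast; linarith))
    rw [hA]; positivity
  have hc := fiberConst_pos 1 d μ a
  have hmono : ∀ w : Cn 1, monomialFun 1 μ (fun _ => a) w = A * w 0 ^ a := by
    intro w
    simp [monomialFun, hA]
  have hint : Integrable (fun x => starRingEnd ℂ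
      (monomialFun (1 + d) μ (Fin.append (fun _ => a) β) x) * g x)
      (weightedMeasure (1 + d) μ) := by
    have hcont := Complex.continuous_conj.comp
      (continuous_monomialFun (1 + d) μ (Fin.append (fun _ => a) β))
    obtain ⟨K, hK⟩ := (isCompact_closedBall (0 : Cn (1 + d)) 1).exists_bound_of_continuousOn
      hcont.continuousOn
    refine hgi.bdd_mul (c := K) hcont.aestronglyMeasurable ?_
    filter_upwards [ae_mem_ball _ μ] with x hx using hK x (ball_subset_closedBall hx)
  refine ⟨((A * m / √(fiberConst 1 d μ a) : ℝ) : ℂ), ?_, ?_⟩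
  · exact_mod_cast (by positivity : (0 : ℝ) < A * m / √(fiberConst 1 d μ a)).ne'
  rw [integral_fiberMap μ hint, ← shift_shift, integral_weightedMeasure_shift (μ.shift 1) a,
    ← integral_const_mul]
  refine integral_congr_ae ?_
  filter_upwards [ae_mem_ball d _, h2.prod_left_ae] with z hz hz2
  have hz0 := one_sub_normSq_pos hz
  have e : Real.Gamma (d + (μ.shift 1 : Weight) + a + 1) * Real.Gamma ((μ.shift 1 : Weight) + 1) /
      (Real.Gamma (d + (μ.shift 1 : Weight) + 1) * Real.Gamma ((μ.shift 1 : Weight) + a + 1)) =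
        fiberConst 1 d μ a := rfl
  have h3 : ∀ w : Cn 1, starRingEnd ℂ
      (monomialFun (1 + d) μ (Fin.append (fun _ => a) β) (fiberMap 1 d (w, z))) *
        g (fiberMap 1 d (w, z)) =
      (√(fiberConst 1 d μ a) * √(1 - ‖z‖ ^ 2) ^ a * A *
        starRingEnd ℂ (monomialFun d (μ.shift (a + 1)) β z)) *
        (starRingEnd ℂ (w 0) ^ a * g (fiberMap 1 d (w, z))) := by
    intro w
    rw [monomialFun_fiberMap, hmono]
    simp only [Finset.univ_unique, Fin.default_eq_zero, Finset.sum_singleton, map_mul, map_pow,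
      Complex.conj_ofReal]
    push_cast
    ring
  simp only [h3]
  rw [integral_const_mul, integral_fiber_conj_pow μ a hg hz hz2, e, Complex.real_smul, ← hm,
    shift_shift]
  have e4 : (√(1 - ‖z‖ ^ 2) : ℂ) ^ a * (√(1 - ‖z‖ ^ 2) : ℂ) ^ a =
      (((1 - ‖z‖ ^ 2) ^ a : ℝ) : ℂ) := by
    rw [← mul_pow, ← Complex.ofReal_mul, Real.mul_self_sqrt hz0.le]
    push_cast; rfl
  have e5 : (√(fiberConst 1 d μ a) : ℂ) * (√(fiberConst 1 d μ a) : ℂ) = fiberConst 1 d μ a := by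
    rw [← Complex.ofReal_mul, Real.mul_self_sqrt hc.le]
  have e6 : (√(fiberConst 1 d μ a) : ℂ) ≠ 0 := by
    exact_mod_cast (Real.sqrt_pos.2 hc).ne'
  calc _ = (√(fiberConst 1 d μ a) : ℂ) * A * m * ((√(1 - ‖z‖ ^ 2) : ℂ) ^ a *
        (√(1 - ‖z‖ ^ 2) : ℂ) ^ a) * (starRingEnd ℂ (monomialFun d (μ.shift (a + 1)) β z) *
          firstCoeff a g z) := by ring
    _ = _ := by
      rw [e4, Complex.ofReal_mul (fiberConst 1 d μ a), ← e5]
      push_cast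
      field_simp

/-- The monomials are complete: a square integrable holomorphic function that is orthogonal to all
of them vanishes. -/
def MonomialsComplete (d : ℕ) (μ : Weight) : Prop :=
  ∀ g : Cn d → ℂ, DifferentiableOn ℂ g (ball 0 1) → MemLp g 2 (weightedMeasure d μ) →
    (∀ α, ∫ z, starRingEnd ℂ (monomialFun d μ α z) * g z ∂(weightedMeasure d μ) = 0) →
    ∀ z ∈ ball (0 : Cn d) 1, g z = 0

lemma monomialsComplete_zero (μ : Weight) : MonomialsComplete 0 μ := by
  intro g _ _ h z _
  have hμ := μ.2
  have h1 := (Real.Gamma_pos_of_pos (show (0 : ℝ) < μ + 1 by linarith)).ne'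
  have h0 : ∀ y, starRingEnd ℂ (monomialFun 0 μ 0 y) * g y = g z := by
    intro y
    rw [Subsingleton.elim y z]
    simp [monomialFun, h1]
  have := h 0
  simp only [h0] at this
  simpa using this

/-- The Taylor coefficients in the first variable of a function that is orthogonal to all monomials
are orthogonal to all monomials themselves. -/
lemma MonomialsComplete.one_add {d : ℕ} (ih : ∀ ν, MonomialsComplete d ν) (μ : Weight) :
    MonomialsComplete (1 + d) μ := by
  intro g hg hL h z hz
  have hcoef : ∀ a, ∀ y ∈ ball (0 : Cn d) 1, firstCoeff a g y = 0 := by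
    intro a
    refine ih (μ.shift (a + 1)) _ (differentiableOn_firstCoeff a hg) (memLp_firstCoeff μ a hg hL)
      fun β => ?_
    obtain ⟨C, hC, hCe⟩ := integral_conj_monomialFun_append μ a β hg hL
    rw [h] at hCe
    exact (mul_eq_zero.1 hCe.symm).resolve_left hC
  obtain ⟨x, rfl⟩ := (joinIsometry 1 d).surjective z
  change g (joinCoords x.fst x.snd) = 0
  change joinCoords x.fst x.snd ∈ _ at hz
  have hx1 : x.fst = oneVec (x.fst 0) := by
    ext i; rw [Subsingleton.elim i 0]; rfl
  rw [mem_ball_iff_one_sub, norm_sq_joinCoords, hx1, norm_oneVec] at hz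
  have hx2 : x.snd ∈ ball (0 : Cn d) 1 :=
    mem_ball_iff_one_sub.2 (by nlinarith [sq_nonneg ‖x.fst 0‖])
  have hx3 : x.fst 0 ∈ ball (0 : ℂ) √(1 - ‖x.snd‖ ^ 2) := by
    rw [mem_ball_zero_iff]
    exact Real.lt_sqrt_of_sq_lt (by linarith)
  have hs := Complex.hasSum_taylorSeries_on_ball (differentiableOn_fiber hg x.snd) hx3
  have hz0 : ∀ n : ℕ, (n.factorial : ℂ)⁻¹ • (x.fst 0 - 0) ^ n •
      iteratedDeriv n (fun ζ => g (joinCoords (oneVec ζ) x.snd)) 0 = 0 := by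
    intro n
    have := hcoef n _ hx2
    rw [firstCoeff, taylorCoeff] at this
    rw [smul_comm, smul_eq_mul (a := (n.factorial : ℂ)⁻¹), this, smul_zero]
  simp only [hz0] at hs
  rw [hx1]
  exact hs.unique hasSum_zero

lemma monomialsComplete (d : ℕ) (μ : Weight) : MonomialsComplete d μ := by
  induction d generalizing μ with
  | zero => exact monomialsComplete_zero μ
  | succ d ih =>
    rw [Nat.add_comm]
    exact MonomialsComplete.one_add ih μ

/-! ### Holomorphic representatives, the monomial Hilbert basis and the reproducing kernel -/

lemma eqOn_ball_of_ae_eq {d : ℕ} (μ : Weight) {g h : Cn d → ℂ}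
    (hg : DifferentiableOn ℂ g (ball 0 1)) (hh : DifferentiableOn ℂ h (ball 0 1))
    (e : g =ᵐ[weightedMeasure d μ] h) : EqOn g h (ball 0 1) := by
  intro z hz
  obtain ⟨C, -, s, hs, -, hb⟩ := point_bound μ hz
  have h1 := hb z (mem_ball_self hs) (g - h) (hg.sub hh)
  have h2 : eLpNorm (g - h) 2 (weightedMeasure d μ) = 0 := by
    have h0 : g - h =ᵐ[weightedMeasure d μ] 0 := by
      filter_upwards [e] with w hw
      simp [hw]
    rw [eLpNorm_congr_ae h0, eLpNorm_zero]
  rw [h2, mul_zero, nonpos_iff_eq_zero, enorm_eq_zero] at h1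
  exact sub_eq_zero.1 h1

/-- The holomorphic function on the ball that represents an element of the Bergman space. -/
def BergmanSpace.fn {d : ℕ} {μ : Weight} (f : BergmanSpace d μ) : Cn d → ℂ :=
  Classical.choose f.2

namespace BergmanSpace

variable {d : ℕ} {μ : Weight}

lemma differentiableOn_fn (f : BergmanSpace d μ) : DifferentiableOn ℂ f.fn (ball 0 1) :=
  (Classical.choose_spec f.2).1

lemma coeFn_ae_eq_fn (f : BergmanSpace d μ) :
    (bergmanIncl d μ f : Cn d → ℂ) =ᵐ[weightedMeasure d μ] f.fn :=
  (Classical.choose_spec f.2).2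

lemma memLp_fn (f : BergmanSpace d μ) : MemLp f.fn 2 (weightedMeasure d μ) :=
  (Lp.memLp (bergmanIncl d μ f)).ae_eq f.coeFn_ae_eq_fn

lemma fn_eqOn (f : BergmanSpace d μ) {g : Cn d → ℂ} (hg : DifferentiableOn ℂ g (ball 0 1))
    (h : (bergmanIncl d μ f : Cn d → ℂ) =ᵐ[weightedMeasure d μ] g) : EqOn f.fn g (ball 0 1) :=
  eqOn_ball_of_ae_eq μ f.differentiableOn_fn hg (f.coeFn_ae_eq_fn.symm.trans h)

lemma inner_bergmanIncl (f h : BergmanSpace d μ) :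
    inner ℂ (bergmanIncl d μ f) (bergmanIncl d μ h) = inner ℂ f h := rfl

lemma norm_bergmanIncl (f : BergmanSpace d μ) : ‖bergmanIncl d μ f‖ = ‖f‖ := rfl

lemma inner_eq_integral (f h : BergmanSpace d μ) :
    inner ℂ f h = ∫ z, starRingEnd ℂ (f.fn z) * h.fn z ∂(weightedMeasure d μ) := by
  rw [← inner_bergmanIncl, L2.inner_def]
  refine integral_congr_ae ?_
  filter_upwards [f.coeFn_ae_eq_fn, h.coeFn_ae_eq_fn] with z h1 h2
  rw [h1, h2, RCLike.inner_apply, mul_comm]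

lemma fn_add (f h : BergmanSpace d μ) : EqOn (f + h).fn (f.fn + h.fn) (ball 0 1) := by
  refine fn_eqOn _ (f.differentiableOn_fn.add h.differentiableOn_fn) ?_
  rw [map_add]
  exact (Lp.coeFn_add _ _).trans (f.coeFn_ae_eq_fn.add h.coeFn_ae_eq_fn)

lemma fn_smul (a : ℂ) (f : BergmanSpace d μ) : EqOn (a • f).fn (a • f.fn) (ball 0 1) := by
  refine fn_eqOn _ (f.differentiableOn_fn.const_smul a) ?_
  rw [map_smul]
  exact (Lp.coeFn_smul _ _).trans (f.coeFn_ae_eq_fn.const_smul a)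

lemma eq_zero_of_fn {f : BergmanSpace d μ} (h : ∀ z ∈ ball (0 : Cn d) 1, f.fn z = 0) : f = 0 := by
  rw [← inner_self_eq_zero (𝕜 := ℂ), inner_eq_integral]
  have : (fun z => starRingEnd ℂ (f.fn z) * f.fn z) =ᵐ[weightedMeasure d μ] fun _ => 0 := by
    filter_upwards [ae_mem_ball d μ] with z hz
    rw [h z hz, mul_zero]
  rw [integral_congr_ae this, integral_zero]

/-- Evaluation at a point of the ball. -/
def eval (z : Ball d) : StrongDual ℂ (BergmanSpace d μ) :=
  LinearMap.mkContinuousOfExistsBound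
    { toFun := fun f => f.fn z
      map_add' := fun f h => fn_add f h z.2
      map_smul' := fun a f => fn_smul a f z.2 } <| by
    obtain ⟨C, hC, s, hs, -, hb⟩ := point_bound μ z.2
    refine ⟨C.toReal, fun f => ?_⟩
    have h1 := hb z (mem_ball_self hs) f.fn f.differentiableOn_fn
    have h2 : eLpNorm f.fn 2 (weightedMeasure d μ) = ENNReal.ofReal ‖f‖ := by
      rw [← eLpNorm_congr_ae f.coeFn_ae_eq_fn, ← norm_bergmanIncl, Lp.norm_def,
        ENNReal.ofReal_toReal (Lp.eLpNorm_ne_top _)]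
    rw [h2, ← ofReal_norm, ← ENNReal.ofReal_toReal hC, ← ENNReal.ofReal_mul (by positivity),
      ENNReal.ofReal_le_ofReal_iff (by positivity)] at h1
    exact h1

@[simp] lemma eval_apply (z : Ball d) (f : BergmanSpace d μ) : eval z f = f.fn z := rfl

/-- The reproducing kernel of the Bergman space at the point `z`, as a vector. -/
def kernel (μ : Weight) (z : Ball d) : BergmanSpace d μ :=
  (InnerProductSpace.toDual ℂ (BergmanSpace d μ)).symm (eval z)

lemma inner_kernel (z : Ball d) (f : BergmanSpace d μ) : inner ℂ (kernel μ z) f = f.fn z := by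
  rw [kernel, InnerProductSpace.toDual_symm_apply, eval_apply]

end BergmanSpace

lemma fn_basisVec {d : ℕ} (μ : Weight) (α : Fin d → ℕ) :
    EqOn (basisVec d μ α).fn (monomialFun d μ α) (ball 0 1) :=
  BergmanSpace.fn_eqOn _ (differentiable_monomialFun d μ α).differentiableOn
    (memLp_monomialFun d μ α).coeFn_toLp

lemma fn_basisVec_ae {d : ℕ} (μ : Weight) (α : Fin d → ℕ) :
    (basisVec d μ α).fn =ᵐ[weightedMeasure d μ] monomialFun d μ α := by
  filter_upwards [ae_mem_ball d μ] with z hz using fn_basisVec μ α hz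

lemma orthonormal_basisVec (d : ℕ) (μ : Weight) : Orthonormal ℂ (basisVec d μ) := by
  classical
  rw [orthonormal_iff_ite]
  intro α β
  rw [BergmanSpace.inner_eq_integral, eq_comm, ← ite_congr (propext eq_comm) (fun _ => rfl)
    (fun _ => rfl), ← monomialsOrthonormal d μ β α]
  refine integral_congr_ae ?_
  filter_upwards [fn_basisVec_ae μ α, fn_basisVec_ae μ β] with z h1 h2
  rw [h1, h2]

/-- The monomial Hilbert basis of the Bergman space. -/
def monomialBasis (d : ℕ) (μ : Weight) : HilbertBasis (Fin d → ℕ) ℂ (BergmanSpace d μ) :=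
  HilbertBasis.mkOfOrthogonalEqBot (orthonormal_basisVec d μ) <| by
    rw [Submodule.eq_bot_iff]
    intro f hf
    refine BergmanSpace.eq_zero_of_fn (monomialsComplete d μ _ f.differentiableOn_fn f.memLp_fn
      fun α => ?_)
    have h1 : inner ℂ (basisVec d μ α) f = 0 :=
      (Submodule.mem_orthogonal _ _).1 hf _ (Submodule.subset_span ⟨α, rfl⟩)
    rw [BergmanSpace.inner_eq_integral] at h1
    rw [← h1]
    refine integral_congr_ae ?_
    filter_upwards [fn_basisVec_ae μ α] with z hz
    rw [hz]

@[simp] lemma monomialBasis_apply (d : ℕ) (μ : Weight) (α : Fin d → ℕ) :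
    monomialBasis d μ α = basisVec d μ α := by
  simp [monomialBasis]

/-- The exponent `d + 1 + μ` of the Bergman kernel. -/
def kernelExp (d : ℕ) (μ : Weight) : ℝ := d + 1 + μ

lemma kernelExp_pos (d : ℕ) (μ : Weight) : 0 < kernelExp d μ := by
  have := μ.2
  have : (0 : ℝ) ≤ d := d.cast_nonneg
  unfold kernelExp; linarith

lemma ring_choose_eq_Gamma {N : ℝ} (hN : 0 < N) (n : ℕ) :
    Ring.choose ((N : ℂ) + n - 1) n =
      ((Real.Gamma (N + n) / (n.factorial * Real.Gamma N) : ℝ) : ℂ) := by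
  have h1 : ∀ k : ℕ, (N : ℂ) ≠ -k := by
    intro k h
    have : N = -k := by exact_mod_cast h
    have : (0 : ℝ) ≤ k := k.cast_nonneg
    linarith
  have h2 := Complex.Gamma_add_nat_div_Gamma_eq (n := n) (N : ℂ) h1
  have h3 := Ring.factorial_nsmul_multichoose_eq_ascPochhammer (N : ℂ) n
  rw [Polynomial.ascPochhammer_smeval_eq_eval, ← h2] at h3
  rw [Ring.choose, show (N : ℂ) + n - 1 - n + 1 = N by ring]
  have hf : (n.factorial : ℂ) ≠ 0 := by exact_mod_cast n.factorial_ne_zero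
  rw [nsmul_eq_mul] at h3
  rw [← mul_right_inj' hf, h3]
  have e : (N : ℂ) + n = ((N + n : ℝ) : ℂ) := by push_cast; rfl
  rw [e, Complex.Gamma_ofReal, Complex.Gamma_ofReal]
  push_cast
  field_simp

lemma norm_inner_lt_one {d : ℕ} (z w : Ball d) : ‖inner ℂ (z : Cn d) (w : Cn d)‖ < 1 := by
  have hz := mem_ball_zero_iff.1 z.2
  have hw := mem_ball_zero_iff.1 w.2
  refine (norm_inner_le_norm _ _).trans_lt ?_
  exact mul_lt_one_of_nonneg_of_lt_one_left (norm_nonneg _) hz hw.le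

/-- The Bergman kernel in closed form: the monomial expansion is summed by the multinomial theorem
and the binomial series. -/
lemma fn_kernel {d : ℕ} (μ : Weight) (z w : Ball d) :
    (BergmanSpace.kernel μ z).fn w =
      1 / (1 - inner ℂ (z : Cn d) (w : Cn d)) ^ ((kernelExp d μ : ℝ) : ℂ) := by
  set N := kernelExp d μ with hN
  have hN0 : 0 < N := kernelExp_pos d μ
  set x := inner ℂ (z : Cn d) (w : Cn d) with hx
  have hxsum : x = ∑ i, (w : Cn d) i * starRingEnd ℂ ((z : Cn d) i) := by
    rw [hx, PiLp.inner_apply]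
    simp [RCLike.inner_apply]
  have h1 := (monomialBasis d μ).hasSum_inner_mul_inner (BergmanSpace.kernel μ w)
    (BergmanSpace.kernel μ z)
  rw [BergmanSpace.inner_kernel] at h1
  have h2 : ∀ α : Fin d → ℕ, inner ℂ (BergmanSpace.kernel μ w) (monomialBasis d μ α) *
      inner ℂ (monomialBasis d μ α) (BergmanSpace.kernel μ z) =
      ((Real.Gamma (N + (∑ i, α i : ℕ)) / ((∏ i, (α i).factorial : ℕ) * Real.Gamma N) : ℝ) : ℂ) *
        ∏ i, ((w : Cn d) i * starRingEnd ℂ ((z : Cn d) i)) ^ α i := by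
    intro α
    rw [← inner_conj_symm (monomialBasis d μ α), BergmanSpace.inner_kernel,
      BergmanSpace.inner_kernel, monomialBasis_apply, fn_basisVec μ α w.2, fn_basisVec μ α z.2,
      monomialFun, monomialFun]
    have e1 : (d : ℝ) + (∑ i, α i : ℕ) + μ + 1 = N + (∑ i, α i : ℕ) := by
      rw [hN, kernelExp]; ring
    have e2 : (d : ℝ) + μ + 1 = N := by rw [hN, kernelExp]; ring
    rw [e1, e2, map_mul, Complex.conj_ofReal, map_prod]
    simp only [map_pow, mul_pow, Finset.prod_mul_distrib]
    have h3 : (0 : ℝ) ≤ Real.Gamma (N + (∑ i, α i : ℕ)) /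
        ((∏ i, (α i).factorial : ℕ) * Real.Gamma N) := by
      have := Real.Gamma_pos_of_pos hN0
      have := Real.Gamma_pos_of_pos (show 0 < N + (∑ i, α i : ℕ) by positivity)
      positivity
    nth_rewrite 3 [← Real.mul_self_sqrt h3]
    rw [Complex.ofReal_mul]
    ring
  simp only [h2] at h1
  have h3 := h1.tsum_fiberwise fun α : Fin d → ℕ => ∑ i, α i
  have h4 : ∀ n : ℕ, ∑' b : (fun α : Fin d → ℕ => ∑ i, α i) ⁻¹' {n},
      ((Real.Gamma (N + (∑ i, b.1 i : ℕ)) /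
        ((∏ i, (b.1 i).factorial : ℕ) * Real.Gamma N) : ℝ) : ℂ) *
        ∏ i, ((w : Cn d) i * starRingEnd ℂ ((z : Cn d) i)) ^ b.1 i =
      ((Real.Gamma (N + n) / (n.factorial * Real.Gamma N) : ℝ) : ℂ) * x ^ n := by
    intro n
    have e : (fun α : Fin d → ℕ => ∑ i, α i) ⁻¹' {n} =
        ((Finset.piAntidiag Finset.univ n : Finset (Fin d → ℕ)) : Set (Fin d → ℕ)) := by
      ext α; simp
    rw [e, Finset.tsum_subtype' (Finset.piAntidiag Finset.univ n) fun b : Fin d → ℕ =>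
      ((Real.Gamma (N + (∑ i, b i : ℕ)) /
        ((∏ i, (b i).factorial : ℕ) * Real.Gamma N) : ℝ) : ℂ) *
        ∏ i, ((w : Cn d) i * starRingEnd ℂ ((z : Cn d) i)) ^ b i,
      hxsum, Finset.sum_pow_eq_sum_piAntidiag, Finset.mul_sum]
    refine Finset.sum_congr rfl fun α hα => ?_
    have hαn : ∑ i, α i = n := by simpa using hα
    have hm := Nat.multinomial_spec Finset.univ α
    rw [hαn] at hm
    have hf : ((∏ i, (α i).factorial : ℕ) : ℝ) ≠ 0 := by
      exact_mod_cast (Finset.prod_pos fun i _ => Nat.factorial_pos _).ne'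
    have hG := (Real.Gamma_pos_of_pos hN0).ne'
    rw [hαn, ← mul_assoc, ← hm]
    congr 1
    have hmn : ((Nat.multinomial Finset.univ α : ℕ) : ℝ) ≠ 0 := by
      intro h0
      have h0' : Nat.multinomial Finset.univ α = 0 := by exact_mod_cast h0
      rw [h0', mul_zero] at hm
      exact n.factorial_ne_zero hm.symm
    rw [← Complex.ofReal_natCast, ← Complex.ofReal_mul]
    congr 1
    rw [Nat.cast_mul]
    field_simp
  simp only [h4] at h3
  refine h3.unique ?_
  have h5 := (Complex.one_div_one_sub_cpow_hasFPowerSeriesOnBall_zero ((N : ℝ) : ℂ)).hasSum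
    (y := x) (by
      have : ‖x‖ₑ < 1 := by
        rw [← ofReal_norm, ENNReal.ofReal_lt_one]
        exact norm_inner_lt_one z w
      simpa using this)
  rw [zero_add] at h5
  convert h5 using 1
  ext n
  rw [FormalMultilinearSeries.ofScalars_apply_eq, ← ring_choose_eq_Gamma hN0, smul_eq_mul]

/-! ### Integrals of powers of `1 - |φ_z(w)|²` -/

/-- The quantity `1 - |φ_z(w)|² = (1 - |z|²)(1 - |w|²) / |1 - ⟨z, w⟩|²`. -/
def sechSq {d : ℕ} (z w : Cn d) : ℝ :=
  (1 - ‖z‖ ^ 2) * (1 - ‖w‖ ^ 2) / ‖1 - inner ℂ z w‖ ^ 2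

lemma pseudoDist_eq {d : ℕ} (z w : Ball d) : pseudoDist z w = √(1 - sechSq (z : Cn d) w) := rfl

lemma norm_one_sub_inner_pos {d : ℕ} {z w : Cn d} (hz : z ∈ ball (0 : Cn d) 1)
    (hw : w ∈ ball (0 : Cn d) 1) : 0 < ‖1 - inner ℂ z w‖ := by
  have h := norm_inner_lt_one ⟨z, hz⟩ ⟨w, hw⟩
  rw [norm_pos_iff, sub_ne_zero]
  rintro h1
  rw [← h1] at h
  simp at h

lemma sechSq_pos {d : ℕ} {z w : Cn d} (hz : z ∈ ball (0 : Cn d) 1)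
    (hw : w ∈ ball (0 : Cn d) 1) : 0 < sechSq z w := by
  have h1 := one_sub_normSq_pos hz
  have h2 := one_sub_normSq_pos hw
  have h3 := norm_one_sub_inner_pos hz hw
  unfold sechSq
  positivity

lemma norm_fn_kernel {d : ℕ} (μ : Weight) (z w : Ball d) :
    ‖(BergmanSpace.kernel μ z).fn w‖ =
      ‖1 - inner ℂ (z : Cn d) (w : Cn d)‖ ^ (-kernelExp d μ) := by
  rw [fn_kernel, norm_div, norm_one, Complex.norm_cpow_real, Real.rpow_neg (norm_nonneg _), one_div]

lemma norm_sq_kernel {d : ℕ} (μ : Weight) (z : Ball d) :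
    ‖BergmanSpace.kernel μ z‖ ^ 2 = (1 - ‖(z : Cn d)‖ ^ 2) ^ (-kernelExp d μ) := by
  have h := one_sub_normSq_pos z.2
  have h1 : (‖BergmanSpace.kernel μ z‖ ^ 2 : ℝ) = ‖(BergmanSpace.kernel μ z).fn z‖ := by
    rw [← BergmanSpace.inner_kernel, inner_self_eq_norm_sq_to_K]
    simp
  rw [h1, norm_fn_kernel, inner_self_eq_norm_sq_to_K]
  congr 1
  have : (1 : ℂ) - (RCLike.ofReal ‖(z : Cn d)‖ : ℂ) ^ 2 = ((1 - ‖(z : Cn d)‖ ^ 2 : ℝ) : ℂ) := by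
    push_cast; rfl
  rw [this, Complex.norm_real, Real.norm_of_nonneg h.le]

lemma BergmanSpace.lintegral_enorm_fn_sq {d : ℕ} {μ : Weight} (f : BergmanSpace d μ) :
    ∫⁻ z, ‖f.fn z‖ₑ ^ 2 ∂(weightedMeasure d μ) = ENNReal.ofReal (‖f‖ ^ 2) := by
  have h1 : eLpNorm f.fn 2 (weightedMeasure d μ) = ENNReal.ofReal ‖f‖ := by
    rw [← eLpNorm_congr_ae f.coeFn_ae_eq_fn, ← norm_bergmanIncl, Lp.norm_def,
      ENNReal.ofReal_toReal (Lp.eLpNorm_ne_top _)]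
  have h2 := eLpNorm_nnreal_pow_eq_lintegral (f := f.fn) (μ := weightedMeasure d μ)
    (p := 2) (by norm_num)
  rw [ENNReal.ofReal_pow (norm_nonneg _), ← h1]
  simpa using h2.symm

/-- The constant `c_ν` of the weight `(1 - |z|²)^ν` on the unit ball of `ℂ^d`. -/
def weightConst (d : ℕ) (ν : ℝ) : ℝ := Real.Gamma (d + ν + 1) / (Real.pi ^ d * Real.Gamma (ν + 1))

lemma weightConst_pos (d : ℕ) {ν : ℝ} (hν : -1 < ν) : 0 < weightConst d ν :=
  weightFun_const_pos d ⟨ν, hν⟩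

/-- The Möbius invariant measure `(1 - |w|²)^(-d-1) dv(w)` on the ball. -/
def hypMeasure (d : ℕ) : Measure (Cn d) :=
  ((volume : Measure (Cn d)).restrict (ball 0 1)).withDensity
    fun w => ENNReal.ofReal ((1 - ‖w‖ ^ 2) ^ (-(d + 1 : ℝ)))

lemma ae_hypMeasure_mem_ball (d : ℕ) : ∀ᵐ z ∂(hypMeasure d), z ∈ ball (0 : Cn d) 1 :=
  (withDensity_absolutelyContinuous _ _).ae_le (ae_restrict_mem measurableSet_ball)

lemma lintegral_weightedMeasure_eq_hyp {d : ℕ} (μ : Weight) {F : Cn d → ℝ≥0∞} (hF : Measurable F) :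
    ∫⁻ w, F w ∂(weightedMeasure d μ) =
      ∫⁻ w, ENNReal.ofReal (weightConst d μ * (1 - ‖w‖ ^ 2) ^ kernelExp d μ) * F w
        ∂(hypMeasure d) := by
  rw [weightedMeasure, hypMeasure, lintegral_withDensity_eq_lintegral_mul _
    (measurable_weightFun d μ).ennreal_ofReal hF]
  have h0 := lintegral_withDensity_eq_lintegral_mul
    ((volume : Measure (Cn d)).restrict (ball 0 1))
    (f := fun w => ENNReal.ofReal ((1 - ‖w‖ ^ 2) ^ (-(d + 1 : ℝ)))) (by fun_prop)
    (g := fun w => ENNReal.ofReal (weightConst d μ * (1 - ‖w‖ ^ 2) ^ kernelExp d μ) * F w)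
    (Measurable.mul (by fun_prop) hF)
  rw [h0]
  refine setLIntegral_congr_fun measurableSet_ball fun w hw => ?_
  have h := one_sub_normSq_pos hw
  have hc := weightConst_pos d μ.2
  simp only [Pi.mul_apply]
  rw [← mul_assoc, ← ENNReal.ofReal_mul (by positivity)]
  congr 2
  rw [mul_left_comm, ← Real.rpow_add h, weightFun, weightConst]
  congr 2
  rw [kernelExp]; ring

/-- The invariant integrals of powers of `1 - |φ_z(w)|²` do not depend on `z`: they are norms of
reproducing kernels. -/
lemma lintegral_sechSq_rpow {d : ℕ} (z : Ball d) {s : ℝ} (hs : d < s) :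
    ∫⁻ w, ENNReal.ofReal (sechSq (z : Cn d) w ^ s) ∂(hypMeasure d) =
      ENNReal.ofReal (1 / weightConst d (s - d - 1)) := by
  let μ : Weight := ⟨s - d - 1, by linarith⟩
  have hN : kernelExp d μ = s := by simp only [kernelExp, μ]; ring
  have hz := one_sub_normSq_pos z.2
  have hc : 0 < weightConst d (s - d - 1) := weightConst_pos d μ.2
  have h1 := BergmanSpace.lintegral_enorm_fn_sq (BergmanSpace.kernel μ z)
  rw [norm_sq_kernel, hN] at h1
  have h2 : ∫⁻ w, ‖(BergmanSpace.kernel μ z).fn w‖ₑ ^ 2 ∂(weightedMeasure d μ) =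
      ∫⁻ w, ENNReal.ofReal ((‖1 - inner ℂ (z : Cn d) w‖ ^ (-s)) ^ 2) ∂(weightedMeasure d μ) := by
    refine lintegral_congr_ae ?_
    filter_upwards [ae_mem_ball d μ] with w hw
    have := norm_fn_kernel μ z ⟨w, hw⟩
    rw [hN] at this
    simp only at this
    rw [ENNReal.ofReal_pow (by positivity), ← this, ofReal_norm]
  have h3 : ∀ᵐ w ∂(hypMeasure d),
      ENNReal.ofReal (weightConst d μ * (1 - ‖w‖ ^ 2) ^ kernelExp d μ) *
        ENNReal.ofReal ((‖1 - inner ℂ (z : Cn d) w‖ ^ (-s)) ^ 2) =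
      ENNReal.ofReal (weightConst d (s - d - 1) * (1 - ‖(z : Cn d)‖ ^ 2) ^ (-s)) *
        ENNReal.ofReal (sechSq (z : Cn d) w ^ s) := by
    filter_upwards [ae_hypMeasure_mem_ball d] with w hw
    have hw1 := one_sub_normSq_pos hw
    have hzw := norm_one_sub_inner_pos z.2 hw
    have hc' : 0 ≤ weightConst d μ := hc.le
    rw [← ENNReal.ofReal_mul (by positivity), ← ENNReal.ofReal_mul (by positivity), hN, sechSq,
      Real.div_rpow (by positivity) (by positivity), Real.mul_rpow hz.le hw1.le,
      Real.rpow_neg hz.le, Real.rpow_neg (norm_nonneg _), inv_pow,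
      Real.rpow_pow_comm (norm_nonneg _)]
    congr 1
    have hzs : 0 < (1 - ‖(z : Cn d)‖ ^ 2) ^ s := by positivity
    have e' : weightConst d (μ : ℝ) = weightConst d (s - d - 1) := rfl
    rw [e']
    field_simp
  rw [h2, lintegral_weightedMeasure_eq_hyp μ (by fun_prop), lintegral_congr_ae h3,
    lintegral_const_mul' _ _ ENNReal.ofReal_ne_top] at h1
  have hpos : 0 < weightConst d (s - d - 1) * (1 - ‖(z : Cn d)‖ ^ 2) ^ (-s) := by positivity
  rw [ENNReal.ofReal_mul hc.le, mul_right_comm] at h1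
  have hz0 : ENNReal.ofReal ((1 - ‖(z : Cn d)‖ ^ 2) ^ (-s)) ≠ 0 := by
    simpa using Real.rpow_pos_of_pos hz _
  have h4 : ENNReal.ofReal (weightConst d (s - d - 1)) *
      ∫⁻ w, ENNReal.ofReal (sechSq (z : Cn d) w ^ s) ∂(hypMeasure d) = 1 := by
    refine (ENNReal.mul_eq_right ?_ ?_).1 h1 <;> first | exact hz0 | exact ENNReal.ofReal_ne_top
  rw [one_div, ENNReal.ofReal_inv_of_pos hc]
  exact ENNReal.eq_inv_of_mul_eq_one_left (by rw [mul_comm]; exact h4)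

/-- Concentration near the diagonal: the part of the integral away from the diagonal gains a
factor `q^(s - d - 1)`. -/
lemma lintegral_mul_sechSq_rpow_le {d : ℕ} (z : Ball d) {ω : Cn d → ℝ} {ε K q s : ℝ} (hε : 0 ≤ ε)
    (hK : 0 ≤ K) (hq : 0 ≤ q) (hs : d + 1 ≤ s)
    (hω : ∀ w ∈ ball (0 : Cn d) 1, ω w ≤ ε + K)
    (hnear : ∀ w ∈ ball (0 : Cn d) 1, q < sechSq (z : Cn d) w → ω w ≤ ε) :
    ∫⁻ w, ENNReal.ofReal (ω w * sechSq (z : Cn d) w ^ s) ∂(hypMeasure d) ≤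
      ENNReal.ofReal (ε / weightConst d (s - d - 1) + K * q ^ (s - d - 1) / weightConst d 0) := by
  have hc0 := weightConst_pos d (show (-1 : ℝ) < 0 by norm_num)
  have hcs := weightConst_pos d (show (-1 : ℝ) < s - d - 1 by linarith)
  have h1 : ∀ᵐ w ∂(hypMeasure d), ENNReal.ofReal (ω w * sechSq (z : Cn d) w ^ s) ≤
      ENNReal.ofReal ε * ENNReal.ofReal (sechSq (z : Cn d) w ^ s) +
      ENNReal.ofReal (K * q ^ (s - d - 1)) *
        ENNReal.ofReal (sechSq (z : Cn d) w ^ (d + 1 : ℝ)) := by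
    filter_upwards [ae_hypMeasure_mem_ball d] with w hw
    have hQ := sechSq_pos z.2 hw
    rw [← ENNReal.ofReal_mul hε, ← ENNReal.ofReal_mul (by positivity),
      ← ENNReal.ofReal_add (by positivity) (by positivity)]
    refine ENNReal.ofReal_le_ofReal ?_
    rcases lt_or_ge q (sechSq (z : Cn d) w) with hlt | hge
    · have := mul_le_mul_of_nonneg_right (hnear w hw hlt) (by positivity : 0 ≤ sechSq (z : Cn d) w ^ s)
      have h0 : 0 ≤ K * q ^ (s - d - 1) * sechSq (z : Cn d) w ^ (d + 1 : ℝ) := by positivity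
      linarith
    · have h2 : sechSq (z : Cn d) w ^ s ≤ q ^ (s - d - 1) * sechSq (z : Cn d) w ^ (d + 1 : ℝ) := by
        have : s = (s - d - 1) + (d + 1) := by ring
        nth_rewrite 1 [this]
        rw [Real.rpow_add hQ]
        gcongr
        linarith
      calc ω w * sechSq (z : Cn d) w ^ s ≤ (ε + K) * sechSq (z : Cn d) w ^ s := by
            gcongr; exact hω w hw
        _ ≤ ε * sechSq (z : Cn d) w ^ s +
            K * (q ^ (s - d - 1) * sechSq (z : Cn d) w ^ (d + 1 : ℝ)) := by
            rw [add_mul]; gcongr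
        _ = _ := by ring
  refine (lintegral_mono_ae h1).trans_eq ?_
  have hm : ∀ t : ℝ, Measurable fun w => ENNReal.ofReal (sechSq (z : Cn d) w ^ t) := by
    intro t; unfold sechSq; fun_prop
  rw [lintegral_add_left ((hm s).const_mul _), lintegral_const_mul' _ _ ENNReal.ofReal_ne_top,
    lintegral_const_mul' _ _ ENNReal.ofReal_ne_top, lintegral_sechSq_rpow z (by linarith),
    lintegral_sechSq_rpow z (by linarith), ← ENNReal.ofReal_mul hε,
    ← ENNReal.ofReal_mul (by positivity), ← ENNReal.ofReal_add (by positivity)]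
  · congr 1
    have : (d : ℝ) + 1 - d - 1 = 0 := by ring
    rw [this]
    ring
  · have : (d : ℝ) + 1 - d - 1 = 0 := by ring
    rw [this]
    positivity

/-- Functions in `BUC` oscillate little near the diagonal. -/
lemma exists_oscillation_bound {d : ℕ} (b : BUC d) {ε : ℝ} (hε : 0 < ε) :
    ∃ K q : ℝ, 0 ≤ K ∧ 0 < q ∧ q < 1 ∧ ∀ z ∈ ball (0 : Cn d) 1, ∀ w ∈ ball (0 : Cn d) 1,
      ‖extendBall (b : Ball d → ℂ) z - extendBall (b : Ball d → ℂ) w‖ ≤ ε + K ∧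
      (q < sechSq z w →
        ‖extendBall (b : Ball d → ℂ) z - extendBall (b : Ball d → ℂ) w‖ ≤ ε) := by
  obtain ⟨C, hC⟩ := exists_norm_extendBall_le b
  obtain ⟨δ, hδ, hb⟩ := b.2.2 ε hε
  have hC0 : 0 ≤ C := (norm_nonneg _).trans (hC 0)
  have hcont : ContinuousAt (fun p : ℝ => 1 / 2 * Real.log ((1 + p) / (1 - p))) 0 := by
    refine continuousAt_const.mul (ContinuousAt.log (ContinuousAt.div (by fun_prop) (by fun_prop)
      (by norm_num)) (by norm_num))
  -- the Bergman distance is a function of the pseudohyperbolic one that vanishes at `0`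
  obtain ⟨η, hη, hη'⟩ := Metric.continuousAt_iff.1 hcont δ hδ
  set η' := min η (1 / 2) with hη1
  have h0 : 0 < η' := lt_min hη (by norm_num)
  have h1 : η' ≤ 1 / 2 := min_le_right _ _
  refine ⟨C + C, 1 - η' ^ 2, by positivity, by nlinarith, by nlinarith, fun z hz w hw => ⟨?_, ?_⟩⟩
  · exact (norm_sub_le _ _).trans (by linarith [hC z, hC w])
  · intro hq
    have e1 : extendBall (b : Ball d → ℂ) z = b.1 ⟨z, hz⟩ := by simp only [extendBall, dif_pos hz]
    have e2 : extendBall (b : Ball d → ℂ) w = b.1 ⟨w, hw⟩ := by simp only [extendBall, dif_pos hw]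
    rw [e1, e2]
    refine (hb ⟨z, hz⟩ ⟨w, hw⟩ ?_).le
    have hp : pseudoDist (⟨z, hz⟩ : Ball d) ⟨w, hw⟩ < η' := by
      rw [pseudoDist_eq, Real.sqrt_lt' h0]
      simp only
      linarith
    have hp0 : 0 ≤ pseudoDist (⟨z, hz⟩ : Ball d) ⟨w, hw⟩ := Real.sqrt_nonneg _
    have := hη' (x := pseudoDist (⟨z, hz⟩ : Ball d) ⟨w, hw⟩) (by
      rw [dist_zero_right, Real.norm_of_nonneg hp0]
      exact hp.trans_le (min_le_left _ _))
    rw [Real.dist_eq] at this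
    simp only [add_zero, sub_zero, div_one, Real.log_one, mul_zero] at this
    exact (le_abs_self _).trans_lt this

/-! ### Growth of the normalizing constants -/

lemma weightConst_eq_prod (d : ℕ) {ν : ℝ} (hν : -1 < ν) :
    weightConst d ν = ∏ i ∈ Finset.range d, (ν + 1 + i) / Real.pi := by
  induction d with
  | zero =>
    have := (Real.Gamma_pos_of_pos (show 0 < ν + 1 by linarith)).ne'
    simp [weightConst, this]
  | succ d ih =>
    have h0 : (0 : ℝ) ≤ d := d.cast_nonneg
    have h1 := (Real.Gamma_pos_of_pos (show 0 < ν + 1 by linarith)).ne'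
    rw [Finset.prod_range_succ, ← ih, weightConst, weightConst]
    have e : ((d + 1 : ℕ) : ℝ) + ν + 1 = (d + ν + 1) + 1 := by push_cast; ring
    rw [e, Real.Gamma_add_one (by linarith)]
    have := Real.pi_pos
    field_simp
    ring

lemma weightConst_le_pow (d : ℕ) {ν : ℝ} (hν : 0 ≤ ν) : weightConst d ν ≤ (ν + 1 + d) ^ d := by
  rw [weightConst_eq_prod d (by linarith)]
  calc ∏ i ∈ Finset.range d, (ν + 1 + i) / Real.pi ≤ ∏ _i ∈ Finset.range d, (ν + 1 + d) := by
        refine Finset.prod_le_prod (fun i _ => by positivity) fun i hi => ?_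
        have hi : (i : ℝ) ≤ d := by exact_mod_cast (Finset.mem_range.1 hi).le
        refine (div_le_self (by positivity) (by linarith [Real.pi_gt_three])).trans (by linarith)
    _ = _ := by simp

/-- The constants `c_ν` and `c_(N/2-d-1)`, `N = d + 1 + ν`, are of the same order of growth, so that
the part of the Schur bound near the diagonal stays proportional to the oscillation. -/
lemma weightConst_le_mul (d : ℕ) {ν : ℝ} (hν : 2 * d ≤ ν) :
    weightConst d ν ≤ 4 ^ d * weightConst d (kernelExp d ⟨ν, by
      have : (0 : ℝ) ≤ d := d.cast_nonneg
      linarith⟩ / 2 - d - 1) := by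
  have hd : (0 : ℝ) ≤ d := d.cast_nonneg
  have e : kernelExp d ⟨ν, by linarith⟩ = d + 1 + ν := rfl
  rw [e, weightConst_eq_prod d (by linarith), weightConst_eq_prod d (by linarith),
    ← Finset.card_range d, ← Finset.prod_const, Finset.card_range, ← Finset.prod_mul_distrib]
  refine Finset.prod_le_prod (fun i _ => div_nonneg (by have : (0 : ℝ) ≤ i := i.cast_nonneg; linarith)
    Real.pi_pos.le) fun i hi => ?_
  have := Real.pi_pos
  have hi : (0 : ℝ) ≤ i := i.cast_nonneg
  rw [← mul_div_assoc]
  gcongr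
  linarith

/-- The constants `c_ν` grow polynomially, hence are absorbed by exponential decay. -/
lemma tendsto_weightConst_mul_rpow (d : ℕ) {q : ℝ} (hq0 : 0 < q) (hq1 : q < 1) {a : ℝ}
    (ha : 0 < a) (b : ℝ) :
    Tendsto (fun ν : ℝ => weightConst d ν * q ^ (a * ν + b)) atTop (𝓝 0) := by
  have hlog : 0 < -Real.log q := by linarith [Real.log_neg hq0 hq1]
  have h1 := tendsto_rpow_mul_exp_neg_mul_atTop_nhds_zero d (a * -Real.log q) (by positivity)
  have h2 : Tendsto (fun ν : ℝ => ν + 1 + d) atTop atTop := by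
    simp only [add_assoc]
    exact tendsto_atTop_add_const_right _ _ tendsto_id
  have h3 := (h1.comp h2).mul_const (q ^ (b - a * (1 + d)))
  rw [zero_mul] at h3
  refine squeeze_zero' ?_ ?_ h3
  · filter_upwards [eventually_ge_atTop 0] with ν hν
    have := weightConst_pos d (show -1 < ν by linarith)
    positivity
  · filter_upwards [eventually_ge_atTop 0] with ν hν
    simp only [Function.comp, Real.rpow_natCast]
    rw [mul_assoc]
    refine mul_le_mul (weightConst_le_pow d hν) (le_of_eq ?_) (by positivity) (by positivity)
    rw [Real.rpow_def_of_pos hq0, Real.rpow_def_of_pos hq0, ← Real.exp_add]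
    congr 1
    ring

/-! ### Toeplitz operators as integrals -/

/-- The projection is adjoint to the inclusion. -/
lemma inner_bergmanProj {d : ℕ} {μ : Weight} (h : BergmanSpace d μ)
    (x : Lp ℂ 2 (weightedMeasure d μ)) :
    inner ℂ h (bergmanProj d μ x) = inner ℂ (bergmanIncl d μ h) x :=
  Submodule.inner_orthogonalProjectionOnto_eq_of_mem_left (K := bergmanSubmodule d μ) h x

lemma inner_toeplitz {d : ℕ} {μ : Weight} {φ : Cn d → ℂ} (hφ : MemLp φ ∞ (weightedMeasure d μ))
    (h f : BergmanSpace d μ) :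
    inner ℂ h (toeplitz hφ.toLp f) =
      ∫ z, starRingEnd ℂ (h.fn z) * (φ z * f.fn z) ∂(weightedMeasure d μ) := by
  rw [toeplitz, ContinuousLinearMap.comp_apply, inner_bergmanProj, L2.inner_def]
  refine integral_congr_ae ?_
  have h1 := ContinuousLinearMap.coeFn_holder (ContinuousLinearMap.mul ℂ ℂ) (r := 2)
    hφ.toLp (bergmanIncl d μ f)
  filter_upwards [h.coeFn_ae_eq_fn, f.coeFn_ae_eq_fn, hφ.coeFn_toLp, h1] with z e1 e2 e3 e4
  rw [ContinuousLinearMap.comp_apply, ContinuousLinearMap.holderL_apply_apply, e1, e4, e2, e3,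
    RCLike.inner_apply, ContinuousLinearMap.mul_apply', mul_comm]

lemma ext_inner_bergman {d : ℕ} {μ : Weight} {S T : BergmanOp d μ}
    (h : ∀ x y, inner ℂ x (S y) = inner ℂ x (T y)) : S = T := by
  ext1 y
  exact ext_inner_left ℂ fun x => h x y

lemma inner_toeplitzBUC {d : ℕ} {μ : Weight} (c : BUC d) (h f : BergmanSpace d μ) :
    inner ℂ h (toeplitzBUC μ c f) =
      ∫ z, starRingEnd ℂ (h.fn z) * (extendBall (c : Ball d → ℂ) z * f.fn z)
        ∂(weightedMeasure d μ) :=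
  inner_toeplitz (memLp_symbol μ c) h f

lemma inner_toeplitzLifted {ℓ d : ℕ} {μ : Weight} (c : BUC d) (h f : BergmanSpace (ℓ + d) μ) :
    inner ℂ h (toeplitzLifted ℓ μ c f) =
      ∫ z, starRingEnd ℂ (h.fn z) * (extendBall (c : Ball d → ℂ) (lastCoords ℓ d z) * f.fn z)
        ∂(weightedMeasure (ℓ + d) μ) :=
  inner_toeplitz (memLp_liftedSymbol μ c) h f

lemma integrable_conj_mul_mul {d : ℕ} {μ : Weight} {φ : Cn d → ℂ}
    (hφ : MemLp φ ∞ (weightedMeasure d μ)) {g f : Cn d → ℂ} (hg : MemLp g 2 (weightedMeasure d μ))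
    (hf : MemLp f 2 (weightedMeasure d μ)) :
    Integrable (fun z => starRingEnd ℂ (g z) * (φ z * f z)) (weightedMeasure d μ) := by
  have h1 : MemLp (fun z => φ z * f z) 2 (weightedMeasure d μ) := hf.mul hφ
  have h2 : MemLp (fun z => starRingEnd ℂ (g z)) 2 (weightedMeasure d μ) := hg.star
  exact h2.integrable_mul h1

lemma extendBall_of_mem {d : ℕ} (c : Ball d → ℂ) (z : Ball d) : extendBall c z = c z := by
  simp only [extendBall, dif_pos z.2]

lemma extendBall_add {d : ℕ} (a b : Ball d → ℂ) (z : Cn d) :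
    extendBall (a + b) z = extendBall a z + extendBall b z := by
  unfold extendBall; split_ifs <;> simp

lemma extendBall_mul {d : ℕ} (a b : Ball d → ℂ) (z : Cn d) :
    extendBall (a * b) z = extendBall a z * extendBall b z := by
  unfold extendBall; split_ifs <;> simp

lemma extendBall_smul {d : ℕ} (r : ℂ) (a : Ball d → ℂ) (z : Cn d) :
    extendBall (r • a) z = r * extendBall a z := by
  unfold extendBall; split_ifs <;> simp

lemma toeplitzBUC_add {d : ℕ} (μ : Weight) (a b : BUC d) :
    toeplitzBUC μ (a + b) = toeplitzBUC μ a + toeplitzBUC μ b := by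
  refine ext_inner_bergman fun x y => ?_
  rw [add_apply, inner_add_right, inner_toeplitzBUC, inner_toeplitzBUC,
    inner_toeplitzBUC, ← integral_add
      (integrable_conj_mul_mul (memLp_symbol μ a) x.memLp_fn y.memLp_fn)
      (integrable_conj_mul_mul (memLp_symbol μ b) x.memLp_fn y.memLp_fn)]
  refine integral_congr_ae (Eventually.of_forall fun z => ?_)
  simp only [Subalgebra.coe_add, extendBall_add]
  ring

lemma toeplitzBUC_smul {d : ℕ} (μ : Weight) (r : ℂ) (a : BUC d) :
    toeplitzBUC μ (r • a) = r • toeplitzBUC μ a := by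
  refine ext_inner_bergman fun x y => ?_
  rw [smul_apply, inner_smul_right, inner_toeplitzBUC, inner_toeplitzBUC,
    ← integral_const_mul]
  refine integral_congr_ae (Eventually.of_forall fun z => ?_)
  simp only [Subalgebra.coe_smul, extendBall_smul]
  ring

lemma toeplitzBUC_sub {d : ℕ} (μ : Weight) (a b : BUC d) :
    toeplitzBUC μ (a - b) = toeplitzBUC μ a - toeplitzBUC μ b := by
  rw [sub_eq_add_neg, ← neg_one_smul ℂ b, toeplitzBUC_add, toeplitzBUC_smul, neg_one_smul,
    sub_eq_add_neg]

lemma toeplitzBUC_one {d : ℕ} (μ : Weight) : toeplitzBUC μ (1 : BUC d) = 1 := by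
  refine ext_inner_bergman fun x y => ?_
  rw [inner_toeplitzBUC, one_apply_eq_self, BergmanSpace.inner_eq_integral]
  refine integral_congr_ae ?_
  filter_upwards [ae_mem_ball d μ] with z hz
  rw [extendBall_of_mem _ ⟨z, hz⟩]
  simp

/-- The complex conjugate of a function in `BUC`. -/
def conjBUC {d : ℕ} (c : BUC d) : BUC d :=
  ⟨fun z => starRingEnd ℂ (c.1 z), by
    obtain ⟨⟨C, hC⟩, h⟩ := c.2
    refine ⟨⟨C, fun z => by simpa using hC z⟩, fun ε hε => ?_⟩
    obtain ⟨δ, hδ, h'⟩ := h ε hε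
    refine ⟨δ, hδ, fun z w hzw => ?_⟩
    rw [← map_sub, RCLike.norm_conj]
    exact h' z w hzw⟩

lemma extendBall_conjBUC {d : ℕ} (c : BUC d) (z : Cn d) :
    extendBall (conjBUC c : Ball d → ℂ) z = starRingEnd ℂ (extendBall (c : Ball d → ℂ) z) := by
  unfold extendBall conjBUC; split_ifs <;> simp

lemma conjBUC_mul {d : ℕ} (a b : BUC d) : conjBUC (a * b) = conjBUC b * conjBUC a := by
  ext z; simp [conjBUC, mul_comm]

lemma star_toeplitzBUC {d : ℕ} (μ : Weight) (c : BUC d) :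
    star (toeplitzBUC μ c) = toeplitzBUC μ (conjBUC c) := by
  refine ext_inner_bergman fun x y => ?_
  rw [ContinuousLinearMap.star_eq_adjoint, ContinuousLinearMap.adjoint_inner_right,
    ← inner_conj_symm, inner_toeplitzBUC, inner_toeplitzBUC, ← integral_conj]
  refine integral_congr_ae (Eventually.of_forall fun z => ?_)
  simp only [extendBall_conjBUC, map_mul, Complex.conj_conj]
  ring

/-! ### Schur's test -/

/-- The Cauchy–Schwarz inequality for lower integrals. -/
lemma lintegral_mul_sq_le {α : Type*} [MeasurableSpace α] (m : Measure α) {f g : α → ℝ≥0∞}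
    (hf : AEMeasurable f m) (hg : AEMeasurable g m) :
    (∫⁻ a, f a * g a ∂m) ^ 2 ≤ (∫⁻ a, f a ^ 2 ∂m) * ∫⁻ a, g a ^ 2 ∂m := by
  have h := ENNReal.lintegral_mul_le_Lp_mul_Lq m Real.HolderConjugate.two_two hf hg
  simp only [Pi.mul_apply, ENNReal.rpow_two] at h
  calc (∫⁻ a, f a * g a ∂m) ^ 2
      ≤ ((∫⁻ a, f a ^ 2 ∂m) ^ (1 / 2 : ℝ) * (∫⁻ a, g a ^ 2 ∂m) ^ (1 / 2 : ℝ)) ^ 2 := by gcongr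
    _ = _ := by
      rw [mul_pow, ← ENNReal.rpow_natCast, ← ENNReal.rpow_natCast, ← ENNReal.rpow_mul,
        ← ENNReal.rpow_mul]
      norm_num

/-- Schur's test for a symmetric kernel `κ ≥ 0` with test function `φ`. -/
lemma schur_test {α : Type*} [MeasurableSpace α] (m : Measure α) [SFinite m]
    {κ : α → α → ℝ≥0∞} (hκ : Measurable (Function.uncurry κ)) (hsymm : ∀ z w, κ z w = κ w z)
    {φ : α → ℝ≥0∞} (hφ : Measurable φ) (hφ0 : ∀ᵐ z ∂m, φ z ≠ 0) (hφt : ∀ᵐ z ∂m, φ z ≠ ∞)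
    {C : ℝ≥0∞} (hC : ∀ᵐ z ∂m, ∫⁻ w, κ z w * φ w ∂m ≤ C * φ z)
    {g : α → ℝ≥0∞} (hg : AEMeasurable g m) :
    ∫⁻ z, (∫⁻ w, κ z w * g w ∂m) ^ 2 ∂m ≤ C ^ 2 * ∫⁻ z, g z ^ 2 ∂m := by
  wlog hgm : Measurable g generalizing g
  · have e : ∀ z, ∫⁻ w, κ z w * g w ∂m = ∫⁻ w, κ z w * hg.mk g w ∂m := fun z =>
      lintegral_congr_ae (by filter_upwards [hg.ae_eq_mk] with w hw; rw [hw])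
    have e' : ∫⁻ z, g z ^ 2 ∂m = ∫⁻ z, hg.mk g z ^ 2 ∂m :=
      lintegral_congr_ae (by filter_upwards [hg.ae_eq_mk] with w hw; rw [hw])
    simp only [e, e']
    exact this hg.measurable_mk.aemeasurable hg.measurable_mk
  have hκz : ∀ z, Measurable (κ z) := fun z => hκ.of_uncurry_left
  have hpt : ∀ᵐ z ∂m, (∫⁻ w, κ z w * g w ∂m) ^ 2 ≤
      C * ∫⁻ w, φ z * κ z w * (g w ^ 2 * (φ w)⁻¹) ∂m := by
    filter_upwards [hC, hφt] with z hz hzt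
    have e1 : ∫⁻ w, κ z w * g w ∂m =
        ∫⁻ w, (κ z w * φ w) ^ (1 / 2 : ℝ) *
          ((κ z w) ^ (1 / 2 : ℝ) * (g w * ((φ w)⁻¹) ^ (1 / 2 : ℝ))) ∂m := by
      refine lintegral_congr_ae ?_
      filter_upwards [hφ0, hφt] with w h0 ht
      have a1 : κ z w ^ (1 / 2 : ℝ) * κ z w ^ (1 / 2 : ℝ) = κ z w := by
        rw [← ENNReal.rpow_add_of_nonneg _ _ (by norm_num) (by norm_num)]; norm_num
      have a2 : φ w ^ (1 / 2 : ℝ) * (φ w)⁻¹ ^ (1 / 2 : ℝ) = 1 := by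
        rw [← ENNReal.mul_rpow_of_nonneg _ _ (by norm_num), ENNReal.mul_inv_cancel h0 ht,
          ENNReal.one_rpow]
      rw [ENNReal.mul_rpow_of_nonneg _ _ (by norm_num)]
      calc κ z w * g w = (κ z w ^ (1 / 2 : ℝ) * κ z w ^ (1 / 2 : ℝ)) * g w *
            (φ w ^ (1 / 2 : ℝ) * (φ w)⁻¹ ^ (1 / 2 : ℝ)) := by rw [a1, a2, mul_one]
        _ = _ := by ring
    have e2 := lintegral_mul_sq_le m (f := fun w => (κ z w * φ w) ^ (1 / 2 : ℝ))
      (g := fun w => (κ z w) ^ (1 / 2 : ℝ) * (g w * ((φ w)⁻¹) ^ (1 / 2 : ℝ)))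
      (((hκz z).mul hφ).pow_const _).aemeasurable
      (((hκz z).pow_const _).mul (hgm.mul (hφ.inv.pow_const _))).aemeasurable
    rw [e1]
    refine e2.trans ?_
    have sq_half : ∀ x : ℝ≥0∞, (x ^ (1 / 2 : ℝ)) ^ 2 = x := by
      intro x
      rw [← ENNReal.rpow_natCast, ← ENNReal.rpow_mul]; norm_num
    simp only [mul_pow, sq_half]
    calc (∫⁻ w, κ z w * φ w ∂m) * ∫⁻ w, κ z w * (g w ^ 2 * (φ w)⁻¹) ∂m
        ≤ (C * φ z) * ∫⁻ w, κ z w * (g w ^ 2 * (φ w)⁻¹) ∂m := by gcongr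
      _ = _ := by
        simp only [mul_assoc]
        rw [lintegral_const_mul' _ _ hzt]
  have hF : Measurable (Function.uncurry fun z w => φ z * κ z w * (g w ^ 2 * (φ w)⁻¹)) :=
    ((hφ.comp measurable_fst).mul hκ).mul
      (((hgm.comp measurable_snd).pow_const 2).mul (hφ.comp measurable_snd).inv)
  calc ∫⁻ z, (∫⁻ w, κ z w * g w ∂m) ^ 2 ∂m
      ≤ ∫⁻ z, C * ∫⁻ w, φ z * κ z w * (g w ^ 2 * (φ w)⁻¹) ∂m ∂m := lintegral_mono_ae hpt
    _ = C * ∫⁻ w, (∫⁻ z, φ z * κ z w * (g w ^ 2 * (φ w)⁻¹) ∂m) ∂m := by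
        rw [lintegral_const_mul _ hF.lintegral_prod_right, lintegral_lintegral_swap hF.aemeasurable]
    _ ≤ C * ∫⁻ w, C * g w ^ 2 ∂m := by
        gcongr 1
        refine lintegral_mono_ae ?_
        filter_upwards [hC, hφ0, hφt] with w hw h0 ht
        have e : ∀ z, φ z * κ z w = κ w z * φ z := fun z => by rw [hsymm z w, mul_comm]
        simp only [e]
        rw [lintegral_mul_const (g w ^ 2 * (φ w)⁻¹) (f := fun z => κ w z * φ z) ((hκz w).mul hφ)]
        calc (∫⁻ z, κ w z * φ z ∂m) * (g w ^ 2 * (φ w)⁻¹) ≤ (C * φ w) * (g w ^ 2 * (φ w)⁻¹) := by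
              gcongr
          _ = C * g w ^ 2 * (φ w * (φ w)⁻¹) := by ring
          _ = C * g w ^ 2 := by rw [ENNReal.mul_inv_cancel h0 ht, mul_one]
    _ = C ^ 2 * ∫⁻ z, g z ^ 2 ∂m := by
        rw [lintegral_const_mul _ (hgm.pow_const 2), ← mul_assoc, sq]

/-! ### Semi-commutators for large weights -/

lemma norm_integral_conj_mul_mul_le {d : ℕ} {μ : Weight} (h : BergmanSpace d μ) {φ G : Cn d → ℂ}
    (hG : AEMeasurable (fun z => ‖G z‖ₑ) (weightedMeasure d μ)) {A B : ℝ} (hA : 0 ≤ A)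
    (hB : 0 ≤ B)
    (hφ : ∀ z, ‖φ z‖ ≤ A)
    (hGB : ∫⁻ z, ‖G z‖ₑ ^ 2 ∂(weightedMeasure d μ) ≤ ENNReal.ofReal (B ^ 2)) :
    ‖∫ z, starRingEnd ℂ (h.fn z) * (φ z * G z) ∂(weightedMeasure d μ)‖ ≤ A * B * ‖h‖ := by
  rw [← ENNReal.ofReal_le_ofReal_iff (by positivity), ofReal_norm]
  refine (enorm_integral_le_lintegral_enorm _).trans ?_
  have h1 : ∫⁻ z, ‖starRingEnd ℂ (h.fn z) * (φ z * G z)‖ₑ ∂(weightedMeasure d μ) ≤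
      ENNReal.ofReal A * ∫⁻ z, ‖h.fn z‖ₑ * ‖G z‖ₑ ∂(weightedMeasure d μ) := by
    rw [← lintegral_const_mul' _ _ ENNReal.ofReal_ne_top]
    refine lintegral_mono fun z => ?_
    rw [enorm_mul, enorm_mul, RCLike.enorm_conj]
    calc ‖h.fn z‖ₑ * (‖φ z‖ₑ * ‖G z‖ₑ) ≤ ‖h.fn z‖ₑ * (ENNReal.ofReal A * ‖G z‖ₑ) := by
          gcongr
          rw [← ofReal_norm]
          exact ENNReal.ofReal_le_ofReal (hφ z)
      _ = _ := by ring
  refine h1.trans ?_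
  rw [mul_assoc, ENNReal.ofReal_mul hA]
  gcongr 1
  have h2 := lintegral_mul_sq_le (weightedMeasure d μ)
    h.memLp_fn.aestronglyMeasurable.enorm hG
  rw [h.lintegral_enorm_fn_sq] at h2
  have h3 : (∫⁻ z, ‖h.fn z‖ₑ * ‖G z‖ₑ ∂(weightedMeasure d μ)) ^ 2 ≤
      ENNReal.ofReal (B * ‖h‖) ^ 2 := by
    refine h2.trans ?_
    rw [← ENNReal.ofReal_pow (by positivity), mul_pow, mul_comm, ENNReal.ofReal_mul (by positivity)]
    gcongr
  exact (ENNReal.pow_le_pow_left_iff two_ne_zero).1 h3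

lemma opNorm_le_of_norm_inner_le {E : Type*} [NormedAddCommGroup E] [InnerProductSpace ℂ E]
    {T : E →L[ℂ] E} {C : ℝ} (hC : 0 ≤ C) (h : ∀ x y, ‖inner ℂ x (T y)‖ ≤ C * ‖y‖ * ‖x‖) :
    ‖T‖ ≤ C := by
  refine ContinuousLinearMap.opNorm_le_bound _ hC fun y => ?_
  have h1 := h (T y) y
  rw [inner_self_eq_norm_sq_to_K] at h1
  rcases eq_or_lt_of_le (norm_nonneg (T y)) with h0 | h0
  · rw [← h0]; positivity
  · have h2 : ‖T y‖ * ‖T y‖ ≤ C * ‖y‖ * ‖T y‖ := by simpa [sq] using h1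
    exact le_of_mul_le_mul_right h2 h0

lemma norm_toeplitzBUC_le {d : ℕ} (μ : Weight) (c : BUC d) {C : ℝ} (hC0 : 0 ≤ C)
    (hC : ∀ z, ‖(c : Ball d → ℂ) z‖ ≤ C) : ‖toeplitzBUC μ c‖ ≤ C := by
  refine opNorm_le_of_norm_inner_le hC0 fun x y => ?_
  rw [inner_toeplitzBUC]
  refine norm_integral_conj_mul_mul_le x y.memLp_fn.aestronglyMeasurable.enorm hC0 (norm_nonneg _)
    (fun z => ?_) y.lintegral_enorm_fn_sq.le
  unfold extendBall
  split_ifs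
  · exact hC _
  · simpa using hC0

lemma norm_one_sub_inner_comm {d : ℕ} (z w : Cn d) :
    ‖1 - inner ℂ z w‖ = ‖1 - inner ℂ w z‖ := by
  rw [← inner_conj_symm w z, ← RCLike.norm_conj (1 - starRingEnd ℂ _)]
  simp

/-- The absolute value of the integral kernel of the operator `f ↦ b f - P (b f)` on the Bergman
space. -/
def hankelKernel {d : ℕ} (μ : Weight) (b : BUC d) (z w : Cn d) : ℝ≥0∞ :=
  ENNReal.ofReal (‖extendBall (b : Ball d → ℂ) z - extendBall (b : Ball d → ℂ) w‖ *
    ‖1 - inner ℂ z w‖ ^ (-kernelExp d μ))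

lemma measurable_hankelKernel {d : ℕ} (μ : Weight) (b : BUC d) :
    Measurable (Function.uncurry (hankelKernel μ b)) := by
  have := measurable_extendBall b
  unfold hankelKernel Function.uncurry
  fun_prop

lemma hankelKernel_comm {d : ℕ} (μ : Weight) (b : BUC d) (z w : Cn d) :
    hankelKernel μ b z w = hankelKernel μ b w z := by
  rw [hankelKernel, hankelKernel, norm_sub_rev, norm_one_sub_inner_comm]

/-- The Schur bound of the kernel `hankelKernel μ b`, with the weight `(1 - |z|²)^(-N/2)`. -/
lemma lintegral_hankelKernel_mul_le {d : ℕ} (μ : Weight) (b : BUC d) {ε K q : ℝ} (hε : 0 ≤ ε)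
    (hK : 0 ≤ K) (hq : 0 ≤ q) (hμ : d + 1 ≤ kernelExp d μ / 2)
    (hb : ∀ z ∈ ball (0 : Cn d) 1, ∀ w ∈ ball (0 : Cn d) 1,
      ‖extendBall (b : Ball d → ℂ) z - extendBall (b : Ball d → ℂ) w‖ ≤ ε + K ∧
      (q < sechSq z w →
        ‖extendBall (b : Ball d → ℂ) z - extendBall (b : Ball d → ℂ) w‖ ≤ ε)) (z : Ball d) :
    ∫⁻ w, hankelKernel μ b z w * ENNReal.ofReal ((1 - ‖w‖ ^ 2) ^ (-(kernelExp d μ / 2)))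
        ∂(weightedMeasure d μ) ≤
      ENNReal.ofReal (weightConst d μ * (ε / weightConst d (kernelExp d μ / 2 - d - 1) +
        K * q ^ (kernelExp d μ / 2 - d - 1) / weightConst d 0)) *
      ENNReal.ofReal ((1 - ‖(z : Cn d)‖ ^ 2) ^ (-(kernelExp d μ / 2))) := by
  set N := kernelExp d μ with hN
  have hz := one_sub_normSq_pos z.2
  have hc := weightConst_pos d μ.2
  have hm : Measurable fun w => hankelKernel μ b z w *
      ENNReal.ofReal ((1 - ‖w‖ ^ 2) ^ (-(N / 2))) := by
    have := (measurable_hankelKernel μ b).of_uncurry_left (x := (z : Cn d))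
    fun_prop
  rw [lintegral_weightedMeasure_eq_hyp μ hm]
  have h1 : ∀ᵐ w ∂(hypMeasure d),
      ENNReal.ofReal (weightConst d μ * (1 - ‖w‖ ^ 2) ^ kernelExp d μ) *
        (hankelKernel μ b z w * ENNReal.ofReal ((1 - ‖w‖ ^ 2) ^ (-(N / 2)))) =
      ENNReal.ofReal (weightConst d μ * (1 - ‖(z : Cn d)‖ ^ 2) ^ (-(N / 2))) *
        ENNReal.ofReal (‖extendBall (b : Ball d → ℂ) z - extendBall (b : Ball d → ℂ) w‖ *
          sechSq (z : Cn d) w ^ (N / 2)) := by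
    filter_upwards [ae_hypMeasure_mem_ball d] with w hw
    have hw1 := one_sub_normSq_pos hw
    have hzw := norm_one_sub_inner_pos z.2 hw
    rw [hankelKernel, ← ENNReal.ofReal_mul (by positivity), ← ENNReal.ofReal_mul (by positivity),
      ← ENNReal.ofReal_mul (by positivity), sechSq,
      Real.div_rpow (by positivity) (by positivity), Real.mul_rpow hz.le hw1.le,
      Real.rpow_neg hz.le, Real.rpow_neg (norm_nonneg _), Real.rpow_neg hw1.le,
      ← Real.rpow_natCast_mul (norm_nonneg _)]
    congr 1
    have e1 : ((2 : ℕ) : ℝ) * (N / 2) = N := by push_cast; ring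
    have e2 : (1 - ‖w‖ ^ 2) ^ N = (1 - ‖w‖ ^ 2) ^ (N / 2) * (1 - ‖w‖ ^ 2) ^ (N / 2) := by
      rw [← Real.rpow_add hw1]; ring_nf
    have hzs : 0 < (1 - ‖(z : Cn d)‖ ^ 2) ^ (N / 2) := by positivity
    have hws : 0 < (1 - ‖w‖ ^ 2) ^ (N / 2) := by positivity
    rw [e1, ← hN, e2]
    field_simp
  rw [lintegral_congr_ae h1, lintegral_const_mul' _ _ ENNReal.ofReal_ne_top]
  have h2 := lintegral_mul_sechSq_rpow_le z hε hK hq hμ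
    (ω := fun w => ‖extendBall (b : Ball d → ℂ) z - extendBall (b : Ball d → ℂ) w‖)
    (fun w hw => (hb z z.2 w hw).1) (fun w hw => (hb z z.2 w hw).2)
  calc _ ≤ _ := mul_le_mul_right h2 _
    _ = _ := by
      rw [ENNReal.ofReal_mul hc.le, ENNReal.ofReal_mul hc.le]
      ring

/-- The function `b f - P (b f)` is an integral of `f` against the kernel
`(b(z) - b(w)) K(z, w)`. -/
lemma enorm_mul_sub_toeplitzBUC_le {d : ℕ} (μ : Weight) (b : BUC d) (f : BergmanSpace d μ)
    (z : Ball d) :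
    ‖extendBall (b : Ball d → ℂ) z * f.fn z - (toeplitzBUC μ b f).fn z‖ₑ ≤
      ∫⁻ w, hankelKernel μ b z w * ‖f.fn w‖ₑ ∂(weightedMeasure d μ) := by
  have hk := (BergmanSpace.kernel μ z).memLp_fn
  have hconst : MemLp (fun _ : Cn d => extendBall (b : Ball d → ℂ) z) ∞ (weightedMeasure d μ) :=
    memLp_const _
  rw [← BergmanSpace.inner_kernel z (toeplitzBUC μ b f), inner_toeplitzBUC,
    ← BergmanSpace.inner_kernel z f, BergmanSpace.inner_eq_integral, ← integral_const_mul]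
  have e : ∀ w, extendBall (b : Ball d → ℂ) z *
      (starRingEnd ℂ ((BergmanSpace.kernel μ z).fn w) * f.fn w) =
      starRingEnd ℂ ((BergmanSpace.kernel μ z).fn w) * (extendBall (b : Ball d → ℂ) z * f.fn w) :=
    fun w => by ring
  simp only [e]
  rw [← integral_sub (integrable_conj_mul_mul hconst hk f.memLp_fn)
    (integrable_conj_mul_mul (memLp_symbol μ b) hk f.memLp_fn)]
  refine (enorm_integral_le_lintegral_enorm _).trans (lintegral_mono_ae ?_)
  filter_upwards [ae_mem_ball d μ] with w hw
  have e2 := norm_fn_kernel μ z ⟨w, hw⟩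
  simp only at e2
  rw [← mul_sub, ← sub_mul, hankelKernel, ENNReal.ofReal_mul (norm_nonneg _), ← e2, ofReal_norm,
    ofReal_norm, enorm_mul, enorm_mul, RCLike.enorm_conj]
  exact le_of_eq (by ring)

/-- The semi-commutator is the compression of multiplication by `a` composed with
`f ↦ P (b f) - b f`, which Schur's test bounds. -/
lemma norm_semiCommutator_le {d : ℕ} (μ : Weight) (a b : BUC d) {A ε K q : ℝ} (hε : 0 ≤ ε)
    (hK : 0 ≤ K) (hq : 0 ≤ q) (hμ : d + 1 ≤ kernelExp d μ / 2) (hA0 : 0 ≤ A)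
    (hA : ∀ z, ‖extendBall (a : Ball d → ℂ) z‖ ≤ A)
    (hb : ∀ z ∈ ball (0 : Cn d) 1, ∀ w ∈ ball (0 : Cn d) 1,
      ‖extendBall (b : Ball d → ℂ) z - extendBall (b : Ball d → ℂ) w‖ ≤ ε + K ∧
      (q < sechSq z w →
        ‖extendBall (b : Ball d → ℂ) z - extendBall (b : Ball d → ℂ) w‖ ≤ ε)) :
    ‖toeplitzBUC μ a * toeplitzBUC μ b - toeplitzBUC μ (a * b)‖ ≤
      A * (weightConst d μ * (ε / weightConst d (kernelExp d μ / 2 - d - 1) +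
        K * q ^ (kernelExp d μ / 2 - d - 1) / weightConst d 0)) := by
  set C := weightConst d μ * (ε / weightConst d (kernelExp d μ / 2 - d - 1) +
        K * q ^ (kernelExp d μ / 2 - d - 1) / weightConst d 0) with hCdef
  have hC : 0 ≤ C := by
    have h1 := weightConst_pos d μ.2
    have h2 := weightConst_pos d (show (-1 : ℝ) < kernelExp d μ / 2 - d - 1 by linarith)
    have h3 := weightConst_pos d (show (-1 : ℝ) < 0 by norm_num)
    positivity
  -- the norm of `f ↦ P (b f) - b f` is at most `C`
  have hS : ∀ f : BergmanSpace d μ,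
      ∫⁻ z, ‖(toeplitzBUC μ b f).fn z - extendBall (b : Ball d → ℂ) z * f.fn z‖ₑ ^ 2
        ∂(weightedMeasure d μ) ≤ ENNReal.ofReal ((C * ‖f‖) ^ 2) := by
    intro f
    have h1 := schur_test (weightedMeasure d μ) (measurable_hankelKernel μ b)
      (hankelKernel_comm μ b)
      (φ := fun w => ENNReal.ofReal ((1 - ‖w‖ ^ 2) ^ (-(kernelExp d μ / 2))))
      (by fun_prop)
      (by
        filter_upwards [ae_mem_ball d μ] with z hz
        simpa using Real.rpow_pos_of_pos (one_sub_normSq_pos hz) _)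
      (Eventually.of_forall fun z => ENNReal.ofReal_ne_top)
      (C := ENNReal.ofReal C)
      (by
        filter_upwards [ae_mem_ball d μ] with z hz
        exact lintegral_hankelKernel_mul_le μ b hε hK hq hμ hb ⟨z, hz⟩)
      (g := fun w => ‖f.fn w‖ₑ) f.memLp_fn.aestronglyMeasurable.enorm
    rw [f.lintegral_enorm_fn_sq, ← ENNReal.ofReal_pow hC, ← ENNReal.ofReal_mul (by positivity),
      ← mul_pow] at h1
    refine le_trans (lintegral_mono_ae ?_) h1
    filter_upwards [ae_mem_ball d μ] with z hz
    gcongr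
    rw [← enorm_neg, neg_sub]
    exact enorm_mul_sub_toeplitzBUC_le μ b f ⟨z, hz⟩
  refine opNorm_le_of_norm_inner_le (by positivity) fun h f => ?_
  have hm : MemLp (fun z => extendBall (b : Ball d → ℂ) z * f.fn z) 2 (weightedMeasure d μ) :=
    f.memLp_fn.mul (memLp_symbol μ b)
  have e : inner ℂ h ((toeplitzBUC μ a * toeplitzBUC μ b - toeplitzBUC μ (a * b)) f) =
      ∫ z, starRingEnd ℂ (h.fn z) * (extendBall (a : Ball d → ℂ) z *
        ((toeplitzBUC μ b f).fn z - extendBall (b : Ball d → ℂ) z * f.fn z))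
          ∂(weightedMeasure d μ) := by
    rw [sub_apply, inner_sub_right, mul_apply_eq_comp,
      inner_toeplitzBUC, inner_toeplitzBUC, ← integral_sub
        (integrable_conj_mul_mul (memLp_symbol μ a) h.memLp_fn (toeplitzBUC μ b f).memLp_fn)
        (integrable_conj_mul_mul (memLp_symbol μ (a * b)) h.memLp_fn f.memLp_fn)]
    refine integral_congr_ae (Eventually.of_forall fun z => ?_)
    simp only [Subalgebra.coe_mul, extendBall_mul]
    ring
  rw [e, mul_assoc A]
  exact norm_integral_conj_mul_mul_le h
    ((toeplitzBUC μ b f).memLp_fn.aestronglyMeasurable.sub hm.aestronglyMeasurable).enorm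
    hA0 (by positivity) hA (hS f)

/-- Semi-commutators become small as the weight grows. -/
lemma tendsto_norm_semiCommutator {d : ℕ} (μ : Weight) (a b : BUC d) :
    Tendsto (fun p : ℕ => ‖toeplitzBUC (μ.shift p) a * toeplitzBUC (μ.shift p) b -
      toeplitzBUC (μ.shift p) (a * b)‖) atTop (𝓝 0) := by
  obtain ⟨A, hA⟩ := exists_norm_extendBall_le a
  have hA0 : 0 ≤ A := (norm_nonneg _).trans (hA 0)
  have hw : Tendsto (fun p : ℕ => ((μ.shift p : Weight) : ℝ)) atTop atTop :=
    tendsto_atTop_add_const_left _ _ tendsto_natCast_atTop_atTop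
  rw [Metric.tendsto_atTop']
  suffices H : ∀ ε > 0, ∀ᶠ p : ℕ in atTop, ‖toeplitzBUC (μ.shift p) a * toeplitzBUC (μ.shift p) b -
      toeplitzBUC (μ.shift p) (a * b)‖ ≤ ε by
    intro ε hε
    obtain ⟨P, hP⟩ := eventually_atTop.1 (H (ε / 2) (by positivity))
    refine ⟨P, fun p hp => ?_⟩
    rw [dist_zero_right, norm_norm]
    exact (hP p hp.le).trans_lt (by linarith)
  intro ε hε
  -- near the diagonal the oscillation contributes at most `A * 4 ^ d` times this bound
  obtain ⟨K, q, hK, hq0, hq1, hb⟩ :=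
    exists_oscillation_bound b (ε := ε / (2 * (A + 1) * 4 ^ d)) (by positivity)
  have h1 := ((tendsto_weightConst_mul_rpow d hq0 hq1 (a := 1 / 2) (by norm_num)
    ((d + 1) / 2 - d - 1)).comp hw).const_mul (A * K / weightConst d 0)
  rw [mul_zero] at h1
  filter_upwards [h1.eventually_le_const (half_pos hε), hw.eventually_ge_atTop (2 * d + 1)]
    with p hp1 hp2
  set ν := μ.shift p
  have hN : kernelExp d ν = d + 1 + ν := rfl
  have hd : (0 : ℝ) ≤ d := d.cast_nonneg
  have hN2 : d + 1 ≤ kernelExp d ν / 2 := by rw [hN]; linarith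
  refine (norm_semiCommutator_le ν a b (by positivity) hK hq0.le hN2 hA0 hA hb).trans ?_
  have h3 : weightConst d ν ≤ 4 ^ d * weightConst d (kernelExp d ν / 2 - d - 1) :=
    weightConst_le_mul d (ν := ν) (by linarith)
  have h4 := weightConst_pos d (show (-1 : ℝ) < kernelExp d ν / 2 - d - 1 by linarith)
  have h5 : A * (weightConst d ν * (ε / (2 * (A + 1) * 4 ^ d) /
      weightConst d (kernelExp d ν / 2 - d - 1))) ≤ ε / 2 := by
    have h6 : weightConst d ν / weightConst d (kernelExp d ν / 2 - d - 1) ≤ 4 ^ d := by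
      rwa [div_le_iff₀ h4]
    calc _ = (A / (A + 1)) * (ε / 2) / 4 ^ d *
          (weightConst d ν / weightConst d (kernelExp d ν / 2 - d - 1)) := by field_simp
      _ ≤ 1 * (ε / 2) / 4 ^ d * 4 ^ d := by
          have h7 : A / (A + 1) ≤ 1 := by rw [div_le_one (by positivity)]; linarith
          have h8 := weightConst_pos d ν.2
          gcongr
      _ = ε / 2 := by field_simp
  have h7 : A * (weightConst d ν * (K * q ^ (kernelExp d ν / 2 - d - 1) / weightConst d 0)) ≤
      ε / 2 := by
    refine le_trans (le_of_eq ?_) hp1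
    have : kernelExp d ν / 2 - d - 1 = 1 / 2 * (ν : ℝ) + ((d + 1) / 2 - d - 1) := by rw [hN]; ring
    rw [this]
    simp only [Function.comp]
    ring
  rw [mul_add, mul_add]
  linarith

/-! ### Recovering the symbol -/

/-- The Berezin transform of a Toeplitz operator recovers the symbol up to a small error. -/
lemma norm_symbol_le {d : ℕ} (μ : Weight) (c : BUC d) {ε K q : ℝ} (hε : 0 ≤ ε)
    (hK : 0 ≤ K) (hq : 0 ≤ q) (hμ : 0 ≤ (μ : ℝ))
    (hb : ∀ z ∈ ball (0 : Cn d) 1, ∀ w ∈ ball (0 : Cn d) 1,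
      ‖extendBall (c : Ball d → ℂ) z - extendBall (c : Ball d → ℂ) w‖ ≤ ε + K ∧
      (q < sechSq z w →
        ‖extendBall (c : Ball d → ℂ) z - extendBall (c : Ball d → ℂ) w‖ ≤ ε)) (z : Ball d) :
    ‖(c : Ball d → ℂ) z‖ ≤
      ‖toeplitzBUC μ c‖ + (ε + K * (weightConst d μ * q ^ (μ : ℝ)) / weightConst d 0) := by
  set N := kernelExp d μ with hN
  have hz := one_sub_normSq_pos z.2
  have hc := weightConst_pos d μ.2
  have hc0 := weightConst_pos d (show (-1 : ℝ) < 0 by norm_num)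
  set k := BergmanSpace.kernel μ z with hk
  have h1 := enorm_mul_sub_toeplitzBUC_le μ c k z
  rw [← BergmanSpace.inner_kernel z (toeplitzBUC μ c k), ← BergmanSpace.inner_kernel z k, ← hk,
    extendBall_of_mem, inner_self_eq_norm_sq_to_K] at h1
  have hm : Measurable fun w => hankelKernel μ c z w *
      ENNReal.ofReal (‖1 - inner ℂ (z : Cn d) w‖ ^ (-N)) := by
    have := (measurable_hankelKernel μ c).of_uncurry_left (x := (z : Cn d))
    fun_prop
  have h2 : ∫⁻ w, hankelKernel μ c z w * ‖k.fn w‖ₑ ∂(weightedMeasure d μ) =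
      ∫⁻ w, hankelKernel μ c z w * ENNReal.ofReal (‖1 - inner ℂ (z : Cn d) w‖ ^ (-N))
        ∂(weightedMeasure d μ) := by
    refine lintegral_congr_ae ?_
    filter_upwards [ae_mem_ball d μ] with w hw
    have := norm_fn_kernel μ z ⟨w, hw⟩
    simp only at this
    rw [hN, ← this, ofReal_norm]
  have h3 : ∀ᵐ w ∂(hypMeasure d),
      ENNReal.ofReal (weightConst d μ * (1 - ‖w‖ ^ 2) ^ kernelExp d μ) *
        (hankelKernel μ c z w * ENNReal.ofReal (‖1 - inner ℂ (z : Cn d) w‖ ^ (-N))) =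
      ENNReal.ofReal (weightConst d μ * (1 - ‖(z : Cn d)‖ ^ 2) ^ (-N)) *
        ENNReal.ofReal (‖extendBall (c : Ball d → ℂ) z - extendBall (c : Ball d → ℂ) w‖ *
          sechSq (z : Cn d) w ^ N) := by
    filter_upwards [ae_hypMeasure_mem_ball d] with w hw
    have hw1 := one_sub_normSq_pos hw
    have hzw := norm_one_sub_inner_pos z.2 hw
    rw [hankelKernel, ← ENNReal.ofReal_mul (by positivity), ← ENNReal.ofReal_mul (by positivity),
      ← ENNReal.ofReal_mul (by positivity), sechSq,
      Real.div_rpow (by positivity) (by positivity), Real.mul_rpow hz.le hw1.le,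
      Real.rpow_neg hz.le, Real.rpow_neg (norm_nonneg _), ← Real.rpow_pow_comm (norm_nonneg _)]
    congr 1
    have hzs : 0 < (1 - ‖(z : Cn d)‖ ^ 2) ^ N := by positivity
    rw [← hN]
    field_simp
  have hN1 : N - d - 1 = μ := by rw [hN, kernelExp]; ring
  have h4 := lintegral_mul_sechSq_rpow_le z hε hK hq (s := N) (by rw [hN, kernelExp]; linarith)
    (ω := fun w => ‖extendBall (c : Ball d → ℂ) z - extendBall (c : Ball d → ℂ) w‖)
    (fun w hw => (hb z z.2 w hw).1) (fun w hw => (hb z z.2 w hw).2)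
  rw [hN1] at h4
  have hk2 : ‖k‖ ^ 2 = (1 - ‖(z : Cn d)‖ ^ 2) ^ (-N) := norm_sq_kernel μ z
  have hk0 : 0 < ‖k‖ ^ 2 := by rw [hk2]; positivity
  have h5 := h1.trans ((h2.trans ((lintegral_weightedMeasure_eq_hyp μ hm).trans
    ((lintegral_congr_ae h3).trans (lintegral_const_mul' _ _ ENNReal.ofReal_ne_top)))).le.trans
    (mul_le_mul_right h4 _))
  rw [← ENNReal.ofReal_mul (by positivity), ← hk2, ← ofReal_norm,
    ENNReal.ofReal_le_ofReal_iff (by positivity)] at h5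
  have h6 : ‖inner ℂ k (toeplitzBUC μ c k)‖ ≤ ‖toeplitzBUC μ c‖ * ‖k‖ ^ 2 := by
    calc _ ≤ ‖k‖ * ‖toeplitzBUC μ c k‖ := norm_inner_le_norm _ _
      _ ≤ ‖k‖ * (‖toeplitzBUC μ c‖ * ‖k‖) := by gcongr; exact ContinuousLinearMap.le_opNorm _ _
      _ = _ := by ring
  have h7 : ‖(c : Ball d → ℂ) z * (RCLike.ofReal ‖k‖ : ℂ) ^ 2‖ = ‖(c : Ball d → ℂ) z‖ * ‖k‖ ^ 2 := by
    simp
  have h8 := norm_le_norm_sub_add ((c : Ball d → ℂ) z * (RCLike.ofReal ‖k‖ : ℂ) ^ 2)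
    (inner ℂ k (toeplitzBUC μ c k))
  rw [h7] at h8
  refine le_of_mul_le_mul_right ?_ hk0
  refine h8.trans ((add_le_add h5 h6).trans (le_of_eq ?_))
  field_simp
  ring

/-- For large weights the supremum of the symbol is controlled by the norm of the Toeplitz
operator. -/
lemma eventually_norm_symbol_le {d : ℕ} (μ : Weight) (c : BUC d) {ε : ℝ} (hε : 0 < ε) :
    ∀ᶠ p : ℕ in atTop, ∀ z, ‖(c : Ball d → ℂ) z‖ ≤ ‖toeplitzBUC (μ.shift p) c‖ + ε := by
  have hw : Tendsto (fun p : ℕ => ((μ.shift p : Weight) : ℝ)) atTop atTop :=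
    tendsto_atTop_add_const_left _ _ tendsto_natCast_atTop_atTop
  obtain ⟨K, q, hK, hq0, hq1, hb⟩ := exists_oscillation_bound c (half_pos hε)
  have h1 := ((tendsto_weightConst_mul_rpow d hq0 hq1 one_pos 0).comp hw).const_mul
    (K / weightConst d 0)
  rw [mul_zero] at h1
  filter_upwards [h1.eventually_le_const (half_pos hε), hw.eventually_ge_atTop 0]
    with p hp1 hp2 z
  have h2 := norm_symbol_le (μ.shift p) c (half_pos hε).le hK hq0.le hp2 hb z
  have h3 : K * (weightConst d (μ.shift p) * q ^ ((μ.shift p : Weight) : ℝ)) / weightConst d 0 ≤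
      ε / 2 := by
    refine le_trans (le_of_eq ?_) hp1
    simp only [Function.comp, one_mul, add_zero]
    ring
  linarith

/-! ### The decomposition of the Bergman space -/

/-- A normed space that is a continuous linear retract of a complete space is complete. -/
lemma completeSpace_of_retract {E G : Type*} [NormedAddCommGroup E] [NormedSpace ℂ E]
    [NormedAddCommGroup G] [NormedSpace ℂ G] [CompleteSpace G] (i : E →L[ℂ] G) (r : G →L[ℂ] E)
    (h : ∀ x, r (i x) = x) : CompleteSpace E := by
  refine Metric.complete_of_cauchySeq_tendsto fun u hu => ?_
  obtain ⟨g, hg⟩ := cauchySeq_tendsto_of_complete (i.uniformContinuous.comp_cauchySeq hu)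
  refine ⟨r g, ?_⟩
  have := (r.continuous.tendsto g).comp hg
  refine this.congr fun n => ?_
  simp [h]

/-- The tensor product of a finite-dimensional space with a Hilbert space is complete. -/
lemma completeSpace_tensorProduct {E F : Type*} [NormedAddCommGroup E] [InnerProductSpace ℂ E]
    [FiniteDimensional ℂ E] [NormedAddCommGroup F] [InnerProductSpace ℂ F] [CompleteSpace F] :
    CompleteSpace (E ⊗[ℂ] F) := by
  let b := stdOrthonormalBasis ℂ E
  let i : E ⊗[ℂ] F →L[ℂ] (Fin (Module.finrank ℂ E) → F) := ContinuousLinearMap.pi fun j =>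
    (TensorProduct.lidIsometry ℂ F).toContinuousLinearEquiv.toContinuousLinearMap ∘L
      (innerSL ℂ (b j)).rTensor F
  let r : (Fin (Module.finrank ℂ E) → F) →L[ℂ] E ⊗[ℂ] F :=
    ∑ j, (TensorProduct.mkL ℂ E F (b j)) ∘L ContinuousLinearMap.proj j
  refine completeSpace_of_retract i r fun x => ?_
  induction x with
  | zero => simp
  | add x y hx hy => rw [map_add, map_add, hx, hy]
  | tmul e f =>
    have h1 : ∀ j, i (e ⊗ₜ f) j = inner ℂ (b j) e • f := fun j => by
      simp [i]
    have h2 : r (i (e ⊗ₜ f)) = ∑ j, (inner ℂ (b j) e • b j) ⊗ₜ[ℂ] f := by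
      simp only [r, sum_apply, ContinuousLinearMap.comp_apply,
        ContinuousLinearMap.proj_apply, h1, TensorProduct.mkL_apply_apply,
        TensorProduct.tmul_smul, TensorProduct.smul_tmul']
    rw [h2, ← TensorProduct.sum_tmul, b.sum_repr' e]

lemma dense_span_hilbertBasis {ι E : Type*} [NormedAddCommGroup E] [InnerProductSpace ℂ E]
    (b : HilbertBasis ι ℂ E) : Dense (Submodule.span ℂ (range b) : Set E) :=
  Submodule.dense_iff_topologicalClosure_eq_top.2 b.dense_span

/-- A vector of a tensor product is determined by its inner products with `e ⊗ f`, where `e` runs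
through a spanning set and `f` through a total set. -/
lemma tensorProduct_eq_of_inner {E F : Type*} [NormedAddCommGroup E] [InnerProductSpace ℂ E]
    [NormedAddCommGroup F] [InnerProductSpace ℂ F] {s : Set E} {t : Set F}
    (hs : Submodule.span ℂ s = ⊤) (ht : Dense (Submodule.span ℂ t : Set F)) {u v : E ⊗[ℂ] F}
    (h : ∀ e ∈ s, ∀ f ∈ t, inner ℂ (e ⊗ₜ[ℂ] f) u = inner ℂ (e ⊗ₜ[ℂ] f) v) : u = v := by
  rw [TensorProduct.ext_iff_inner_left]
  intro e f
  revert f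
  induction (hs ▸ Submodule.mem_top : e ∈ Submodule.span ℂ s) using Submodule.span_induction with
  | mem e he =>
    have h1 : innerSL ℂ u ∘L TensorProduct.mkL ℂ E F e =
        innerSL ℂ v ∘L TensorProduct.mkL ℂ E F e :=
      ContinuousLinearMap.ext_on ht fun f hf => (inner_conj_symm u (e ⊗ₜ[ℂ] f)).symm.trans
        ((congrArg (starRingEnd ℂ) (h e he f hf)).trans (inner_conj_symm v (e ⊗ₜ[ℂ] f)))
    intro f
    exact (inner_conj_symm (e ⊗ₜ[ℂ] f) u).symm.trans ((congrArg (starRingEnd ℂ)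
      (DFunLike.congr_fun h1 f)).trans (inner_conj_symm (e ⊗ₜ[ℂ] f) v))
  | zero => simp
  | add e₁ e₂ _ _ ih₁ ih₂ =>
    intro f
    rw [TensorProduct.add_tmul, inner_add_left, inner_add_left, ih₁, ih₂]
  | smul r e _ ih =>
    intro f
    rw [← TensorProduct.smul_tmul', inner_smul_left, inner_smul_left, ih]

lemma sum_blockDegree {ℓ : ℕ} (k : Composition ℓ) (α : Fin ℓ → ℕ) :
    ∑ j, blockDegree k α j = ∑ i, α i :=
  Finset.sum_fiberwise _ _ _

lemma finite_blockDegree_eq {ℓ : ℕ} (k : Composition ℓ) (ρ : Fin k.length → ℕ) :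
    {α | blockDegree k α = ρ}.Finite := by
  refine (Set.finite_Iic fun i => ρ (k.index i)).subset fun α hα i => ?_
  have hα : blockDegree k α = ρ := hα
  change α i ≤ ρ (k.index i)
  rw [← hα]
  exact Finset.single_le_sum (f := α) (fun _ _ => Nat.zero_le _) (by simp)

/-- Every tuple `ρ` occurs as a tuple of block degrees: the whole degree of a block is put on its
first coordinate, as the blocks of a composition are nonempty. -/
lemma exists_blockDegree_eq {ℓ : ℕ} (k : Composition ℓ) (ρ : Fin k.length → ℕ) :
    ∃ α, blockDegree k α = ρ := by
  let first : Fin k.length → Fin ℓ := fun j => k.embedding j ⟨0, k.blocks_pos' j j.2⟩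
  refine ⟨fun i => if i = first (k.index i) then ρ (k.index i) else 0, ?_⟩
  ext j
  have hj : k.index (first j) = j := k.index_embedding _ _
  rw [blockDegree, Finset.sum_eq_single (first j)]
  · simp [hj]
  · intro i hi hne
    have hi : k.index i = j := by simpa using hi
    rw [hi, if_neg hne]
  · intro h
    simp [hj] at h

lemma exists_sum_eq {m : ℕ} (hm : 0 < m) (p : ℕ) : ∃ ρ : Fin m → ℕ, ∑ j, ρ j = p :=
  ⟨Pi.single ⟨0, hm⟩ p, by simp⟩

instance finiteDimensional_levelSpace {ℓ : ℕ} (μ : Weight) (k : Composition ℓ)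
    (ρ : Fin k.length → ℕ) : FiniteDimensional ℂ (levelSpace μ k ρ) :=
  FiniteDimensional.span_of_finite ℂ ((finite_blockDegree_eq k ρ).image _)

instance completeSpace_summand {ℓ d : ℕ} (μ : Weight) (k : Composition ℓ)
    (ρ : Fin k.length → ℕ) : CompleteSpace (Summand d μ k ρ) :=
  completeSpace_tensorProduct

/-- `e_α'` as an element of `ℋ_ρ`, for a multi-index `α'` with block degrees `ρ`. -/
def levelVecOf {ℓ : ℕ} (μ : Weight) (k : Composition ℓ) {ρ : Fin k.length → ℕ} (α : Fin ℓ → ℕ)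
    (h : blockDegree k α = ρ) : levelSpace μ k ρ :=
  ⟨basisVec ℓ μ α, Submodule.subset_span ⟨α, h, rfl⟩⟩

/-- The image `e_α' ⊗ e_α''` of a basis vector under the decomposition. -/
def sumVec {ℓ : ℕ} (d : ℕ) (μ : Weight) (k : Composition ℓ) (α' : Fin ℓ → ℕ) (α'' : Fin d → ℕ) :
    DirectSumSpace d μ k :=
  lp.single 2 (blockDegree k α')
    (levelVec μ k α' ⊗ₜ[ℂ] basisVec d (levelWeight ℓ μ (blockDegree k α')) α'')

lemma sumVec_apply_of_eq {ℓ d : ℕ} {μ : Weight} {k : Composition ℓ} {ρ : Fin k.length → ℕ}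
    (α' : Fin ℓ → ℕ) (α'' : Fin d → ℕ) (h : blockDegree k α' = ρ) :
    sumVec d μ k α' α'' ρ = levelVecOf μ k α' h ⊗ₜ[ℂ] basisVec d (levelWeight ℓ μ ρ) α'' := by
  subst h
  exact lp.single_apply_self _ _ _

lemma sumVec_apply_of_ne {ℓ d : ℕ} {μ : Weight} {k : Composition ℓ} {ρ : Fin k.length → ℕ}
    (α' : Fin ℓ → ℕ) (α'' : Fin d → ℕ) (h : blockDegree k α' ≠ ρ) :
    sumVec d μ k α' α'' ρ = 0 :=
  lp.single_apply_ne _ _ _ h.symm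

lemma inner_sumVec {ℓ d : ℕ} {μ : Weight} {k : Composition ℓ} {ρ : Fin k.length → ℕ}
    (α' : Fin ℓ → ℕ) (α'' : Fin d → ℕ) (h : blockDegree k α' = ρ) (x : DirectSumSpace d μ k) :
    inner ℂ (sumVec d μ k α' α'') x =
      inner ℂ (levelVecOf μ k α' h ⊗ₜ[ℂ] basisVec d (levelWeight ℓ μ ρ) α'') (x ρ) := by
  subst h
  exact lp.inner_single_left _ _ _

/-- A vector of a summand is determined by its inner products with the basis vectors. -/
lemma summand_eq_of_inner {ℓ d : ℕ} {μ : Weight} {k : Composition ℓ} {ρ : Fin k.length → ℕ}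
    {u v : Summand d μ k ρ}
    (h : ∀ (α' : Fin ℓ → ℕ) (h : blockDegree k α' = ρ) (α'' : Fin d → ℕ),
      inner ℂ (levelVecOf μ k α' h ⊗ₜ[ℂ] basisVec d (levelWeight ℓ μ ρ) α'') u =
      inner ℂ (levelVecOf μ k α' h ⊗ₜ[ℂ] basisVec d (levelWeight ℓ μ ρ) α'') v) : u = v := by
  refine tensorProduct_eq_of_inner Submodule.span_span_coe_preimage
    (dense_span_hilbertBasis (monomialBasis d (levelWeight ℓ μ ρ))) ?_
  rintro ⟨_, _⟩ ⟨α', hα', rfl⟩ _ ⟨α'', rfl⟩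
  rw [monomialBasis_apply]
  exact h α' hα' α''

lemma inner_levelVecOf {ℓ : ℕ} {μ : Weight} {k : Composition ℓ} {ρ : Fin k.length → ℕ}
    (α β : Fin ℓ → ℕ) (hα : blockDegree k α = ρ) (hβ : blockDegree k β = ρ) :
    inner ℂ (levelVecOf μ k α hα) (levelVecOf μ k β hβ) = if α = β then 1 else 0 := by
  have h := orthonormal_iff_ite.1 (orthonormal_basisVec ℓ μ) α β
  exact h

/-- The vectors `e_α' ⊗ e_α''`, indexed by the joint multi-index `α = (α', α'')`. -/
def sumVecJoint {ℓ : ℕ} (d : ℕ) (μ : Weight) (k : Composition ℓ) (γ : Fin (ℓ + d) → ℕ) :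
    DirectSumSpace d μ k :=
  sumVec d μ k (fun i => γ (Fin.castAdd d i)) (fun i => γ (Fin.natAdd ℓ i))

lemma sumVecJoint_append {ℓ d : ℕ} (μ : Weight) (k : Composition ℓ) (α' : Fin ℓ → ℕ)
    (α'' : Fin d → ℕ) : sumVecJoint d μ k (Fin.append α' α'') = sumVec d μ k α' α'' := by
  simp [sumVecJoint]

lemma append_castAdd_natAdd {ℓ d : ℕ} (γ : Fin (ℓ + d) → ℕ) :
    Fin.append (fun i => γ (Fin.castAdd d i)) (fun i => γ (Fin.natAdd ℓ i)) = γ :=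
  Fin.append_castAdd_natAdd

lemma inner_sumVec_sumVec {ℓ d : ℕ} (μ : Weight) (k : Composition ℓ) (α' β' : Fin ℓ → ℕ)
    (α'' β'' : Fin d → ℕ) :
    inner ℂ (sumVec d μ k α' α'') (sumVec d μ k β' β'') =
      if α' = β' ∧ α'' = β'' then 1 else 0 := by
  rw [inner_sumVec α' α'' rfl]
  by_cases h : blockDegree k β' = blockDegree k α'
  · rw [sumVec_apply_of_eq β' β'' h, TensorProduct.inner_tmul, inner_levelVecOf,
      orthonormal_iff_ite.1 (orthonormal_basisVec d _) α'' β'', ite_and]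
    split_ifs <;> simp
  · rw [sumVec_apply_of_ne β' β'' h, if_neg]
    · exact inner_zero_right (𝕜 := ℂ) (E := Summand d μ k _) _
    · rintro ⟨rfl, -⟩
      exact h rfl

lemma orthonormal_sumVecJoint {ℓ : ℕ} (d : ℕ) (μ : Weight) (k : Composition ℓ) :
    Orthonormal ℂ (sumVecJoint d μ k) := by
  classical
  rw [orthonormal_iff_ite]
  intro γ δ
  rw [sumVecJoint, sumVecJoint, inner_sumVec_sumVec]
  refine if_congr ⟨fun h => ?_, fun h => by simp [h]⟩ rfl rfl
  rw [← append_castAdd_natAdd γ, ← append_castAdd_natAdd δ, h.1, h.2]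

/-- The Hilbert basis `e_α' ⊗ e_α''` of the direct sum. -/
def sumBasis {ℓ : ℕ} (d : ℕ) (μ : Weight) (k : Composition ℓ) :
    HilbertBasis (Fin (ℓ + d) → ℕ) ℂ (DirectSumSpace d μ k) :=
  HilbertBasis.mkOfOrthogonalEqBot (orthonormal_sumVecJoint d μ k) <| by
    rw [Submodule.eq_bot_iff]
    intro x hx
    refine lp.ext (funext fun ρ => ?_)
    refine summand_eq_of_inner fun α' h α'' => ?_
    have h1 : inner ℂ (sumVecJoint d μ k (Fin.append α' α'')) x = 0 :=
      (Submodule.mem_orthogonal _ _).1 hx _ (Submodule.subset_span ⟨_, rfl⟩)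
    rw [sumVecJoint_append, inner_sumVec α' α'' h] at h1
    rw [h1]
    exact (inner_zero_right (𝕜 := ℂ) (E := Summand d μ k _) _).symm

@[simp] lemma sumBasis_apply {ℓ : ℕ} (d : ℕ) (μ : Weight) (k : Composition ℓ)
    (γ : Fin (ℓ + d) → ℕ) : sumBasis d μ k γ = sumVecJoint d μ k γ := by
  simp [sumBasis]

lemma inner_map_map_lp {ι E : Type*} {G : ι → Type*} [∀ i, NormedAddCommGroup (G i)]
    [∀ i, InnerProductSpace ℂ (G i)] [NormedAddCommGroup E] [InnerProductSpace ℂ E]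
    (U : E ≃ₗᵢ[ℂ] lp G 2) (x y : E) : inner ℂ (U x) (U y) = inner ℂ x y :=
  U.inner_map_map x y

/-- `U` is the decomposition precisely if it maps one Hilbert basis to the other. -/
lemma isDecomposition_iff {ℓ d : ℕ} {μ : Weight} {k : Composition ℓ}
    {U : BergmanSpace (ℓ + d) μ ≃ₗᵢ[ℂ] DirectSumSpace d μ k} :
    IsDecomposition U ↔ ∀ γ, U (monomialBasis (ℓ + d) μ γ) = sumBasis d μ k γ := by
  simp only [monomialBasis_apply, sumBasis_apply]
  constructor
  · intro h γ
    rw [← append_castAdd_natAdd γ, sumVecJoint_append]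
    exact h _ _
  · intro h α' α''
    rw [h, sumVecJoint_append]
    rfl

/-- Both sides have Hilbert bases with the same index set, which `U` must match. -/
lemma existsUnique_isDecomposition (ℓ d : ℕ) (μ : Weight) (k : Composition ℓ) :
    ∃! U : BergmanSpace (ℓ + d) μ ≃ₗᵢ[ℂ] DirectSumSpace d μ k, IsDecomposition U := by
  classical
  refine ⟨(monomialBasis (ℓ + d) μ).repr.trans (sumBasis d μ k).repr.symm, ?_, fun V hV => ?_⟩
  · refine isDecomposition_iff.2 fun γ => ?_
    rw [LinearIsometryEquiv.trans_apply, HilbertBasis.repr_self, HilbertBasis.repr_symm_single]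
  · replace hV := isDecomposition_iff.1 hV
    have hd := dense_span_hilbertBasis (monomialBasis (ℓ + d) μ)
    have : (V.toContinuousLinearEquiv : BergmanSpace (ℓ + d) μ →L[ℂ] DirectSumSpace d μ k) =
        (((monomialBasis (ℓ + d) μ).repr.trans
          (sumBasis d μ k).repr.symm).toContinuousLinearEquiv :
            BergmanSpace (ℓ + d) μ →L[ℂ] DirectSumSpace d μ k) := by
      refine ContinuousLinearMap.ext_on hd ?_
      rintro _ ⟨γ, rfl⟩
      refine (hV γ).trans ?_
      change _ = (sumBasis d μ k).repr.symm ((monomialBasis (ℓ + d) μ).repr _)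
      rw [HilbertBasis.repr_self, HilbertBasis.repr_symm_single]
    ext1 x
    exact DFunLike.congr_fun this x

/-! ### Lifted Toeplitz operators are decomposed -/

/-- The coordinate projections of the direct sum. -/
def sumProj {ℓ : ℕ} (d : ℕ) (μ : Weight) (k : Composition ℓ) (ρ : Fin k.length → ℕ) :
    DirectSumSpace d μ k →L[ℂ] Summand d μ k ρ :=
  LinearMap.mkContinuous
    { toFun := fun x : DirectSumSpace d μ k => x ρ
      map_add' := fun _ _ => rfl
      map_smul' := fun _ _ => rfl } 1 fun x => by
    rw [one_mul]
    exact lp.norm_apply_le_norm two_ne_zero x ρ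

lemma inner_toeplitzBUC_basisVec {d : ℕ} (μ : Weight) (c : BUC d) (α β : Fin d → ℕ) :
    inner ℂ (basisVec d μ β) (toeplitzBUC μ c (basisVec d μ α)) =
      ∫ z, starRingEnd ℂ (monomialFun d μ β z) *
        (extendBall (c : Ball d → ℂ) z * monomialFun d μ α z) ∂(weightedMeasure d μ) := by
  rw [inner_toeplitzBUC]
  refine integral_congr_ae ?_
  filter_upwards [fn_basisVec_ae μ α, fn_basisVec_ae μ β] with z h1 h2
  rw [h1, h2]

/-- Integration over the slices `z'' = const` gives the matrix of a lifted Toeplitz operator. -/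
lemma inner_toeplitzLifted_basisVec {ℓ d : ℕ} (μ : Weight) (c : BUC d) (α' β' : Fin ℓ → ℕ)
    (α'' β'' : Fin d → ℕ) :
    inner ℂ (basisVec (ℓ + d) μ (Fin.append β' β''))
        (toeplitzLifted ℓ μ c (basisVec (ℓ + d) μ (Fin.append α' α''))) =
      if α' = β' then
        inner ℂ (basisVec d (μ.shift ((∑ i, β' i) + ℓ)) β'')
          (toeplitzBUC _ c (basisVec d (μ.shift ((∑ i, β' i) + ℓ)) α''))
      else 0 := by
  obtain ⟨C, hC⟩ := exists_norm_extendBall_le c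
  have h1 := integral_monomials_lastCoords (monomialsOrthonormal ℓ μ) α' β' α'' β''
    (measurable_extendBall c) hC
  rw [inner_toeplitzLifted]
  have h2 : ∫ z, starRingEnd ℂ ((basisVec (ℓ + d) μ (Fin.append β' β'')).fn z) *
      (extendBall (c : Ball d → ℂ) (lastCoords ℓ d z) *
        (basisVec (ℓ + d) μ (Fin.append α' α'')).fn z) ∂(weightedMeasure (ℓ + d) μ) =
      ∫ z, starRingEnd ℂ (monomialFun (ℓ + d) μ (Fin.append β' β'') z) *
      (extendBall (c : Ball d → ℂ) (lastCoords ℓ d z) *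
        monomialFun (ℓ + d) μ (Fin.append α' α'') z) ∂(weightedMeasure (ℓ + d) μ) := by
    refine integral_congr_ae ?_
    filter_upwards [fn_basisVec_ae μ (Fin.append α' α''), fn_basisVec_ae μ (Fin.append β' β'')]
      with z h1 h2
    rw [h1, h2]
  rw [h2, h1]
  split_ifs with h
  · rw [inner_toeplitzBUC_basisVec, h]
  · rfl

lemma decomposesAs_toeplitzLifted {ℓ d : ℕ} {μ : Weight} {k : Composition ℓ}
    {U : BergmanSpace (ℓ + d) μ ≃ₗᵢ[ℂ] DirectSumSpace d μ k} (hU : IsDecomposition U)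
    (c : BUC d) :
    DecomposesAs U (toeplitzLifted ℓ μ c) fun ρ => toeplitzBUC (levelWeight ℓ μ ρ) c := by
  intro x ρ
  have hd := dense_span_hilbertBasis (sumBasis d μ k)
  let L : DirectSumSpace d μ k →L[ℂ] Summand d μ k ρ := sumProj d μ k ρ ∘L
    (U.toContinuousLinearEquiv : BergmanSpace (ℓ + d) μ →L[ℂ] DirectSumSpace d μ k) ∘L
    toeplitzLifted ℓ μ c ∘L
    (U.symm.toContinuousLinearEquiv : DirectSumSpace d μ k →L[ℂ] BergmanSpace (ℓ + d) μ)
  suffices H : L = (toeplitzBUC (levelWeight ℓ μ ρ) c).lTensor (levelSpace μ k ρ) ∘L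
      sumProj d μ k ρ from DFunLike.congr_fun H x
  refine ContinuousLinearMap.ext_on hd ?_
  rintro _ ⟨γ, rfl⟩
  rw [sumBasis_apply, ← append_castAdd_natAdd γ, sumVecJoint_append]
  set α' : Fin ℓ → ℕ := fun i => γ (Fin.castAdd d i)
  set α'' : Fin d → ℕ := fun i => γ (Fin.natAdd ℓ i)
  change (U (toeplitzLifted ℓ μ c (U.symm (sumVec d μ k α' α''))) : ∀ ρ, Summand d μ k ρ) ρ =
    (toeplitzBUC (levelWeight ℓ μ ρ) c).lTensor (levelSpace μ k ρ) (sumVec d μ k α' α'' ρ)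
  have hU' : ∀ β' β'', U (basisVec (ℓ + d) μ (Fin.append β' β'')) = sumVec d μ k β' β'' :=
    fun β' β'' => hU β' β''
  rw [← hU' α' α'', LinearIsometryEquiv.symm_apply_apply, hU']
  refine summand_eq_of_inner fun β' hβ β'' => ?_
  rw [← inner_sumVec β' β'' hβ, ← hU']
  refine (inner_map_map_lp U _ _).trans ?_
  rw [inner_toeplitzLifted_basisVec]
  subst hβ
  by_cases h : blockDegree k α' = blockDegree k β'
  · rw [sumVec_apply_of_eq α' α'' h, ContinuousLinearMap.lTensor_tmul, TensorProduct.inner_tmul,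
      inner_levelVecOf, ite_mul, one_mul, zero_mul]
    refine if_congr eq_comm ?_ rfl
    rw [inner_toeplitzBUC_basisVec, inner_toeplitzBUC_basisVec, levelWeight, sum_blockDegree]
  · rw [sumVec_apply_of_ne α' α'' h, map_zero, if_neg]
    · exact (inner_zero_right (𝕜 := ℂ) (E := Summand d μ k _) _).symm
    · rintro e
      exact h (by rw [e])

/-! ### The semi-commutator ideal -/

lemma toeplitzBUC_mem_toeplitzAlgebra {d : ℕ} (μ : Weight) (c : BUC d) :
    toeplitzBUC μ c ∈ toeplitzAlgebra d μ :=
  StarSubalgebra.le_topologicalClosure _ (StarAlgebra.subset_adjoin ℂ _ ⟨c, rfl⟩)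

lemma isClosed_semiCommutatorIdeal (d : ℕ) (μ : Weight) :
    IsClosed (semiCommutatorIdeal d μ : Set (BergmanOp d μ)) :=
  Submodule.isClosed_topologicalClosure _

/-- Induction principle for the semi-commutator ideal, as a closed linear span. -/
lemma semiCommutatorIdeal_induction {d : ℕ} {μ : Weight} {P : BergmanOp d μ → Prop}
    (closed : IsClosed {N | P N}) (zero : P 0) (add : ∀ M N, P M → P N → P (M + N))
    (smul : ∀ (r : ℂ) N, P N → P (r • N))
    (gen : ∀ X ∈ toeplitzAlgebra d μ, ∀ Y ∈ toeplitzAlgebra d μ, ∀ a b : BUC d,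
      P (X * (toeplitzBUC μ a * toeplitzBUC μ b - toeplitzBUC μ (a * b)) * Y))
    {N : BergmanOp d μ} (hN : N ∈ semiCommutatorIdeal d μ) : P N := by
  refine closure_minimal (fun M hM => ?_) closed hN
  change P M
  induction hM using Submodule.span_induction with
  | mem M hM =>
    obtain ⟨X, hX, Y, hY, a, b, rfl⟩ := hM
    exact gen X hX Y hY a b
  | zero => exact zero
  | add M N _ _ hM hN => exact add M N hM hN
  | smul r M _ hM => exact smul r M hM

lemma generator_mem_semiCommutatorIdeal {d : ℕ} {μ : Weight} {X Y : BergmanOp d μ}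
    (hX : X ∈ toeplitzAlgebra d μ) (hY : Y ∈ toeplitzAlgebra d μ) (a b : BUC d) :
    X * (toeplitzBUC μ a * toeplitzBUC μ b - toeplitzBUC μ (a * b)) * Y ∈
      semiCommutatorIdeal d μ :=
  Submodule.le_topologicalClosure _ (Submodule.subset_span ⟨X, hX, Y, hY, a, b, rfl⟩)

lemma semiCommutator_mem_ideal {d : ℕ} (μ : Weight) (a b : BUC d) :
    toeplitzBUC μ a * toeplitzBUC μ b - toeplitzBUC μ (a * b) ∈ semiCommutatorIdeal d μ := by
  have h := generator_mem_semiCommutatorIdeal (one_mem (toeplitzAlgebra d μ)) (one_mem _) a b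
  rwa [one_mul, mul_one] at h

lemma mul_mem_semiCommutatorIdeal_left {d : ℕ} {μ : Weight} {Z N : BergmanOp d μ}
    (hZ : Z ∈ toeplitzAlgebra d μ) (hN : N ∈ semiCommutatorIdeal d μ) :
    Z * N ∈ semiCommutatorIdeal d μ := by
  refine semiCommutatorIdeal_induction (P := fun N => Z * N ∈ semiCommutatorIdeal d μ)
    ((isClosed_semiCommutatorIdeal d μ).preimage (continuous_const_mul Z)) ?_ ?_ ?_ ?_ hN
  · rw [mul_zero]
    exact zero_mem _
  · intro M N hM hN
    rw [mul_add]
    exact add_mem hM hN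
  · intro r N hN
    rw [mul_smul_comm]
    exact Submodule.smul_mem _ r hN
  · intro X hX Y hY a b
    rw [← mul_assoc, ← mul_assoc]
    exact generator_mem_semiCommutatorIdeal (mul_mem hZ hX) hY a b

lemma mul_mem_semiCommutatorIdeal_right {d : ℕ} {μ : Weight} {Z N : BergmanOp d μ}
    (hZ : Z ∈ toeplitzAlgebra d μ) (hN : N ∈ semiCommutatorIdeal d μ) :
    N * Z ∈ semiCommutatorIdeal d μ := by
  refine semiCommutatorIdeal_induction (P := fun N => N * Z ∈ semiCommutatorIdeal d μ)
    ((isClosed_semiCommutatorIdeal d μ).preimage (continuous_mul_const Z)) ?_ ?_ ?_ ?_ hN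
  · rw [zero_mul]
    exact zero_mem _
  · intro M N hM hN
    rw [add_mul]
    exact add_mem hM hN
  · intro r N hN
    rw [smul_mul_assoc]
    exact Submodule.smul_mem _ r hN
  · intro X hX Y hY a b
    rw [mul_assoc _ Y Z]
    exact generator_mem_semiCommutatorIdeal hX (mul_mem hY hZ) a b

lemma mem_toeplitzAlgebra_of_mem_semiCommutatorIdeal {d : ℕ} {μ : Weight} {N : BergmanOp d μ}
    (hN : N ∈ semiCommutatorIdeal d μ) : N ∈ toeplitzAlgebra d μ := by
  refine semiCommutatorIdeal_induction (P := fun N => N ∈ toeplitzAlgebra d μ)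
    (StarSubalgebra.isClosed_topologicalClosure _) (zero_mem _) (fun _ _ => add_mem)
    (fun r N hN => SMulMemClass.smul_mem r hN) (fun X hX Y hY a b => ?_) hN
  exact mul_mem (mul_mem hX (sub_mem
    (mul_mem (toeplitzBUC_mem_toeplitzAlgebra μ a) (toeplitzBUC_mem_toeplitzAlgebra μ b))
    (toeplitzBUC_mem_toeplitzAlgebra μ _))) hY

/-- The adjoint of a semi-commutator is a semi-commutator of the conjugate symbols in reverse
order. -/
lemma star_mem_semiCommutatorIdeal {d : ℕ} {μ : Weight} {N : BergmanOp d μ}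
    (hN : N ∈ semiCommutatorIdeal d μ) : star N ∈ semiCommutatorIdeal d μ := by
  refine semiCommutatorIdeal_induction (P := fun N => star N ∈ semiCommutatorIdeal d μ)
    ((isClosed_semiCommutatorIdeal d μ).preimage continuous_star) ?_ ?_ ?_ ?_ hN
  · rw [star_zero]
    exact zero_mem _
  · intro M N hM hN
    rw [star_add]
    exact add_mem hM hN
  · intro r N hN
    rw [star_smul]
    exact Submodule.smul_mem _ _ hN
  · intro X hX Y hY a b
    have h := generator_mem_semiCommutatorIdeal (star_mem hY) (star_mem hX) (conjBUC b) (conjBUC a)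
    rwa [← conjBUC_mul, ← star_toeplitzBUC, ← star_toeplitzBUC, ← star_toeplitzBUC, ← star_mul,
      ← star_sub, mul_assoc, ← star_mul, ← star_mul] at h

/-! ### Operators that are decomposed by the direct sum -/

section Decomposes

variable {ℓ d : ℕ} {μ : Weight} {k : Composition ℓ}
  {U : BergmanSpace (ℓ + d) μ ≃ₗᵢ[ℂ] DirectSumSpace d μ k}
  {T S : BergmanOp (ℓ + d) μ} {A B : ∀ ρ : Fin k.length → ℕ, BergmanOp d (levelWeight ℓ μ ρ)}

lemma DecomposesAs.add (hT : DecomposesAs U T A) (hS : DecomposesAs U S B) :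
    DecomposesAs U (T + S) fun ρ => A ρ + B ρ := by
  intro x ρ
  rw [ContinuousLinearMap.lTensor_add, add_apply, add_apply, map_add, ← hT x ρ, ← hS x ρ]
  rfl

lemma DecomposesAs.smul (r : ℂ) (hT : DecomposesAs U T A) :
    DecomposesAs U (r • T) fun ρ => r • A ρ := by
  intro x ρ
  rw [ContinuousLinearMap.lTensor_smul, smul_apply, smul_apply, map_smul, ← hT x ρ]
  rfl

lemma DecomposesAs.sub (hT : DecomposesAs U T A) (hS : DecomposesAs U S B) :
    DecomposesAs U (T - S) fun ρ => A ρ - B ρ := by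
  have := hT.add (hS.smul (-1))
  simpa only [neg_one_smul, ← sub_eq_add_neg] using this

lemma DecomposesAs.mul (hT : DecomposesAs U T A) (hS : DecomposesAs U S B) :
    DecomposesAs U (T * S) fun ρ => A ρ * B ρ := by
  intro x ρ
  have h := hT (U (S (U.symm x))) ρ
  rw [U.symm_apply_apply] at h
  rw [ContinuousLinearMap.lTensor_mul, mul_apply_eq_comp, mul_apply_eq_comp, h, hS x ρ]

lemma DecomposesAs.apply_single (hT : DecomposesAs U T A) (ρ : Fin k.length → ℕ)
    (w : Summand d μ k ρ) :
    U (T (U.symm (lp.single 2 ρ w))) =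
      lp.single 2 ρ ((A ρ).lTensor (levelSpace μ k ρ) w) := by
  refine lp.ext (funext fun σ => ?_)
  rw [hT]
  by_cases h : σ = ρ
  · subst h
    rw [lp.single_apply_self, lp.single_apply_self]
  · rw [lp.single_apply_ne _ _ _ h, lp.single_apply_ne _ _ _ h, map_zero]

lemma DecomposesAs.star (hT : DecomposesAs U T A) :
    DecomposesAs U (star T) fun ρ => star (A ρ) := by
  intro x ρ
  refine ext_inner_left ℂ fun w => ?_
  have h1 := lp.inner_single_left (𝕜 := ℂ) ρ w (U (Star.star T (U.symm x)))
  have h2 := lp.inner_single_left (𝕜 := ℂ) ρ ((A ρ).lTensor (levelSpace μ k ρ) w) x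
  refine h1.symm.trans ?_
  rw [← U.apply_symm_apply (lp.single 2 ρ w)]
  refine (inner_map_map_lp U _ _).trans ?_
  refine (ContinuousLinearMap.adjoint_inner_right T _ _).trans ?_
  rw [← inner_map_map_lp U, U.apply_symm_apply, hT.apply_single]
  refine h2.trans ?_
  have h3 := ContinuousLinearMap.adjoint_lTensor (E := levelSpace μ k ρ) (A ρ)
  refine (ContinuousLinearMap.adjoint_inner_right
    ((A ρ).lTensor (levelSpace μ k ρ)) w (x ρ)).symm.trans ?_
  rw [h3]
  rfl

/-- Each `ℋ_ρ` is nonzero, so that the components of a decomposed operator are bounded by its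
norm. -/
lemma DecomposesAs.norm_le (hT : DecomposesAs U T A) (ρ : Fin k.length → ℕ) : ‖A ρ‖ ≤ ‖T‖ := by
  obtain ⟨α, hα⟩ := exists_blockDegree_eq k ρ
  refine ContinuousLinearMap.opNorm_le_bound _ (norm_nonneg _) fun f => ?_
  set e := levelVecOf μ k α hα
  have he : ‖e‖ = 1 := (orthonormal_basisVec ℓ μ).1 α
  have h1 : ‖U (T (U.symm (lp.single 2 ρ (e ⊗ₜ[ℂ] f))))‖ ≤ ‖T‖ * ‖f‖ := by
    rw [U.norm_map]
    refine (T.le_opNorm _).trans (le_of_eq ?_)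
    rw [U.symm.norm_map, lp.norm_single (by norm_num), TensorProduct.norm_tmul, he, one_mul]
  rw [hT.apply_single, lp.norm_single (by norm_num), ContinuousLinearMap.lTensor_tmul,
    TensorProduct.norm_tmul, he, one_mul] at h1
  exact h1

lemma DecomposesAs.unique (hT : DecomposesAs U T A) (hS : DecomposesAs U T B)
    (ρ : Fin k.length → ℕ) : A ρ = B ρ := by
  have := (hT.sub hS).norm_le ρ
  rw [sub_self, norm_zero, norm_le_zero_iff, sub_eq_zero] at this
  exact this

/-- Decompositions pass to norm limits. -/
lemma DecomposesAs.of_tendsto {T : ℕ → BergmanOp (ℓ + d) μ}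
    {A : ℕ → ∀ ρ : Fin k.length → ℕ, BergmanOp d (levelWeight ℓ μ ρ)}
    (h : ∀ n, DecomposesAs U (T n) (A n)) (hT : Tendsto T atTop (𝓝 S))
    (hA : ∀ ρ, Tendsto (fun n => A n ρ) atTop (𝓝 (B ρ))) : DecomposesAs U S B := by
  intro x ρ
  have h1 : Tendsto (fun n => (U (T n (U.symm x)) : ∀ ρ, Summand d μ k ρ) ρ) atTop
      (𝓝 ((U (S (U.symm x)) : ∀ ρ, Summand d μ k ρ) ρ)) := by
    have h2 : Tendsto (fun n => T n (U.symm x)) atTop (𝓝 (S (U.symm x))) :=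
      ((ContinuousLinearMap.apply ℂ _ (U.symm x)).continuous.tendsto S).comp hT
    exact ((sumProj d μ k ρ).continuous.tendsto _).comp ((U.continuous.tendsto _).comp h2)
  refine tendsto_nhds_unique h1 ?_
  simp only [fun n => h n x ρ]
  rw [tendsto_iff_norm_sub_tendsto_zero]
  refine squeeze_zero (fun _ => norm_nonneg _) (g := fun n => ‖A n ρ - B ρ‖ * ‖x ρ‖) (fun n => ?_) ?_
  · rw [← sub_apply, ← ContinuousLinearMap.lTensor_sub]
    refine (((A n ρ - B ρ).lTensor (levelSpace μ k ρ)).le_opNorm (x ρ)).trans ?_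
    gcongr
    exact ContinuousLinearMap.norm_lTensor_le _ _
  · have := (tendsto_iff_norm_sub_tendsto_zero.1 (hA ρ)).mul_const ‖x ρ‖
    rwa [zero_mul] at this

end Decomposes

/-! ### The represented operators form a C*-algebra -/

/-- `BUC` is closed under uniform limits. -/
lemma mem_BUC_of_approx {d : ℕ} {c : Ball d → ℂ}
    (h : ∀ ε > 0, ∃ b : BUC d, ∀ z, ‖(b : Ball d → ℂ) z - c z‖ ≤ ε) : c ∈ BUC d := by
  refine ⟨?_, fun ε hε => ?_⟩
  · obtain ⟨b, hb⟩ := h 1 one_pos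
    obtain ⟨C, hC⟩ := b.2.1
    refine ⟨C + 1, fun z => ?_⟩
    have := norm_sub_norm_le (c z) ((b : Ball d → ℂ) z)
    rw [norm_sub_rev] at this
    linarith [hb z, hC z]
  · obtain ⟨b, hb⟩ := h (ε / 3) (by positivity)
    obtain ⟨δ, hδ, hδ'⟩ := b.2.2 (ε / 3) (by positivity)
    refine ⟨δ, hδ, fun z w hzw => ?_⟩
    have e : c z - c w = -((b : Ball d → ℂ) z - c z) + ((b : Ball d → ℂ) z - (b : Ball d → ℂ) w) +
        ((b : Ball d → ℂ) w - c w) := by ring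
    rw [e]
    refine (norm_add₃_le).trans_lt ?_
    rw [norm_neg]
    linarith [hb z, hb w, hδ' z w hzw]

section Representation

variable {ℓ d : ℕ} {μ : Weight} {k : Composition ℓ}
  {U : BergmanSpace (ℓ + d) μ ≃ₗᵢ[ℂ] DirectSumSpace d μ k}
  {T S : BergmanOp (ℓ + d) μ}

lemma neBot_comap_sum (hk : 0 < k.length) :
    (comap (fun ρ : Fin k.length → ℕ => ∑ j, ρ j) atTop).NeBot :=
  atTop_neBot.comap_of_surj (exists_sum_eq hk)

/-- The symbol is bounded by the norm of the represented operator, as the remainders vanish in the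
limit. -/
lemma norm_symbol_le_of_decomposesAs (hk : 0 < k.length) {c : BUC d}
    {N : ∀ ρ : Fin k.length → ℕ, BergmanOp d (levelWeight ℓ μ ρ)}
    (h : DecomposesAs U T fun ρ => toeplitzBUC (levelWeight ℓ μ ρ) c + N ρ)
    (hN : Tendsto (fun ρ => ‖N ρ‖) (comap (fun ρ => ∑ j, ρ j) atTop) (𝓝 0)) (z : Ball d) :
    ‖(c : Ball d → ℂ) z‖ ≤ ‖T‖ := by
  have := neBot_comap_sum hk
  refine le_of_forall_pos_le_add fun ε hε => ?_
  have h1 : Tendsto (fun ρ : Fin k.length → ℕ => (∑ j, ρ j) + ℓ)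
      (comap (fun ρ => ∑ j, ρ j) atTop) atTop :=
    (tendsto_add_atTop_nat ℓ).comp tendsto_comap
  have h2 := h1.eventually (eventually_norm_symbol_le μ c (half_pos hε))
  obtain ⟨ρ, h3, h4⟩ := (h2.and (hN.eventually_le_const (half_pos hε))).exists
  have h5 := h.norm_le ρ
  have h6 : ‖toeplitzBUC (levelWeight ℓ μ ρ) c‖ ≤
      ‖toeplitzBUC (levelWeight ℓ μ ρ) c + N ρ‖ + ‖N ρ‖ := by
    have := norm_sub_le (toeplitzBUC (levelWeight ℓ μ ρ) c + N ρ) (N ρ)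
    rwa [add_sub_cancel_right] at this
  linarith [h3 z]

/-- The difference of two representations of `T` represents `0`, so that the symbols agree; the
remainders are then determined because all components of a decomposed operator are. -/
lemma IsRepresentation.unique (hk : 0 < k.length) {c c' : BUC d}
    {N N' : ∀ ρ : Fin k.length → ℕ, BergmanOp d (levelWeight ℓ μ ρ)}
    (h : IsRepresentation U T c N) (h' : IsRepresentation U T c' N') : c' = c ∧ N' = N := by
  have hc : c' = c := by
    have h1 := h'.decomposes.sub h.decomposes
    have h2 : DecomposesAs U (T - T)
        fun ρ => toeplitzBUC (levelWeight ℓ μ ρ) (c' - c) + (N' ρ - N ρ) := by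
      convert h1 using 2 with ρ
      rw [toeplitzBUC_sub]
      abel
    have h3 : Tendsto (fun ρ => ‖N' ρ - N ρ‖) (comap (fun ρ => ∑ j, ρ j) atTop) (𝓝 0) := by
      have h4 := h'.tendsto_zero.add h.tendsto_zero
      rw [add_zero] at h4
      exact squeeze_zero (fun _ => norm_nonneg _) (fun _ => norm_sub_le _ _) h4
    ext z
    have h5 := norm_symbol_le_of_decomposesAs hk h2 h3 z
    rw [sub_self, norm_zero, norm_le_zero_iff] at h5
    exact sub_eq_zero.1 h5
  subst hc
  refine ⟨rfl, funext fun ρ => ?_⟩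
  exact add_left_cancel (h'.decomposes.unique h.decomposes ρ)

/-- `U T U⁻¹ = ⨁_ρ I ⊗ (T_c + N_|ρ|)` with `N_p` in the semi-commutator ideals and `‖N_p‖ → 0`. -/
structure IsLevelRepresentation (U : BergmanSpace (ℓ + d) μ ≃ₗᵢ[ℂ] DirectSumSpace d μ k)
    (T : BergmanOp (ℓ + d) μ) (c : BUC d) (N : ∀ p : ℕ, BergmanOp d (μ.shift (p + ℓ))) : Prop where
  decomposes : DecomposesAs U T fun ρ => toeplitzBUC (levelWeight ℓ μ ρ) c + N (∑ j, ρ j)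
  mem_ideal : ∀ p, N p ∈ semiCommutatorIdeal d (μ.shift (p + ℓ))
  tendsto_zero : Tendsto (fun p => ‖N p‖) atTop (𝓝 0)

namespace IsLevelRepresentation

variable {c b : BUC d} {N M : ∀ p : ℕ, BergmanOp d (μ.shift (p + ℓ))}

lemma isRepresentation (h : IsLevelRepresentation U T c N) :
    IsRepresentation U T c fun ρ => N (∑ j, ρ j) where
  decomposes := h.decomposes
  mem_ideal _ := h.mem_ideal _
  tendsto_zero := h.tendsto_zero.comp tendsto_comap

lemma add (h : IsLevelRepresentation U T c N) (h' : IsLevelRepresentation U S b M) :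
    IsLevelRepresentation U (T + S) (c + b) fun p => N p + M p where
  decomposes := by
    convert h.decomposes.add h'.decomposes using 2 with ρ
    rw [toeplitzBUC_add]
    abel
  mem_ideal p := add_mem (h.mem_ideal p) (h'.mem_ideal p)
  tendsto_zero := by
    have h1 := h.tendsto_zero.add h'.tendsto_zero
    rw [add_zero] at h1
    exact squeeze_zero (fun _ => norm_nonneg _) (fun _ => norm_add_le _ _) h1

lemma smul (r : ℂ) (h : IsLevelRepresentation U T c N) :
    IsLevelRepresentation U (r • T) (r • c) fun p => r • N p where
  decomposes := by
    convert h.decomposes.smul r using 2 with ρ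
    rw [toeplitzBUC_smul, smul_add]
  mem_ideal p := Submodule.smul_mem _ r (h.mem_ideal p)
  tendsto_zero := by
    have h1 := h.tendsto_zero.const_mul ‖r‖
    rw [mul_zero] at h1
    simpa only [norm_smul] using h1

lemma sub (h : IsLevelRepresentation U T c N) (h' : IsLevelRepresentation U S b M) :
    IsLevelRepresentation U (T - S) (c - b) fun p => N p - M p := by
  have := h.add (h'.smul (-1))
  simpa only [neg_one_smul, ← sub_eq_add_neg] using this

/-- Products: the remainder of `(T_c + N)(T_b + M)` is `(T_c T_b - T_cb) + T_c M + N T_b + N M`. -/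
lemma mul (h : IsLevelRepresentation U T c N) (h' : IsLevelRepresentation U S b M) :
    IsLevelRepresentation U (T * S) (c * b) fun p =>
      (toeplitzBUC (μ.shift (p + ℓ)) c * toeplitzBUC (μ.shift (p + ℓ)) b -
        toeplitzBUC (μ.shift (p + ℓ)) (c * b)) + toeplitzBUC (μ.shift (p + ℓ)) c * M p +
        N p * toeplitzBUC (μ.shift (p + ℓ)) b + N p * M p where
  decomposes := by
    convert h.decomposes.mul h'.decomposes using 2 with ρ
    rw [mul_add, add_mul, add_mul]
    abel
  mem_ideal p := add_mem (add_mem (add_mem (semiCommutator_mem_ideal _ _ _)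
    (mul_mem_semiCommutatorIdeal_left (toeplitzBUC_mem_toeplitzAlgebra _ _) (h'.mem_ideal p)))
    (mul_mem_semiCommutatorIdeal_right (toeplitzBUC_mem_toeplitzAlgebra _ _) (h.mem_ideal p)))
    (mul_mem_semiCommutatorIdeal_right
      (mem_toeplitzAlgebra_of_mem_semiCommutatorIdeal (h'.mem_ideal p)) (h.mem_ideal p))
  tendsto_zero := by
    obtain ⟨C, hC⟩ := c.2.1
    obtain ⟨B, hB⟩ := b.2.1
    have hC' : ∀ p, ‖toeplitzBUC (μ.shift (p + ℓ)) c‖ ≤ max C 0 := fun p =>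
      norm_toeplitzBUC_le _ c (le_max_right _ _) fun z => (hC z).trans (le_max_left _ _)
    have hB' : ∀ p, ‖toeplitzBUC (μ.shift (p + ℓ)) b‖ ≤ max B 0 := fun p =>
      norm_toeplitzBUC_le _ b (le_max_right _ _) fun z => (hB z).trans (le_max_left _ _)
    have h1 := (((tendsto_norm_semiCommutator μ c b).comp (tendsto_add_atTop_nat ℓ)).add
      (h'.tendsto_zero.const_mul (max C 0))).add (h.tendsto_zero.mul_const (max B 0)) |>.add
      (h.tendsto_zero.mul h'.tendsto_zero)
    simp only [mul_zero, zero_mul, add_zero] at h1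
    refine squeeze_zero (fun _ => norm_nonneg _) (fun p => ?_) h1
    refine (norm_add_le _ _).trans (add_le_add ((norm_add_le _ _).trans (add_le_add
      ((norm_add_le _ _).trans (add_le_add le_rfl ?_)) ?_)) (norm_mul_le _ _))
    · exact (norm_mul_le _ _).trans (mul_le_mul_of_nonneg_right (hC' p) (norm_nonneg _))
    · exact (norm_mul_le _ _).trans (mul_le_mul_of_nonneg_left (hB' p) (norm_nonneg _))

lemma star (h : IsLevelRepresentation U T c N) :
    IsLevelRepresentation U (star T) (conjBUC c) fun p => Star.star (N p) where
  decomposes := by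
    convert h.decomposes.star using 2 with ρ
    rw [star_add, star_toeplitzBUC]
  mem_ideal p := star_mem_semiCommutatorIdeal (h.mem_ideal p)
  tendsto_zero := by simpa only [norm_star] using h.tendsto_zero

lemma toeplitzLifted (hU : IsDecomposition U) (c : BUC d) :
    IsLevelRepresentation U (toeplitzLifted ℓ μ c) c fun _ => 0 where
  decomposes := by simpa only [add_zero] using decomposesAs_toeplitzLifted hU c
  mem_ideal _ := zero_mem _
  tendsto_zero := by simp

lemma one (U : BergmanSpace (ℓ + d) μ ≃ₗᵢ[ℂ] DirectSumSpace d μ k) :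
    IsLevelRepresentation U 1 1 fun _ => 0 where
  decomposes := by
    intro x ρ
    beta_reduce
    rw [toeplitzBUC_one, add_zero, ContinuousLinearMap.lTensor_one, one_apply_eq_self,
      one_apply_eq_self, U.apply_symm_apply]
  mem_ideal _ := zero_mem _
  tendsto_zero := by simp

lemma norm_symbol_le (hk : 0 < k.length) (h : IsLevelRepresentation U T c N) (z : Ball d) :
    ‖(c : Ball d → ℂ) z‖ ≤ ‖T‖ :=
  norm_symbol_le_of_decomposesAs hk h.decomposes h.isRepresentation.tendsto_zero z

/-- The remainder is the difference of the component of `T` and a Toeplitz operator, both of norm at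
most `‖T‖`. -/
lemma norm_remainder_le (hk : 0 < k.length) (h : IsLevelRepresentation U T c N) (p : ℕ) :
    ‖N p‖ ≤ 2 * ‖T‖ := by
  obtain ⟨ρ, rfl⟩ := exists_sum_eq hk p
  have h1 := h.decomposes.norm_le ρ
  have h2 : ‖toeplitzBUC (levelWeight ℓ μ ρ) c‖ ≤ ‖T‖ :=
    norm_toeplitzBUC_le _ c (norm_nonneg _) (h.norm_symbol_le hk)
  have h3 := norm_sub_le (toeplitzBUC (levelWeight ℓ μ ρ) c + N (∑ j, ρ j))
    (toeplitzBUC (levelWeight ℓ μ ρ) c)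
  rw [add_sub_cancel_left] at h3
  linarith

/-- Norm limits of represented operators are represented: symbols and remainders converge
uniformly. -/
lemma exists_of_tendsto (hk : 0 < k.length) {T : ℕ → BergmanOp (ℓ + d) μ} {c : ℕ → BUC d}
    {N : ℕ → ∀ p : ℕ, BergmanOp d (μ.shift (p + ℓ))}
    (h : ∀ n, IsLevelRepresentation U (T n) (c n) (N n)) (hT : Tendsto T atTop (𝓝 S)) :
    ∃ c N, IsLevelRepresentation U S c N := by
  have hcauchy : ∀ ε > 0, ∃ K, ∀ m ≥ K, ∀ n ≥ K, ‖T m - T n‖ < ε := by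
    have := Metric.cauchySeq_iff.1 hT.cauchySeq
    simpa only [dist_eq_norm] using this
  have hlim : ∀ n, Tendsto (fun m => ‖T n - T m‖) atTop (𝓝 ‖T n - S‖) := fun n =>
    (tendsto_const_nhds.sub hT).norm
  have hS : Tendsto (fun n => ‖T n - S‖) atTop (𝓝 0) := tendsto_iff_norm_sub_tendsto_zero.1 hT
  have hc : ∀ m n z, ‖(c m : Ball d → ℂ) z - (c n : Ball d → ℂ) z‖ ≤ ‖T m - T n‖ := fun m n z =>
    ((h m).sub (h n)).norm_symbol_le hk z
  have hN : ∀ m n p, ‖N m p - N n p‖ ≤ 2 * ‖T m - T n‖ := fun m n p =>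
    ((h m).sub (h n)).norm_remainder_le hk p
  have hc' : ∀ z, ∃ y, Tendsto (fun n => (c n : Ball d → ℂ) z) atTop (𝓝 y) := by
    intro z
    refine cauchySeq_tendsto_of_complete (Metric.cauchySeq_iff.2 fun ε hε => ?_)
    obtain ⟨K, hK⟩ := hcauchy ε hε
    refine ⟨K, fun m hm n hn => ?_⟩
    rw [dist_eq_norm]
    exact (hc m n z).trans_lt (hK m hm n hn)
  have hN' : ∀ p, ∃ M, Tendsto (fun n => N n p) atTop (𝓝 M) := by
    intro p
    refine cauchySeq_tendsto_of_complete (Metric.cauchySeq_iff.2 fun ε hε => ?_)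
    obtain ⟨K, hK⟩ := hcauchy (ε / 2) (by positivity)
    refine ⟨K, fun m hm n hn => ?_⟩
    rw [dist_eq_norm]
    exact (hN m n p).trans_lt (by linarith [hK m hm n hn])
  choose b hb using hc'
  choose M hM using hN'
  have hcb : ∀ n z, ‖(c n : Ball d → ℂ) z - b z‖ ≤ ‖T n - S‖ := fun n z =>
    le_of_tendsto_of_tendsto' (tendsto_const_nhds.sub (hb z)).norm (hlim n) fun m => hc n m z
  have hNM : ∀ n p, ‖N n p - M p‖ ≤ 2 * ‖T n - S‖ := fun n p =>
    le_of_tendsto_of_tendsto' (tendsto_const_nhds.sub (hM p)).norm ((hlim n).const_mul 2)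
      fun m => hN n m p
  have hbB : b ∈ BUC d := mem_BUC_of_approx fun ε hε => by
    obtain ⟨n, hn⟩ := (hS.eventually_le_const hε).exists
    exact ⟨c n, fun z => (hcb n z).trans hn⟩
  refine ⟨⟨b, hbB⟩, M, ?_, fun p => ?_, ?_⟩
  · refine DecomposesAs.of_tendsto (fun n => (h n).decomposes) hT fun ρ => ?_
    refine Tendsto.add ?_ (hM _)
    rw [tendsto_iff_norm_sub_tendsto_zero]
    refine squeeze_zero (fun _ => norm_nonneg _) (fun n => ?_) hS
    rw [← toeplitzBUC_sub]
    exact norm_toeplitzBUC_le _ _ (norm_nonneg _) (hcb n)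
  · exact (isClosed_semiCommutatorIdeal d _).mem_of_tendsto (hM p)
      (Eventually.of_forall fun n => (h n).mem_ideal p)
  · rw [Metric.tendsto_atTop]
    intro ε hε
    obtain ⟨n, hn⟩ := (hS.eventually_lt_const (show (0 : ℝ) < ε / 4 by positivity)).exists
    obtain ⟨P, hP⟩ := eventually_atTop.1
      ((h n).tendsto_zero.eventually_lt_const (show (0 : ℝ) < ε / 2 by positivity))
    refine ⟨P, fun p hp => ?_⟩
    rw [dist_zero_right, norm_norm]
    have h1 := norm_sub_norm_le (M p) (N n p)
    rw [norm_sub_rev] at h1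
    linarith [hNM n p, hP p hp]

end IsLevelRepresentation

/-- The operators with a representation `⨁_ρ I ⊗ (T_c + N_|ρ|)`, as a star subalgebra. -/
def representedOperators (U : BergmanSpace (ℓ + d) μ ≃ₗᵢ[ℂ] DirectSumSpace d μ k) :
    StarSubalgebra ℂ (BergmanOp (ℓ + d) μ) where
  carrier := {T | ∃ c N, IsLevelRepresentation U T c N}
  mul_mem' := by
    rintro T S ⟨c, N, h⟩ ⟨b, M, h'⟩
    exact ⟨_, _, h.mul h'⟩
  add_mem' := by
    rintro T S ⟨c, N, h⟩ ⟨b, M, h'⟩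
    exact ⟨_, _, h.add h'⟩
  algebraMap_mem' r := by
    rw [Algebra.algebraMap_eq_smul_one]
    exact ⟨_, _, (IsLevelRepresentation.one U).smul r⟩
  star_mem' := by
    rintro T ⟨c, N, h⟩
    exact ⟨_, _, h.star⟩

lemma isClosed_representedOperators (hk : 0 < k.length) :
    IsClosed (representedOperators U : Set (BergmanOp (ℓ + d) μ)) := by
  refine IsSeqClosed.isClosed fun T S hT hlim => ?_
  choose c N h using hT
  exact IsLevelRepresentation.exists_of_tendsto hk h hlim

lemma liftedToeplitzAlgebra_le (hk : 0 < k.length) (hU : IsDecomposition U) :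
    liftedToeplitzAlgebra ℓ d μ ≤ representedOperators U := by
  refine StarSubalgebra.topologicalClosure_minimal (StarAlgebra.adjoin_le ?_)
    (isClosed_representedOperators hk)
  rintro _ ⟨c, rfl⟩
  exact ⟨_, _, IsLevelRepresentation.toeplitzLifted hU c⟩

end Representation

end

end BergmanToeplitz

theorem mainTheorem4 (ℓ d : ℕ) (hℓ : 1 ≤ ℓ) (hd : 1 ≤ d) (k : Composition ℓ)
    (lam : BergmanToeplitz.Weight) :
    (∃! U : BergmanToeplitz.BergmanSpace (ℓ + d) lam ≃ₗᵢ[ℂ] BergmanToeplitz.DirectSumSpace d lam k,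
      BergmanToeplitz.IsDecomposition U) ∧
    ∀ U : BergmanToeplitz.BergmanSpace (ℓ + d) lam ≃ₗᵢ[ℂ] BergmanToeplitz.DirectSumSpace d lam k,
      BergmanToeplitz.IsDecomposition U →
      ∀ T ∈ BergmanToeplitz.liftedToeplitzAlgebra ℓ d lam,
        ∃ (c : BergmanToeplitz.BUC d)
          (N : ∀ p : ℕ, BergmanToeplitz.BergmanOp d (lam.shift (p + ℓ))),
          BergmanToeplitz.IsRepresentation U T c (fun ρ => N (∑ j, ρ j)) ∧
          ∀ (c' : BergmanToeplitz.BUC d)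
            (N' : ∀ ρ : Fin k.length → ℕ,
              BergmanToeplitz.BergmanOp d (BergmanToeplitz.levelWeight ℓ lam ρ)),
            BergmanToeplitz.IsRepresentation U T c' N' →
              c' = c ∧ ∀ ρ, N' ρ = N (∑ j, ρ j) := by
  have hk : 0 < k.length := k.length_pos_of_pos hℓ
  refine ⟨BergmanToeplitz.existsUnique_isDecomposition ℓ d lam k, fun U hU T hT => ?_⟩
  obtain ⟨c, N, h⟩ := BergmanToeplitz.liftedToeplitzAlgebra_le hk hU hT
  refine ⟨c, N, h.isRepresentation, fun c' N' h' => ?_⟩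
  obtain ⟨h1, h2⟩ := h.isRepresentation.unique hk h'
  exact ⟨h1, fun ρ => congrFun h2 ρ⟩
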